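/- Let $V$ be a real polynomial of even degree $D\ge 2$ with leading coefficient $\gamma>0$, and let $n\ge 0$ be an integer. **Polynomials.** For real polynomials put $\langle P,Q\rangle_4=\frac12\int_{\mathbb R}(PQ'-P'Q)e^{-2V}\,dx$. A sequence of monic real polynomials $(P_k)_{k\ge 0}$ with $\deg P_k=k$ is called skew-orthogonal if $\langle P_{2k},P_{2m}\rangle_4=\langle P_{2k+1},P_{2m+1}\rangle_4=0$ for all $k,m$ and $\langle P_{2k},P_{2m+1}\rangle_4=0$ for all $k\ne m$. For such a sequence put $h_k=\langle P_{2k},P_{2k+1}\rangle_4$ and let $\Psi_k=-\frac1{\gamma D}e^{V}\frac{d}{dx}\left(e^{-V}P_k\right)$, a polynomial. **Contours.** Let $C_k=e^{2\pi i k/D}[0,\infty)$ for $0\le k\le D-1$, where $C_0$ is oriented away from the origin and the other $C_k$ towards it, $\Gamma_j=C_0\cup C_j$ for $1\le j\le D-1$, and $\Gamma=\bigcup_{j=1}^{D-1}\Gamma_j$. For $\Sigma=\mathbb R$ (oriented from left to right) or $\Sigma=\Gamma_j$ let $C_{\Sigma}(f)(z)=\frac1{2\pi i}\int_{\Sigma}\frac{f(x)}{x-z}\,dx$.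 Let $\chi_\Sigma$ be the indicator function of $\Sigma$. **Even Riemann–Hilbert problem.** Find $A:\mathbb C\setminus\Gamma\to\mathcal M_{D+1}(\mathbb C)$ such that 1. $A$ is analytic on $\mathbb C\setminus\Gamma$; 2. at every $x\in\Gamma\setminus\{0\}$ the non-tangential limits $A^{+}(x)$ and $A^-(x)$ of $A$ from the left and from the right of the oriented contour exist, and $A^{\pm}$ are continuous on $\Gamma\setminus\{0\}$; 3. $A$ is bounded in a neighbourhood of every point of $\Gamma$, in particular of $0$; 4. $A^+(x)=A^-(x)J(x)$ for $x\in\Gamma\setminus\{0\}$, where $J(x)$ is the identity matrix except that its first row is $\left(1,\ e^{-2V}\chi_{\mathbb R},\ e^{-V}\chi_{\Gamma_1},\ \dots,\ e^{-V}\chi_{\Gamma_{D-1}}\right)$, evaluated at $x$; 5. $A(z)=\left(\mathbb I+\mathcal O(z^{-1})\right)\mathrm{diag}\left(z^{2n+D-1},z^{-2n},z^{-1},\dots,z^{-1}\right)$ as $z\to\infty$ in $\mathbb C\setminus\Gamma$. **Theorem.** A skew-orthogonal sequence exists. For each $j=1,\dots,D-1$ there is exactly one complex polynomial $R^{(j)}_n$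 of degree at most $2n+D-2$ such that $\int_{\mathbb R}x^l R^{(j)}_n e^{-2V}\,dx=0$ for $0\le l\le 2n-1$ and $-\frac1{2\pi i}\int_{\Gamma_k}R^{(j)}_n e^{-V}\,dz=\delta_{kj}$ for $1\le k\le D-1$. For every skew-orthogonal sequence the following holds. If $n\ge1$, then $h_{n-1}\neq0$ and the even Riemann–Hilbert problem has exactly one solution, namely $$A_n=\begin{pmatrix}\Psi_{2n}&C_{\mathbb R}(e^{-2V}\Psi_{2n})&C_{\Gamma_1}(e^{-V}\Psi_{2n})&\cdots&C_{\Gamma_{D-1}}(e^{-V}\Psi_{2n})\\ \tilde Q&C_{\mathbb R}(e^{-2V}\tilde Q)&C_{\Gamma_1}(e^{-V}\tilde Q)&\cdots&C_{\Gamma_{D-1}}(e^{-V}\tilde Q)\\ R^{(1)}_n&C_{\mathbb R}(e^{-2V}R^{(1)}_n)&C_{\Gamma_1}(e^{-V}R^{(1)}_n)&\cdots&C_{\Gamma_{D-1}}(e^{-V}R^{(1)}_n)\\ \vdots&\vdots&\vdots&&\vdots\\ R^{(D-1)}_n&C_{\mathbb R}(e^{-2V}R^{(D-1)}_n)&C_{\Gamma_1}(e^{-V}R^{(D-1)}_n)&\cdots&C_{\Gamma_{D-1}}(e^{-V}R^{(D-1)}_n)\end{pmatrix},\qquad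 \tilde Q=-\frac{2\pi i\gamma D}{h_{n-1}}\Psi_{2n-2}.$$ If $n=0$, the problem also has exactly one solution $A_0$, given by the same formula with the second row replaced by $(0,1,0,\dots,0)$. In all cases $\det A_n(z)=1$ for all $z\in\mathbb C\setminus\Gamma$. -/

import Mathlib

open Polynomial Filter Topology

noncomputable section

namespace SymplecticRHP

/-! ### Skew-orthogonal polynomials of symplectic type and their duals -/

/-- `⟨P, Q⟩₄ = (1/2) ∫_ℝ (P Q' - P' Q) e^{-2V} dx`. -/
def skewProd (V P Q : ℝ[X]) : ℝ :=
  (1 / 2) * ∫ x : ℝ,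
    (P.eval x * (derivative Q).eval x - (derivative P).eval x * Q.eval x)
      * Real.exp (-2 * V.eval x)

/-- A sequence of monic real polynomials, `deg P n = n`, skew-orthogonal for `⟨·,·⟩₄`. -/
structure IsSkewOrthogonal (V : ℝ[X]) (P : ℕ → ℝ[X]) : Prop where
  monic : ∀ n, (P n).Monic
  natDegree_eq : ∀ n, (P n).natDegree = n
  even_even : ∀ n m, skewProd V (P (2 * n)) (P (2 * m)) = 0
  odd_odd : ∀ n m, skewProd V (P (2 * n + 1)) (P (2 * m + 1)) = 0
  even_odd : ∀ n m, n ≠ m → skewProd V (P (2 * n)) (P (2 * m + 1)) = 0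

/-- The skew norm `h_n = ⟨P_{2n}, P_{2n+1}⟩₄`. -/
def skewNorm (V : ℝ[X]) (P : ℕ → ℝ[X]) (n : ℕ) : ℝ :=
  skewProd V (P (2 * n)) (P (2 * n + 1))

/-- The dual of `p`, i.e. the polynomial `-(γ D)⁻¹ e^V (e^{-V} p)'`, written out;
see `dual_eval`. Here `γ` and `D` are the leading coefficient and the degree of `V`. -/
def dual (V p : ℝ[X]) : ℝ[X] :=
  C (-(V.leadingCoeff * (V.natDegree : ℝ))⁻¹) * (derivative p - derivative V * p)

theorem dual_eval (V p : ℝ[X]) (x : ℝ) :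
    (dual V p).eval x = -(V.leadingCoeff * (V.natDegree : ℝ))⁻¹ *
      (Real.exp (V.eval x) * deriv (fun y : ℝ => Real.exp (-V.eval y) * p.eval y) x) := by
  have h := ((V.hasDerivAt x).neg.exp).mul (p.hasDerivAt x)
  have h' : HasDerivAt (fun y : ℝ => Real.exp (-V.eval y) * p.eval y) _ x := h
  rw [h'.deriv]
  have e : Real.exp (V.eval x) * Real.exp (-V.eval x) = 1 := by
    rw [← Real.exp_add]; simp
  simp only [dual, eval_mul, eval_C, eval_sub]
  linear_combination (V.leadingCoeff * (V.natDegree : ℝ))⁻¹ *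
    (eval x (derivative p) - eval x (derivative V) * eval x p) * e

/-! ### Contours -/

/-- The unit vector `e^{2π i k / D}`. -/
def dir (D k : ℕ) : ℂ := Complex.exp (2 * Real.pi * Complex.I * k / D)

/-- The ray `C_k = e^{2π i k / D} [0, ∞)`. -/
def ray (D k : ℕ) : Set ℂ := {z | ∃ t : ℝ, 0 ≤ t ∧ z = t * dir D k}

/-- `Γ_j = C_0 ∪ C_j` as a set. -/
def contour (D j : ℕ) : Set ℂ := ray D 0 ∪ ray D j

/-- `Γ = Γ_1 ∪ … ∪ Γ_{D-1}` as a set. -/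
def Gam (D : ℕ) : Set ℂ := ⋃ j ∈ Set.Icc 1 (D - 1), contour D j

/-- The real line in `ℂ`. -/
def realLine : Set ℂ := Set.range ((↑) : ℝ → ℂ)

/-- Unit tangent of `C_k`: `C_0` is oriented away from the origin, the other rays towards it. -/
def tangent (D k : ℕ) : ℂ := if k = 0 then dir D 0 else -dir D k

/-- `∫ f(z) dz` over `C_k`, directed away from the origin. -/
def rayIntegral (D k : ℕ) (f : ℂ → ℂ) : ℂ :=
  ∫ t in Set.Ioi (0 : ℝ), f (t * dir D k) * dir D k

/-- `∫_{Γ_j} f(z) dz`: in along `C_j`, then out along `C_0`. -/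
def contourIntegral (D j : ℕ) (f : ℂ → ℂ) : ℂ :=
  rayIntegral D 0 f - rayIntegral D j f

/-- The Cauchy transform over `ℝ`. -/
def cauchyReal (f : ℂ → ℂ) (z : ℂ) : ℂ :=
  (2 * Real.pi * Complex.I)⁻¹ * ∫ x : ℝ, f x / (x - z)

/-- The Cauchy transform over `Γ_j`. -/
def cauchyContour (D j : ℕ) (f : ℂ → ℂ) (z : ℂ) : ℂ :=
  (2 * Real.pi * Complex.I)⁻¹ * contourIntegral D j (fun x => f x / (x - z))

/-! ### The even Riemann-Hilbert problem -/

/-- Rows and columns are numbered `0, …, D`; column `0` is that of the polynomials, column `1` that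
of `ℝ`, and column `j ≥ 2` that of `Γ_{j-1}`. This is the weight `e^{-2V}` or `e^{-V}` of column
`j ≥ 1`. -/
def weight (V : ℝ[X]) (j : ℕ) (x : ℂ) : ℂ :=
  if j = 1 then Complex.exp (-2 * aeval x V) else Complex.exp (-aeval x V)

/-- The part of the contour on which column `j ≥ 1` jumps: `ℝ` or `Γ_{j-1}`. -/
def support (D j : ℕ) : Set ℂ := if j = 1 then realLine else contour D (j - 1)

/-- The jump matrix: the identity, except that its first row is
`(1, e^{-2V} χ_ℝ, e^{-V} χ_{Γ_1}, …, e^{-V} χ_{Γ_{D-1}})`. -/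
def jump (V : ℝ[X]) (x : ℂ) : Matrix (Fin (V.natDegree + 1)) (Fin (V.natDegree + 1)) ℂ :=
  Matrix.of fun i j =>
    if i = j then 1
    else if i.val = 0 then (support V.natDegree j).indicator (weight V j) x
    else 0

/-- `diag(z^{2n+D-1}, z^{-2n}, z^{-1}, …, z^{-1})`. -/
def normMatrix (D n : ℕ) (z : ℂ) : Matrix (Fin (D + 1)) (Fin (D + 1)) ℂ :=
  Matrix.diagonal fun j =>
    z ^ (if j.val = 0 then 2 * (n : ℤ) + D - 1 else if j.val = 1 then -(2 * (n : ℤ)) else -1)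

/-- The infinite cone at `x ∈ C_k` with axis the normal to the left (`s = 1`) or to the right
(`s = -1`) of the oriented ray `C_k`; it is a proper cone for `0 < c < 1`. -/
def cone (D k : ℕ) (s c : ℝ) (x : ℂ) : Set ℂ :=
  {z | c * ‖z - x‖ < s * ((z - x) / tangent D k).im}

/-- `B` is the non-tangential boundary value of `A` on `Γ \ {0}` from the left (`s = 1`) or from
the right (`s = -1`). -/
def IsBoundaryValue {D : ℕ} (s : ℝ) (A B : ℂ → Matrix (Fin (D + 1)) (Fin (D + 1)) ℂ) : Prop :=
  ∀ k < D, ∀ x ∈ ray D k, x ≠ 0 → ∀ c > 0, Tendsto A (𝓝[cone D k s c x] x) (𝓝 (B x))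

/-- `A` solves the even Riemann-Hilbert problem. Only the values of `A` off `Γ` matter. -/
structure IsEvenSolution (V : ℝ[X]) (n : ℕ)
    (A : ℂ → Matrix (Fin (V.natDegree + 1)) (Fin (V.natDegree + 1)) ℂ) : Prop where
  analytic : ∀ i j, AnalyticOnNhd ℂ (fun z => A z i j) (Gam V.natDegree)ᶜ
  bounded : ∀ x ∈ Gam V.natDegree, ∃ r > 0, ∃ M : ℝ, ∀ z ∉ Gam V.natDegree, dist z x < r →
    ∀ i j, ‖A z i j‖ ≤ M
  boundary : ∃ Ap Am : ℂ → Matrix (Fin (V.natDegree + 1)) (Fin (V.natDegree + 1)) ℂ,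
    IsBoundaryValue 1 A Ap ∧ IsBoundaryValue (-1) A Am ∧
    ContinuousOn Ap (Gam V.natDegree \ {0}) ∧ ContinuousOn Am (Gam V.natDegree \ {0}) ∧
    ∀ x ∈ Gam V.natDegree \ {0}, Ap x = Am x * jump V x
  normalisation : ∃ E : ℂ → Matrix (Fin (V.natDegree + 1)) (Fin (V.natDegree + 1)) ℂ,
    (∀ i j, (fun z => E z i j)
      =O[Bornology.cobounded ℂ ⊓ 𝓟 (Gam V.natDegree)ᶜ] fun z => z⁻¹) ∧
    ∀ᶠ z in Bornology.cobounded ℂ ⊓ 𝓟 (Gam V.natDegree)ᶜ,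
      A z = (1 + E z) * normMatrix V.natDegree n z

/-! ### The explicit solution -/

/-- `S` has degree at most `2n + D - 2`, `∫_ℝ x^l S e^{-2V} dx = 0` for `0 ≤ l ≤ 2n - 1`, and
`-(2π i)⁻¹ ∫_{Γ_k} S e^{-V} dz = δ_{kj}` for `1 ≤ k ≤ D - 1`. -/
structure IsAuxiliary (V : ℝ[X]) (n j : ℕ) (S : ℂ[X]) : Prop where
  natDegree_le : S.natDegree ≤ 2 * n + V.natDegree - 2
  orthogonal : ∀ l < 2 * n,
    ∫ x : ℝ, Complex.exp (-2 * aeval (x : ℂ) V) * (x : ℂ) ^ l * S.eval (x : ℂ) = 0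
  normalised : ∀ k ∈ Set.Icc 1 (V.natDegree - 1),
    -(2 * Real.pi * Complex.I)⁻¹ *
      contourIntegral V.natDegree k (fun x => Complex.exp (-aeval x V) * S.eval x)
      = if k = j then 1 else 0

/-- The polynomials in column `0`: `Ψ_{2n}`, `-(2π i γ D / h_{n-1}) Ψ_{2n-2}`, and `R j` in row
`j + 1` for `1 ≤ j ≤ D - 1`. -/
def rowPoly (V : ℝ[X]) (P : ℕ → ℝ[X]) (R : ℕ → ℂ[X]) (n i : ℕ) : ℂ[X] :=
  if i = 0 then (dual V (P (2 * n))).map (algebraMap ℝ ℂ)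
  else if i = 1 then
    C (-(2 * Real.pi * Complex.I * V.leadingCoeff * V.natDegree / skewNorm V P (n - 1)))
      * (dual V (P (2 * n - 2))).map (algebraMap ℝ ℂ)
  else R (i - 1)

/-- A polynomial `q` followed by its Cauchy transforms. -/
def cauchyRow (V : ℝ[X]) (q : ℂ[X]) (j : ℕ) (z : ℂ) : ℂ :=
  if j = 0 then q.eval z
  else if j = 1 then cauchyReal (fun x => weight V 1 x * q.eval x) z
  else cauchyContour V.natDegree (j - 1) (fun x => weight V j x * q.eval x) z

/-- The explicit solution. For `n = 0`, where `Ψ_{2n-2}` does not exist, the second row is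
`(0, 1, 0, …, 0)`. -/
def evenSolution (V : ℝ[X]) (P : ℕ → ℝ[X]) (R : ℕ → ℂ[X]) (n : ℕ) (z : ℂ) :
    Matrix (Fin (V.natDegree + 1)) (Fin (V.natDegree + 1)) ℂ :=
  Matrix.of fun i j =>
    if n = 0 ∧ i.val = 1 then (if j = i then 1 else 0)
    else cauchyRow V (rowPoly V P R n i) j z

end SymplecticRHP

end

open Polynomial Filter Topology

noncomputable section

namespace SymplecticRHP

open MeasureTheory

section

/-! ### Exponentially decaying entire functions -/

/-! Existence is a verification of the explicit matrix; uniqueness and `det = 1` are Liouville-type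
arguments.

Since `D` is even, `C_{D/2}` is the negative half-line and `ℝ` is `Γ_{D/2}` with its orientation. So
every column but the first consists of Cauchy transforms over some `Γ_m` of an entire function `g =
e^{-W} q` with `W = V` or `W = 2V`. Writing `g(t) = (g(t) - g(z)) + g(z)` shows that such a
transform is an entire function plus `g / (2πi)` times a difference of two logarithms cut along the
rays (`exists_halfTransform_eq`, `GrowsOnRays.exists_cauchyContour_eq`). Analyticity, boundedness
(also at `0`) and the jump `g` can be read off from this formula.

At infinity, expanding `1/(x - z)` turns the normalisation into conditions on `∫ x^l q e^{-2V}` over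
`ℝ` and `∫ q e^{-V}` over `Γ_k`. For a dual `Ψ` of `P` the former are, up to a constant, the skew
products of `x^l` with `P` (integration by parts), and the latter vanish because `e^{-V} Ψ` is an
exact derivative. The polynomials `R` solve a square linear system with these conditions.

Two facts make everything nondegenerate. `Admissible.nondegenerate`: the skew form is nondegenerate
on polynomials of degree less than `2n`, by induction and the positivity of a Wronskian without real
zeros; this gives skew-orthogonal sequences and `h_n ≠ 0`. `Admissible.eq_zero_of_periods`: a
polynomial `S` of degree at most `D - 2` with all `∫ S e^{-V}` over `Γ_k` zero is zero, by
Phragmén–Lindelöf and Liouville applied to `e^V` times a primitive of `e^{-V} S`. Together they make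
the system for `R` uniquely solvable (`Admissible.existsUnique_isAuxiliary`).

For solutions `A` and `B`, the functions `det A` and `A · adj B` do not change when both are
multiplied from the right by a matrix of determinant one. Hence they have no jump, and
`eq_limit_of_no_jump` identifies them with their limits at infinity. -/

/-- The real polynomial whose coefficients are the real parts of those of `W`. -/
def rePart (W : ℂ[X]) : ℝ[X] := ∑ i ∈ Finset.range (W.natDegree + 1), monomial i (W.coeff i).re

theorem coeff_rePart (W : ℂ[X]) (i : ℕ) : (rePart W).coeff i = (W.coeff i).re := by
  simp only [rePart, finsetSum_coeff, coeff_monomial, Finset.sum_ite_eq', Finset.mem_range]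
  split_ifs with h
  · rfl
  · rw [coeff_eq_zero_of_natDegree_lt (by omega), Complex.zero_re]

theorem eval_rePart (W : ℂ[X]) (t : ℝ) : (rePart W).eval t = (W.eval (t : ℂ)).re := by
  rw [eval_eq_sum_range (p := W), rePart, eval_finsetSum, Complex.re_sum]
  refine Finset.sum_congr rfl fun i _ => ?_
  rw [eval_monomial, ← Complex.ofReal_pow, Complex.re_mul_ofReal]

theorem natDegree_rePart_le (W : ℂ[X]) : (rePart W).natDegree ≤ W.natDegree :=
  natDegree_le_iff_coeff_eq_zero.2 fun i hi => by
    rw [coeff_rePart, coeff_eq_zero_of_natDegree_lt hi, Complex.zero_re]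

theorem tendsto_re_eval_atTop {W : ℂ[X]} (hW : 1 ≤ W.natDegree) (hl : 0 < W.leadingCoeff.re) :
    Tendsto (fun t : ℝ => (W.eval (t : ℂ)).re) atTop atTop := by
  have hc : (rePart W).coeff W.natDegree = W.leadingCoeff.re := coeff_rePart W _
  have hd : (rePart W).natDegree = W.natDegree :=
    le_antisymm (natDegree_rePart_le W) (le_natDegree_of_ne_zero (by rw [hc]; exact hl.ne'))
  have := (rePart W).tendsto_atTop_of_leadingCoeff_nonneg
    (natDegree_pos_iff_degree_pos.1 (by omega)) (by rw [leadingCoeff, hd, hc]; exact hl.le)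
  simpa only [eval_rePart] using this

/-- `W` grows along the positive real axis at least like `γ t²`. -/
structure Grows (W : ℂ[X]) : Prop where
  two_le : 2 ≤ W.natDegree
  re_pos : 0 < W.leadingCoeff.re

/-- The slope `2` is chosen so that `e^{-W}` times a polynomial, itself at most a multiple of `e^t`,
still decays like `e^{-t}`. -/
theorem Grows.exists_bound {W : ℂ[X]} (hW : Grows W) :
    ∃ C : ℝ, ∀ t : ℝ, 0 ≤ t → 2 * t - C ≤ (W.eval (t : ℂ)).re := by
  have hlt : (C 2 * X : ℂ[X]).natDegree < W.natDegree := by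
    rw [natDegree_C_mul_X _ two_ne_zero]; exact hW.two_le
  have hd : (W - C 2 * X).natDegree = W.natDegree := natDegree_sub_eq_left_of_natDegree_lt hlt
  have ht : Tendsto (fun t : ℝ => ((W - C 2 * X).eval (t : ℂ)).re) atTop atTop := by
    refine tendsto_re_eval_atTop (by have := hW.two_le; omega) ?_
    rw [leadingCoeff_sub_of_degree_lt (degree_lt_degree hlt)]
    exact hW.re_pos
  obtain ⟨T, hT⟩ := eventually_atTop.1 (ht.eventually_ge_atTop 0)
  have hc : Continuous fun t : ℝ => ((W - C 2 * X).eval (t : ℂ)).re := by fun_prop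
  obtain ⟨m, hm⟩ := (isCompact_Icc (a := (0 : ℝ)) (b := T)).bddBelow_image hc.continuousOn
  refine ⟨|m|, fun t h0 => ?_⟩
  have key : -|m| ≤ ((W - C 2 * X).eval (t : ℂ)).re := by
    rcases le_total t T with h | h
    · exact (neg_abs_le m).trans (hm ⟨t, ⟨h0, h⟩, rfl⟩)
    · exact (neg_nonpos.2 (abs_nonneg m)).trans (hT t h)
  have : ((W - C 2 * X).eval (t : ℂ)).re = (W.eval (t : ℂ)).re - 2 * t := by
    simp [Complex.mul_re]
  linarith

theorem exists_poly_le_exp (q : ℂ[X]) :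
    ∃ C : ℝ, 0 ≤ C ∧ ∀ t : ℝ, 0 ≤ t → ‖q.eval (t : ℂ)‖ ≤ C * Real.exp t := by
  refine ⟨∑ i ∈ Finset.range (q.natDegree + 1), ‖q.coeff i‖ * (i.factorial : ℝ), by positivity,
    fun t ht => ?_⟩
  rw [eval_eq_sum_range, Finset.sum_mul]
  refine (norm_sum_le _ _).trans (Finset.sum_le_sum fun i _ => ?_)
  rw [norm_mul, norm_pow, Complex.norm_real, Real.norm_of_nonneg ht, mul_assoc]
  refine mul_le_mul_of_nonneg_left ?_ (norm_nonneg _)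
  have := Real.pow_div_factorial_le_exp t ht i
  rwa [div_le_iff₀ (by positivity), mul_comm] at this

/-- The entire function `e^{-W} q`. -/
def expPoly (W q : ℂ[X]) (z : ℂ) : ℂ := Complex.exp (-W.eval z) * q.eval z

theorem hasDerivAt_expPoly (W q : ℂ[X]) (z : ℂ) :
    HasDerivAt (expPoly W q) (expPoly W (derivative q - derivative W * q) z) z := by
  have h : HasDerivAt (fun x => Complex.exp (-W.eval x)) _ z := (W.hasDerivAt z).neg.cexp
  refine (h.mul (q.hasDerivAt z)).congr_deriv ?_
  simp only [expPoly, eval_sub, eval_mul, Pi.neg_apply]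
  ring

theorem differentiable_expPoly (W q : ℂ[X]) : Differentiable ℂ (expPoly W q) :=
  fun z => (hasDerivAt_expPoly W q z).differentiableAt

theorem continuous_expPoly (W q : ℂ[X]) : Continuous (expPoly W q) :=
  (differentiable_expPoly W q).continuous

theorem mul_expPoly (W p q : ℂ[X]) (z : ℂ) :
    p.eval z * expPoly W q z = expPoly W (p * q) z := by
  simp only [expPoly, eval_mul]; ring

theorem Grows.norm_expPoly_le {W : ℂ[X]} (hW : Grows W) (q : ℂ[X]) :
    ∃ C : ℝ, 0 ≤ C ∧ ∀ t : ℝ, 0 ≤ t → ‖expPoly W q t‖ ≤ C * Real.exp (-t) := by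
  obtain ⟨A, hA⟩ := hW.exists_bound
  obtain ⟨B, hB0, hB⟩ := exists_poly_le_exp q
  refine ⟨B * Real.exp A, by positivity, fun t ht => ?_⟩
  rw [expPoly, norm_mul, Complex.norm_exp, Complex.neg_re]
  calc Real.exp (-(W.eval (t : ℂ)).re) * ‖q.eval (t : ℂ)‖
      ≤ Real.exp (A - 2 * t) * (B * Real.exp t) := by
        gcongr
        · linarith [hA t ht]
        · exact hB t ht
    _ = B * Real.exp A * Real.exp (-t) := by
        rw [mul_left_comm, ← Real.exp_add, mul_assoc, ← Real.exp_add]; ring_nf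

theorem Grows.norm_expPoly_bounded {W : ℂ[X]} (hW : Grows W) (q : ℂ[X]) :
    ∃ C : ℝ, 0 ≤ C ∧ ∀ t : ℝ, 0 ≤ t → ‖expPoly W q t‖ ≤ C := by
  obtain ⟨C, h0, hC⟩ := hW.norm_expPoly_le q
  refine ⟨C, h0, fun t ht => (hC t ht).trans (mul_le_of_le_one_right h0 ?_)⟩
  exact Real.exp_le_one_iff.2 (by linarith)

theorem Grows.integrableOn {W : ℂ[X]} (hW : Grows W) (q : ℂ[X]) :
    MeasureTheory.IntegrableOn (fun t : ℝ => expPoly W q t) (Set.Ioi 0) := by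
  obtain ⟨C, -, hC⟩ := hW.norm_expPoly_le q
  refine ((integrableOn_exp_neg_Ioi 0).const_mul C).mono' ?_ ?_
  · exact ((continuous_expPoly W q).comp Complex.continuous_ofReal).aestronglyMeasurable
  · filter_upwards [MeasureTheory.ae_restrict_mem measurableSet_Ioi] with t ht
    exact hC t (le_of_lt ht)

theorem Grows.tendsto_zero {W : ℂ[X]} (hW : Grows W) (q : ℂ[X]) :
    Tendsto (fun t : ℝ => expPoly W q t) atTop (𝓝 0) := by
  obtain ⟨C, -, hC⟩ := hW.norm_expPoly_le q
  refine squeeze_zero_norm' ((eventually_ge_atTop 0).mono fun t ht => hC t ht) ?_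
  simpa using (Real.tendsto_exp_neg_atTop_nhds_zero.const_mul C)

theorem Grows.integral_deriv {W : ℂ[X]} (hW : Grows W) (q : ℂ[X]) :
    ∫ t in Set.Ioi (0 : ℝ), expPoly W (derivative q - derivative W * q) t = -expPoly W q 0 := by
  have := MeasureTheory.integral_Ioi_of_hasDerivAt_of_tendsto' (a := 0)
    (fun t _ => (hasDerivAt_expPoly W q (t : ℂ)).comp_ofReal)
    (hW.integrableOn (derivative q - derivative W * q)) (hW.tendsto_zero q)
  simpa using this

/-- Substitution `z = d w`. -/
theorem expPoly_comp (W q : ℂ[X]) (d w : ℂ) :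
    expPoly (W.comp (C d * X)) (q.comp (C d * X)) w = expPoly W q (w * d) := by
  simp only [expPoly, eval_comp, eval_mul, eval_C, eval_X, mul_comm d w]

/-! ### The rays -/

theorem dir_pow {D : ℕ} (hD : D ≠ 0) (k : ℕ) : dir D k ^ D = 1 := by
  have hD' : (D : ℂ) ≠ 0 := Nat.cast_ne_zero.2 hD
  rw [dir, ← Complex.exp_nat_mul, Complex.exp_eq_one_iff]
  exact ⟨k, by push_cast; field_simp⟩

theorem dir_ne_zero (D k : ℕ) : dir D k ≠ 0 := Complex.exp_ne_zero _

theorem dir_eq (D k : ℕ) : dir D k = Complex.exp ((2 * Real.pi * k / D : ℝ) * Complex.I) := by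
  rw [dir]; congr 1; push_cast; ring

theorem norm_dir (D k : ℕ) : ‖dir D k‖ = 1 := by
  rw [dir_eq, Complex.norm_exp_ofReal_mul_I]

@[simp] theorem dir_zero (D : ℕ) : dir D 0 = 1 := by simp [dir]

/-- This is where the evenness of `D` enters: the real line becomes the contour `Γ_{D/2}`, and
column `1` can be treated like the others. -/
theorem dir_half {D : ℕ} (hD : D ≠ 0) (he : Even D) : dir D (D / 2) = -1 := by
  obtain ⟨m, rfl⟩ := he
  have hm : (m : ℂ) ≠ 0 := Nat.cast_ne_zero.2 (by omega)
  rw [← two_mul, Nat.mul_div_cancel_left _ two_pos, dir, ← Complex.exp_pi_mul_I]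
  congr 1; push_cast; field_simp

/-- `W` grows along all rays `C_k`. -/
structure GrowsOnRays (D : ℕ) (W : ℂ[X]) : Prop where
  natDegree_eq : W.natDegree = D
  two_le : 2 ≤ D
  re_pos : 0 < W.leadingCoeff.re

/-- Rotating the ray to the positive axis multiplies the leading coefficient by `(dir D k)^D = 1`.
-/
theorem GrowsOnRays.grows {D : ℕ} {W : ℂ[X]} (hW : GrowsOnRays D W) (k : ℕ) :
    Grows (W.comp (C (dir D k) * X)) := by
  have hd : (C (dir D k) * X : ℂ[X]).natDegree = 1 := natDegree_C_mul_X _ (dir_ne_zero D k)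
  constructor
  · rw [natDegree_comp, hd, hW.natDegree_eq, mul_one]; exact hW.two_le
  · rw [leadingCoeff_comp (by rw [hd]; exact one_ne_zero), leadingCoeff_mul, leadingCoeff_C,
      leadingCoeff_X, mul_one, hW.natDegree_eq, dir_pow (by have := hW.two_le; omega), mul_one]
    exact hW.re_pos

theorem GrowsOnRays.rayIntegrable {D : ℕ} {W : ℂ[X]} (hW : GrowsOnRays D W) (k : ℕ) (q : ℂ[X]) :
    MeasureTheory.IntegrableOn (fun t : ℝ => expPoly W q (t * dir D k)) (Set.Ioi 0) :=
  ((hW.grows k).integrableOn (q.comp (C (dir D k) * X))).congr_fun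
    (fun _ _ => expPoly_comp _ _ _ _) measurableSet_Ioi

theorem rayIntegral_expPoly (D k : ℕ) (W q : ℂ[X]) :
    rayIntegral D k (expPoly W q) = dir D k *
      ∫ t in Set.Ioi (0 : ℝ), expPoly (W.comp (C (dir D k) * X)) (q.comp (C (dir D k) * X)) t := by
  rw [rayIntegral, MeasureTheory.integral_mul_const, mul_comm]
  simp only [expPoly_comp]

theorem GrowsOnRays.rayIntegral_deriv {D : ℕ} {W : ℂ[X]} (hW : GrowsOnRays D W) (k : ℕ)
    (q : ℂ[X]) :
    rayIntegral D k (expPoly W (derivative q - derivative W * q)) = -expPoly W q 0 := by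
  have h := (hW.grows k).integral_deriv (q.comp (C (dir D k) * X))
  rw [expPoly_comp, zero_mul] at h
  rw [← h, rayIntegral_expPoly, ← MeasureTheory.integral_const_mul]
  congr 1; ext t
  simp only [expPoly, derivative_comp, derivative_mul, derivative_C, derivative_X, eval_sub,
    eval_mul, eval_comp, eval_add, eval_C, eval_X, eval_zero, eval_one, sub_comp, mul_comp]
  ring

/-- The integrand is the derivative of `e^{-W} q`; both rays contribute the same boundary value at
the origin, and these cancel. -/
theorem GrowsOnRays.contourIntegral_deriv {D : ℕ} {W : ℂ[X]} (hW : GrowsOnRays D W) (k : ℕ)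
    (q : ℂ[X]) :
    contourIntegral D k (expPoly W (derivative q - derivative W * q)) = 0 := by
  rw [contourIntegral, hW.rayIntegral_deriv, hW.rayIntegral_deriv, sub_self]

theorem GrowsOnRays.rayIntegral_add {D : ℕ} {W : ℂ[X]} (hW : GrowsOnRays D W) (k : ℕ)
    (p q : ℂ[X]) : rayIntegral D k (expPoly W (p + q)) =
      rayIntegral D k (expPoly W p) + rayIntegral D k (expPoly W q) := by
  rw [rayIntegral, rayIntegral, rayIntegral, ← MeasureTheory.integral_add
    ((hW.rayIntegrable k p).mul_const _) ((hW.rayIntegrable k q).mul_const _)]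
  simp only [expPoly, eval_add, mul_add, add_mul]

theorem rayIntegral_smul (D k : ℕ) (W : ℂ[X]) (c : ℂ) (p : ℂ[X]) :
    rayIntegral D k (expPoly W (c • p)) = c * rayIntegral D k (expPoly W p) := by
  rw [rayIntegral, rayIntegral, ← MeasureTheory.integral_const_mul]
  congr 1; ext t
  simp only [expPoly, eval_smul, smul_eq_mul]; ring

theorem GrowsOnRays.contourIntegral_add {D : ℕ} {W : ℂ[X]} (hW : GrowsOnRays D W) (k : ℕ)
    (p q : ℂ[X]) : contourIntegral D k (expPoly W (p + q)) =
      contourIntegral D k (expPoly W p) + contourIntegral D k (expPoly W q) := by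
  simp only [contourIntegral, hW.rayIntegral_add]; ring

theorem contourIntegral_smul (D k : ℕ) (W : ℂ[X]) (c : ℂ) (p : ℂ[X]) :
    contourIntegral D k (expPoly W (c • p)) = c * contourIntegral D k (expPoly W p) := by
  simp only [contourIntegral, rayIntegral_smul]; ring

end

section

/-! ### Cauchy transforms over the half-line -/

/-- Only the integrand needs a locally uniform bound: Cauchy's estimate passes it on to the
derivative in the parameter. -/
theorem differentiable_integral {α : Type*} [MeasurableSpace α] {μ : Measure α} {F : ℂ → α → ℂ}
    (hF : ∀ t, Differentiable ℂ fun w => F w t) (hm : ∀ w, AEStronglyMeasurable (F w) μ)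
    (hb : ∀ L : ℝ, ∃ b : α → ℝ, Integrable b μ ∧ ∀ᵐ t ∂μ, ∀ w : ℂ, ‖w‖ ≤ L → ‖F w t‖ ≤ b t) :
    Differentiable ℂ fun w => ∫ t, F w t ∂μ := by
  intro w₀
  -- The radius leaves room for the unit ball around `w₀` and for the unit circles around its
  -- points, on which Cauchy's estimate is used.
  obtain ⟨b, hbi, hb⟩ := hb (‖w₀‖ + 2)
  have hs : Metric.ball w₀ 1 ∈ 𝓝 w₀ := Metric.ball_mem_nhds _ one_pos
  -- The derivative is measurable in `t` as the pointwise limit of difference quotients with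
  -- increments `1/(n+1)`.
  have hmd : AEStronglyMeasurable (fun t => deriv (fun w => F w t) w₀) μ := by
    have hlim : ∀ t, Tendsto (fun n : ℕ => ((n : ℂ) + 1) * (F (w₀ + ((n : ℂ) + 1)⁻¹) t - F w₀ t))
        atTop (𝓝 (deriv (fun w => F w t) w₀)) := by
      intro t
      have h := (hF t w₀).hasDerivAt.tendsto_slope_zero
      have h2 : Tendsto (fun n : ℕ => ((n : ℂ) + 1)⁻¹) atTop (𝓝[≠] 0) := by
        refine tendsto_nhdsWithin_iff.2 ⟨?_, Eventually.of_forall fun n => ?_⟩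
        · simpa only [one_div] using (tendsto_one_div_add_atTop_nhds_zero_nat (𝕜 := ℂ))
        · exact inv_ne_zero (Nat.cast_add_one_ne_zero n)
      refine (h.comp h2).congr fun n => ?_
      simp only [Function.comp, smul_eq_mul, inv_inv]
    exact aestronglyMeasurable_of_tendsto_ae atTop
      (fun n => ((hm _).sub (hm _)).const_mul _) (Eventually.of_forall hlim)
  have := hasDerivAt_integral_of_dominated_loc_of_deriv_le (μ := μ) (F := F) (x₀ := w₀)
    (F' := fun w t => deriv (fun w => F w t) w) hs (Eventually.of_forall hm)
    (hbi.mono' (hm w₀) (hb.mono fun t ht => ht w₀ (by linarith))) hmd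
    (bound := b) (hb.mono fun t ht w hw => ?_) hbi
    (Eventually.of_forall fun t w _ => (hF t w).hasDerivAt)
  · exact this.2.differentiableAt
  · have := Complex.norm_deriv_le_of_forall_mem_sphere_norm_le (C := b t) one_pos
      ((hF t).diffContOnCl (s := Metric.ball w 1)) fun z hz => ht z ?_
    · simpa using this
    · have h1 : ‖z - w‖ = 1 := by simpa [dist_eq_norm] using hz
      have h2 : ‖w - w₀‖ < 1 := by simpa [dist_eq_norm] using hw
      have h3 : ‖z‖ ≤ ‖z - w‖ + ‖w - w₀‖ + ‖w₀‖ := by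
        simpa using norm_add₃_le (a := z - w) (b := w - w₀) (c := w₀)
      linarith

/-- `∫_0^∞ g(t) / (t - w) dt`. -/
def halfTransform (g : ℂ → ℂ) (w : ℂ) : ℂ := ∫ t in Set.Ioi (0 : ℝ), g t / (t - w)

/-- The condition `-w ∈ slitPlane` says that `w` lies off the half-line `[0, ∞)`. -/
theorem ofReal_sub_mem_slitPlane {w : ℂ} (hw : -w ∈ Complex.slitPlane) {t : ℝ} (ht : 0 ≤ t) :
    (t : ℂ) - w ∈ Complex.slitPlane := by
  rw [Complex.mem_slitPlane_iff] at hw ⊢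
  simp only [Complex.neg_re, Complex.neg_im, Complex.sub_re, Complex.sub_im, Complex.ofReal_re,
    Complex.ofReal_im] at hw ⊢
  rcases hw with h | h
  · left; linarith
  · right; simpa using h

/-- A positive distance to the half-line is combined with linear growth in `t`. The linear growth
makes `1/(t-w) - 1/(t+1)` decay like `t^{-2}`. -/
theorem exists_le_norm_ofReal_sub {w : ℂ} (hw : -w ∈ Complex.slitPlane) :
    ∃ c : ℝ, 0 < c ∧ ∀ t : ℝ, 0 ≤ t → c * (1 + t) ≤ ‖(t : ℂ) - w‖ := by
  obtain ⟨δ, hδ, h⟩ : ∃ δ : ℝ, 0 < δ ∧ ∀ t : ℝ, 0 ≤ t → δ ≤ ‖(t : ℂ) - w‖ := by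
    rw [Complex.mem_slitPlane_iff] at hw
    rcases hw with h | h
    · refine ⟨(-w).re, h, fun t ht => le_trans ?_ (Complex.re_le_norm _)⟩
      simp only [Complex.neg_re, Complex.sub_re, Complex.ofReal_re]; linarith
    · refine ⟨|(-w).im|, abs_pos.2 h, fun t ht => ?_⟩
      simpa using Complex.abs_im_le_norm ((t : ℂ) - w)
  refine ⟨δ / (δ + 1 + ‖w‖), by positivity, fun t ht => ?_⟩
  have h1 : t ≤ ‖(t : ℂ) - w‖ + ‖w‖ := by
    have := norm_add_le ((t : ℂ) - w) w
    rwa [sub_add_cancel, Complex.norm_real, Real.norm_of_nonneg ht] at this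
  rw [div_mul_eq_mul_div, div_le_iff₀ (by positivity)]
  nlinarith [h t ht, norm_nonneg w, norm_nonneg ((t : ℂ) - w)]

theorem ofReal_sub_ne_zero {w : ℂ} (hw : -w ∈ Complex.slitPlane) {t : ℝ} (ht : 0 ≤ t) :
    (t : ℂ) - w ≠ 0 := Complex.slitPlane_ne_zero (ofReal_sub_mem_slitPlane hw ht)

theorem integrableOn_inv_one_add_sq_mul (C : ℝ) :
    IntegrableOn (fun t : ℝ => C * (1 + t ^ 2)⁻¹) (Set.Ioi 0) :=
  (integrable_inv_one_add_sq.const_mul C).integrableOn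

theorem integrableOn_div_sub {g : ℂ → ℂ} (hg : Continuous g)
    (hi : IntegrableOn (fun t : ℝ => g t) (Set.Ioi 0)) {w : ℂ} (hw : -w ∈ Complex.slitPlane) :
    IntegrableOn (fun t : ℝ => g t / (t - w)) (Set.Ioi 0) := by
  obtain ⟨c, hc, h⟩ := exists_le_norm_ofReal_sub hw
  refine (hi.norm.const_mul c⁻¹).mono' ?_ ?_
  · refine ContinuousOn.aestronglyMeasurable (fun t ht => ?_) measurableSet_Ioi
    refine ContinuousAt.continuousWithinAt (ContinuousAt.div (by fun_prop) (by fun_prop)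
      (ofReal_sub_ne_zero hw (le_of_lt ht)))
  · filter_upwards [ae_restrict_mem measurableSet_Ioi] with t ht
    have ht' : 0 < t := ht
    rw [norm_div, div_eq_inv_mul]
    gcongr
    nlinarith [h t ht'.le]

theorem integrableOn_sub_inv {w : ℂ} (hw : -w ∈ Complex.slitPlane) :
    IntegrableOn (fun t : ℝ => ((t : ℂ) - w)⁻¹ - ((t : ℂ) + 1)⁻¹) (Set.Ioi 0) := by
  obtain ⟨c, hc, h⟩ := exists_le_norm_ofReal_sub hw
  have hne : ∀ t : ℝ, 0 < t → (t : ℂ) + 1 ≠ 0 := fun t ht => by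
    exact_mod_cast (by positivity : t + 1 ≠ 0)
  refine (integrableOn_inv_one_add_sq_mul (c⁻¹ * ‖1 + w‖)).mono' ?_ ?_
  · refine ContinuousOn.aestronglyMeasurable (fun t ht => ?_) measurableSet_Ioi
    refine ContinuousAt.continuousWithinAt (ContinuousAt.sub ?_ ?_)
    · exact ContinuousAt.inv₀ (by fun_prop) (ofReal_sub_ne_zero hw (le_of_lt ht))
    · exact ContinuousAt.inv₀ (by fun_prop) (hne t ht)
  · filter_upwards [ae_restrict_mem measurableSet_Ioi] with t ht
    have ht' : 0 < t := ht
    have hn : ‖(t : ℂ) + 1‖ = t + 1 := by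
      rw [← Complex.ofReal_one, ← Complex.ofReal_add, Complex.norm_real,
        Real.norm_of_nonneg (by positivity)]
    rw [inv_sub_inv (ofReal_sub_ne_zero hw ht'.le) (hne t ht), norm_div, norm_mul, hn,
      show (t : ℂ) + 1 - (t - w) = 1 + w by ring, mul_comm c⁻¹, mul_assoc, div_eq_mul_inv,
      ← mul_inv]
    refine mul_le_mul_of_nonneg_left (inv_anti₀ (by positivity) ?_) (norm_nonneg _)
    nlinarith [h t ht'.le, mul_le_mul_of_nonneg_right (h t ht'.le) (by positivity : 0 ≤ t + 1),
      mul_pos hc ht']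

/-- A primitive is `log(t - w) - log(t + 1)`. It is `log(-w)` at `t = 0`, and it tends to `0`
because it is the logarithm of a quotient tending to `1`; splitting that logarithm is legitimate
since `t + 1 > 0`. -/
theorem integral_sub_inv {w : ℂ} (hw : -w ∈ Complex.slitPlane) :
    ∫ t in Set.Ioi (0 : ℝ), (((t : ℂ) - w)⁻¹ - ((t : ℂ) + 1)⁻¹) = -Complex.log (-w) := by
  have hlim : Tendsto (fun t : ℝ => Complex.log (t - w) - Complex.log (t + 1)) atTop (𝓝 0) := by
    have h1 : Tendsto (fun t : ℝ => ((t : ℂ) - w) / (t + 1)) atTop (𝓝 1) := by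
      have h2 : Tendsto (fun t : ℝ => 1 - (1 + w) * (((t + 1 : ℝ)⁻¹ : ℝ) : ℂ)) atTop
          (𝓝 (1 - (1 + w) * ((0 : ℝ) : ℂ))) := by
        refine Tendsto.sub tendsto_const_nhds (Tendsto.const_mul _ ?_)
        exact (Complex.continuous_ofReal.tendsto 0).comp
          (tendsto_inv_atTop_zero.comp (tendsto_atTop_add_const_right _ _ tendsto_id))
      rw [Complex.ofReal_zero, mul_zero, sub_zero] at h2
      refine h2.congr' ((eventually_gt_atTop 0).mono fun t ht => ?_)
      have : (t : ℂ) + 1 ≠ 0 := by exact_mod_cast (by positivity : t + 1 ≠ 0)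
      push_cast; field_simp; ring
    have h3 := (continuousAt_clog (x := 1) (by simp)).tendsto.comp h1
    rw [Complex.log_one] at h3
    refine h3.congr' ((eventually_gt_atTop 0).mono fun t ht => ?_)
    have hp : 0 < t + 1 := by positivity
    have hne : ((t : ℂ) - w) / ((t : ℂ) + 1) ≠ 0 := div_ne_zero (ofReal_sub_ne_zero hw ht.le)
      (by exact_mod_cast hp.ne')
    have e : (t : ℂ) - w = ((t + 1 : ℝ) : ℂ) * (((t : ℂ) - w) / ((t : ℂ) + 1)) := by
      have : (t : ℂ) + 1 ≠ 0 := by exact_mod_cast hp.ne'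
      push_cast; field_simp
    have e2 := Complex.log_ofReal_mul hp hne
    rw [← e, Complex.ofReal_log hp.le] at e2
    simp only [Function.comp, e2]
    push_cast; ring
  have := integral_Ioi_of_hasDerivAt_of_tendsto' (a := 0)
    (f := fun t : ℝ => Complex.log (t - w) - Complex.log (t + 1))
    (f' := fun t : ℝ => ((t : ℂ) - w)⁻¹ - ((t : ℂ) + 1)⁻¹) (fun t ht => ?_)
    (integrableOn_sub_inv hw) hlim
  · rw [this]; simp
  · have ht' : (0 : ℝ) ≤ t := ht
    have ha : HasDerivAt (fun t : ℝ => Complex.log (t - w)) (((t : ℂ) - w)⁻¹) t := by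
      have := (((hasDerivAt_id (t : ℂ)).sub_const w).clog
        (ofReal_sub_mem_slitPlane hw ht')).comp_ofReal
      simpa using this
    have hb : HasDerivAt (fun t : ℝ => Complex.log (t + 1)) (((t : ℂ) + 1)⁻¹) t := by
      have := (((hasDerivAt_id (t : ℂ)).add_const 1).clog
        (by left; simp; linarith)).comp_ofReal
      simpa using this
    exact ha.sub hb

theorem dslope_comm (g : ℂ → ℂ) (a b : ℂ) : dslope g a b = dslope g b a := by
  rcases eq_or_ne a b with rfl | h
  · rfl
  · rw [dslope_of_ne _ h.symm, dslope_of_ne _ h, slope_comm]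

theorem differentiable_dslope {g : ℂ → ℂ} (hg : Differentiable ℂ g) (a : ℂ) :
    Differentiable ℂ (dslope g a) := by
  rw [← differentiableOn_univ]
  exact (Complex.differentiableOn_dslope univ_mem).2 hg.differentiableOn

theorem norm_dslope_le {g : ℂ → ℂ} (hg : Differentiable ℂ g) {R M : ℝ}
    (hM : ∀ z, ‖z‖ ≤ R → ‖deriv g z‖ ≤ M) {a b : ℂ} (ha : ‖a‖ ≤ R) (hb : ‖b‖ ≤ R) :
    ‖dslope g a b‖ ≤ M := by
  rcases eq_or_ne b a with rfl | h
  · rw [dslope_same]; exact hM _ ha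
  · rw [dslope_of_ne _ h, slope_def_field, norm_div,
      div_le_iff₀ (norm_pos_iff.2 (sub_ne_zero.2 h))]
    exact (convex_closedBall (0 : ℂ) R).norm_image_sub_le_of_norm_deriv_le
      (fun z _ => hg z) (fun z hz => hM z (by simpa using hz)) (by simpa using ha)
      (by simpa using hb)

theorem exists_bound_closedBall {g : ℂ → ℂ} (hg : Continuous g) (R : ℝ) :
    ∃ M : ℝ, 0 ≤ M ∧ ∀ z, ‖z‖ ≤ R → ‖g z‖ ≤ M := by
  obtain ⟨M, hM⟩ := (isCompact_closedBall (0 : ℂ) R).exists_bound_of_continuousOn hg.continuousOn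
  exact ⟨|M|, abs_nonneg M, fun z hz => (hM z (by simpa using hz)).trans (le_abs_self M)⟩

/-- The Cauchy transform of an entire function over the half-line, up to an entire function. -/
theorem exists_halfTransform_eq {g : ℂ → ℂ} (hg : Differentiable ℂ g) {C : ℝ}
    (hC : ∀ t : ℝ, 0 ≤ t → ‖g t‖ ≤ C * Real.exp (-t))
    (hi : IntegrableOn (fun t : ℝ => g t) (Set.Ioi 0)) :
    ∃ H : ℂ → ℂ, Differentiable ℂ H ∧ ∀ w, -w ∈ Complex.slitPlane →
      halfTransform g w = H w - g w * Complex.log (-w) := by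
  have hC0 : 0 ≤ C := by
    have := (norm_nonneg _).trans (hC 0 le_rfl)
    simpa using this
  -- The quotient `(g(t) - g(w))/(t - w)` is entire in `w`. The remaining `g(w)/(t - w)` is not
  -- integrable by itself; comparing it with `g(w)/(t + 1)` produces the logarithm and leaves the
  -- second summand here.
  refine ⟨fun w => ∫ t in Set.Ioi (0 : ℝ), (dslope g t w + g w / (t + 1)),
    differentiable_integral (fun t => ?_) (fun w => ?_) (fun L => ?_), fun w hw => ?_⟩
  · exact (differentiable_dslope hg t).add (hg.div_const _)
  · refine ContinuousOn.aestronglyMeasurable (fun t ht => ?_) measurableSet_Ioi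
    refine ContinuousAt.continuousWithinAt (ContinuousAt.add ?_ ?_)
    · simp only [dslope_comm g _ w]
      exact ((differentiable_dslope hg w).continuous.comp Complex.continuous_ofReal).continuousAt
    · refine ContinuousAt.div continuousAt_const (by fun_prop) ?_
      have : (0 : ℝ) < t := ht
      exact_mod_cast (by positivity : t + 1 ≠ 0)
  · wlog hL : 0 ≤ L generalizing L
    · refine ⟨fun _ => 0, integrable_zero _ _ _, Eventually.of_forall fun t w hw => ?_⟩
      exact absurd ((norm_nonneg w).trans hw) hL
    obtain ⟨G, hG0, hG⟩ := exists_bound_closedBall hg.continuous L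
    obtain ⟨M, hM0, hM⟩ := exists_bound_closedBall
      ((hg.contDiff (n := 1)).continuous_deriv le_rfl) (2 * L + 1)
    refine ⟨fun t => ((M + G) * (1 + (2 * L + 1) ^ 2) + 2 * G * (1 + L)) * (1 + t ^ 2)⁻¹ +
      2 * C * Real.exp (-t), Integrable.add (integrableOn_inv_one_add_sq_mul _)
      (Integrable.const_mul (integrableOn_exp_neg_Ioi 0) _), ?_⟩
    filter_upwards [ae_restrict_mem measurableSet_Ioi] with t ht w hw
    have ht' : 0 < t := ht
    have hn : ‖(t : ℂ) + 1‖ = t + 1 := by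
      rw [← Complex.ofReal_one, ← Complex.ofReal_add, Complex.norm_real,
        Real.norm_of_nonneg (by positivity)]
    have hnt : ‖(t : ℂ)‖ = t := by rw [Complex.norm_real, Real.norm_of_nonneg ht'.le]
    -- For small `t` the mean value inequality bounds the difference quotient. For `t ≥ 2L + 1` and
    -- `|w| ≤ L` one has `|t - w| ≥ (t + 1)/2`, and the two slowly decaying parts combine to
    -- `O(t^{-2})`.
    rcases le_total t (2 * L + 1) with h | h
    · have h1 : ‖dslope g t w‖ ≤ M := norm_dslope_le hg hM (by rw [hnt]; exact h) (by linarith)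
      have h2 : ‖g w / ((t : ℂ) + 1)‖ ≤ G := by
        rw [norm_div, hn]
        exact (div_le_self (norm_nonneg _) (by linarith)).trans (hG w hw)
      have h3 : (M + G) ≤ (M + G) * (1 + (2 * L + 1) ^ 2) * (1 + t ^ 2)⁻¹ := by
        rw [← div_eq_mul_inv, le_div_iff₀ (by positivity)]
        gcongr
      have h4 : 0 ≤ 2 * G * (1 + L) * (1 + t ^ 2)⁻¹ := by positivity
      have h5 : 0 ≤ 2 * C * Real.exp (-t) := by positivity
      have := norm_add_le (dslope g t w) (g w / ((t : ℂ) + 1))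
      linarith
    · have hge : (t + 1) / 2 ≤ ‖(t : ℂ) - w‖ := by
        have := norm_sub_norm_le (t : ℂ) w
        rw [hnt] at this; linarith
      have hne : (t : ℂ) - w ≠ 0 := norm_pos_iff.1 (by linarith)
      have hne1 : (t : ℂ) + 1 ≠ 0 := norm_pos_iff.1 (by linarith)
      have hne2 : w ≠ t := fun e => hne (by rw [e, sub_self])
      have e : dslope g t w + g w / (t + 1) =
          g t / (t - w) - g w * (1 + w) / ((t - w) * (t + 1)) := by
        have hne3 : w - (t : ℂ) ≠ 0 := sub_ne_zero.2 hne2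
        rw [dslope_of_ne _ hne2, slope_def_field, ← neg_sub (t : ℂ) w, div_neg]
        field_simp; ring
      rw [e]
      have h1 : ‖g t / ((t : ℂ) - w)‖ ≤ 2 * C * Real.exp (-t) := by
        rw [norm_div, div_le_iff₀ (by linarith)]
        have := hC t ht'.le
        have h5 : 0 ≤ 2 * C * Real.exp (-t) := by positivity
        nlinarith
      have h2 : ‖g w * (1 + w) / (((t : ℂ) - w) * (t + 1))‖ ≤ 2 * G * (1 + L) * (1 + t ^ 2)⁻¹ := by
        rw [norm_div, norm_mul, norm_mul, hn, ← div_eq_mul_inv]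
        have h6 : ‖1 + w‖ ≤ 1 + L := by
          refine (norm_add_le _ _).trans ?_
          rw [norm_one]; linarith
        calc ‖g w‖ * ‖1 + w‖ / (‖(t : ℂ) - w‖ * (t + 1))
            ≤ G * (1 + L) / ((1 + t ^ 2) / 2) := by
              gcongr
              · exact hG w hw
              · nlinarith
          _ = 2 * G * (1 + L) / (1 + t ^ 2) := by field_simp
      have h4 : 0 ≤ (M + G) * (1 + (2 * L + 1) ^ 2) * (1 + t ^ 2)⁻¹ := by positivity
      have := norm_sub_le (g t / ((t : ℂ) - w)) (g w * (1 + w) / (((t : ℂ) - w) * (t + 1)))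
      linarith
  · have e : ∀ t ∈ Set.Ioi (0 : ℝ), dslope g t w + g w / (t + 1) =
        g t / (t - w) - g w * (((t : ℂ) - w)⁻¹ - ((t : ℂ) + 1)⁻¹) := by
      intro t ht
      have ht' : (0 : ℝ) < t := ht
      have hne := ofReal_sub_ne_zero hw ht'.le
      have hne1 : (t : ℂ) + 1 ≠ 0 := by exact_mod_cast (by positivity : t + 1 ≠ 0)
      have hne2 : w ≠ t := fun e => hne (by rw [e, sub_self])
      rw [dslope_of_ne _ hne2, slope_def_field, ← neg_sub (t : ℂ) w, div_neg]
      field_simp; ring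
    simp only []
    rw [setIntegral_congr_fun measurableSet_Ioi e,
      integral_sub (integrableOn_div_sub hg.continuous hi hw)
        ((integrableOn_sub_inv hw).const_mul _), integral_const_mul, integral_sub_inv hw,
      halfTransform]
    ring

/-- The Cauchy transform over the half-line is bounded up to the half-line, away from `0`. -/
theorem exists_norm_halfTransform_le {g : ℂ → ℂ} (hg : Differentiable ℂ g) {C : ℝ}
    (hC : ∀ t : ℝ, 0 ≤ t → ‖g t‖ ≤ C * Real.exp (-t))
    (hi : IntegrableOn (fun t : ℝ => g t) (Set.Ioi 0)) {L : ℝ}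
    (hL : ∀ t : ℝ, 0 ≤ t → ‖deriv g t‖ ≤ L) :
    ∃ M : ℝ, ∀ w : ℂ, -w ∈ Complex.slitPlane → 2 ≤ ‖w‖ → ‖halfTransform g w‖ ≤ M := by
  have hC0 : 0 ≤ C := by
    have := (norm_nonneg _).trans (hC 0 le_rfl)
    simpa using this
  have hL0 : 0 ≤ L := (norm_nonneg _).trans (hL 0 le_rfl)
  have hint : ∫ t in Set.Ioi (0 : ℝ), C * Real.exp (-t) = C := by
    rw [integral_const_mul, integral_exp_neg_Ioi_zero, mul_one]
  -- The terms come from the part at distance at least `1` from the singularity, from the Lipschitz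
  -- bound on a window of length `2`, and from an explicit logarithm.
  refine ⟨C + 2 * L + C * (2 * Real.pi), fun w hw h2 => ?_⟩
  have hsq : 4 ≤ w.re ^ 2 + w.im ^ 2 := by
    have := Complex.sq_norm w
    rw [Complex.normSq_apply] at this
    nlinarith
  have hnsq : ∀ t : ℝ, ‖(t : ℂ) - w‖ ^ 2 = (t - w.re) ^ 2 + w.im ^ 2 := fun t => by
    rw [Complex.sq_norm, Complex.normSq_apply]; simp; ring
  -- If `Re w ≤ 1`, then `|w| ≥ 2` keeps `w` at distance at least `1` from the half-line. Otherwise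
  -- the window of radius `1` around `Re w` lies in `(0, ∞)`.
  rcases le_or_gt w.re 1 with hu | hu
  · have h1 : ∀ t : ℝ, 0 < t → 1 ≤ ‖(t : ℂ) - w‖ := fun t ht => by
      refine le_of_sq_le_sq ?_ (norm_nonneg _)
      rw [hnsq]
      rcases le_or_gt w.re 0 with h0 | h0 <;> nlinarith
    have : ‖halfTransform g w‖ ≤ ∫ t in Set.Ioi (0 : ℝ), C * Real.exp (-t) := by
      refine norm_integral_le_of_norm_le ((integrableOn_exp_neg_Ioi 0).const_mul C) ?_
      filter_upwards [ae_restrict_mem measurableSet_Ioi] with t ht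
      rw [norm_div]
      exact (div_le_self (norm_nonneg _) (h1 t ht)).trans (hC t (le_of_lt ht))
    have hpi := Real.pi_pos
    nlinarith
  · have hv : w.im ≠ 0 := by
      rcases Complex.mem_slitPlane_iff.1 hw with h | h
      · simp at h; linarith
      · simpa using h
    set u := w.re with hu_def
    have hne : ∀ t : ℝ, (t : ℂ) - w ≠ 0 := fun t h => hv (by
      have := congrArg Complex.im h; simpa using this)
    have hsub : Set.Ioc (u - 1) (u + 1) ⊆ Set.Ioi 0 := fun t ht => by
      have := ht.1; simp only [Set.mem_Ioi]; linarith
    have hcont : Continuous fun t : ℝ => g u / ((t : ℂ) - w) :=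
      Continuous.div (by fun_prop) (by fun_prop) hne
    -- Near the singularity `g(t)` is replaced by `g(Re w)`: the difference is controlled by the
    -- derivative, and the integral of `φ` can be computed.
    set φ : ℝ → ℂ := (Set.Ioc (u - 1) (u + 1)).indicator fun t => g u / ((t : ℂ) - w) with hφ
    have hφi : IntegrableOn φ (Set.Ioi 0) :=
      ((hcont.integrableOn_Ioc).integrable_indicator measurableSet_Ioc).integrableOn
    have hi' := integrableOn_div_sub hg.continuous hi hw
    have hφ2 : ∫ t in Set.Ioi (0 : ℝ), φ t = g u * ∫ t in (u - 1)..(u + 1), ((t : ℂ) - w)⁻¹ := by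
      rw [hφ, setIntegral_indicator measurableSet_Ioc, Set.inter_eq_self_of_subset_right hsub,
        intervalIntegral.integral_of_le (by linarith), ← integral_const_mul]
      simp only [div_eq_mul_inv]
    have hlog : ‖∫ t in (u - 1)..(u + 1), ((t : ℂ) - w)⁻¹‖ ≤ 2 * Real.pi := by
      have hmem : ∀ t : ℝ, (t : ℂ) - w ∈ Complex.slitPlane := fun t => by
        right; simpa using hv
      have hci : Continuous fun t : ℝ => ((t : ℂ) - w)⁻¹ := Continuous.inv₀ (by fun_prop) hne
      rw [intervalIntegral.integral_eq_sub_of_hasDerivAt (f := fun t : ℝ => Complex.log (t - w))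
        (fun t _ => by
          simpa using (((hasDerivAt_id (t : ℂ)).sub_const w).clog (hmem t)).comp_ofReal)
        (hci.intervalIntegrable _ _)]
      -- The endpoints are symmetric about `Re w`, so the two logarithms have equal real parts and
      -- only their bounded arguments remain.
      · have hre : (Complex.log (((u + 1 : ℝ) : ℂ) - w) - Complex.log (((u - 1 : ℝ) : ℂ) - w)).re
            = 0 := by
          rw [Complex.sub_re, Complex.log_re, Complex.log_re, sub_eq_zero]
          congr 1
          rw [← sq_eq_sq₀ (norm_nonneg _) (norm_nonneg _), hnsq, hnsq]; ring
        rw [← Complex.re_add_im (Complex.log (((u + 1 : ℝ) : ℂ) - w) -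
          Complex.log (((u - 1 : ℝ) : ℂ) - w)), hre, Complex.ofReal_zero, zero_add, norm_mul,
          Complex.norm_I, mul_one, Complex.norm_real, Complex.sub_im, Complex.log_im,
          Complex.log_im, Real.norm_eq_abs]
        refine (abs_sub _ _).trans ?_
        have := Complex.abs_arg_le_pi (((u + 1 : ℝ) : ℂ) - w)
        have := Complex.abs_arg_le_pi (((u - 1 : ℝ) : ℂ) - w)
        linarith
    have hfirst : ‖∫ t in Set.Ioi (0 : ℝ), (g t / ((t : ℂ) - w) - φ t)‖ ≤ C + 2 * L := by
      have hLi : IntegrableOn ((Set.Ioc (u - 1) (u + 1)).indicator fun _ => L) (Set.Ioi (0 : ℝ)) :=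
        ((continuous_const.integrableOn_Ioc).integrable_indicator measurableSet_Ioc).integrableOn
      have hE := (integrableOn_exp_neg_Ioi 0).const_mul C
      have hval : ∫ t in Set.Ioi (0 : ℝ), (C * Real.exp (-t) +
          (Set.Ioc (u - 1) (u + 1)).indicator (fun _ => L) t) = C + 2 * L := by
        rw [integral_add hE hLi, hint, setIntegral_indicator measurableSet_Ioc,
          Set.inter_eq_self_of_subset_right hsub, setIntegral_const]
        simp [Measure.real, Real.volume_Ioc]
        left; norm_num
      rw [← hval]
      refine norm_integral_le_of_norm_le (hE.add hLi) ?_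
      filter_upwards [ae_restrict_mem measurableSet_Ioi] with t ht
      have ht' : (0 : ℝ) < t := ht
      have hexp : 0 ≤ C * Real.exp (-t) := by positivity
      by_cases hS : t ∈ Set.Ioc (u - 1) (u + 1)
      · rw [hφ, Set.indicator_of_mem hS, Set.indicator_of_mem hS, ← sub_div, norm_div]
        have hlip : ‖g t - g u‖ ≤ L * ‖t - u‖ := by
          have := (convex_Ici (0 : ℝ)).norm_image_sub_le_of_norm_hasDerivWithin_le
            (f := fun s : ℝ => g s) (f' := fun s : ℝ => deriv g s) (C := L) (x := u) (y := t)
            (fun s _ => ((hg s).hasDerivAt.comp_ofReal).hasDerivWithinAt)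
            (fun s hs => hL s hs) (show (0 : ℝ) ≤ u by linarith) ht'.le
          exact this
        have hle : ‖t - u‖ ≤ ‖(t : ℂ) - w‖ := by
          have := Complex.abs_re_le_norm ((t : ℂ) - w)
          simpa [hu_def] using this
        have hpos := norm_pos_iff.2 (hne t)
        have : ‖g t - g u‖ / ‖(t : ℂ) - w‖ ≤ L := by
          rw [div_le_iff₀ hpos]; nlinarith
        linarith
      · rw [hφ, Set.indicator_of_notMem hS, Set.indicator_of_notMem hS, sub_zero, add_zero,
          norm_div]
        refine (div_le_self (norm_nonneg _) ?_).trans (hC t ht'.le)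
        have hle : |t - u| ≤ ‖(t : ℂ) - w‖ := by
          have := Complex.abs_re_le_norm ((t : ℂ) - w)
          simpa [hu_def] using this
        refine le_trans ?_ hle
        rw [Set.mem_Ioc, not_and_or, not_lt, not_le] at hS
        rcases hS with h | h
        · rw [abs_of_nonpos (by linarith)]; linarith
        · rw [abs_of_nonneg (by linarith)]; linarith
    have hsplit : halfTransform g w =
        (∫ t in Set.Ioi (0 : ℝ), (g t / ((t : ℂ) - w) - φ t)) +
          g u * ∫ t in (u - 1)..(u + 1), ((t : ℂ) - w)⁻¹ := by
      rw [integral_sub hi' hφi, hφ2, halfTransform]; ring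
    have hgu : ‖g u‖ ≤ C := (hC u (by linarith)).trans
      (mul_le_of_le_one_right hC0 (Real.exp_le_one_iff.2 (by linarith)))
    rw [hsplit]
    refine (norm_add_le _ _).trans (add_le_add hfirst ?_)
    rw [norm_mul]
    gcongr

end

section

/-! ### Cauchy transforms over the contours -/

theorem mem_ray_iff {D k : ℕ} {z : ℂ} :
    z ∈ ray D k ↔ 0 ≤ (z / dir D k).re ∧ (z / dir D k).im = 0 := by
  constructor
  · rintro ⟨t, ht, rfl⟩
    rw [mul_div_cancel_right₀ _ (dir_ne_zero D k)]
    exact ⟨ht, Complex.ofReal_im t⟩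
  · rintro ⟨h1, h2⟩
    refine ⟨(z / dir D k).re, h1, ?_⟩
    rw [← div_eq_iff (dir_ne_zero D k)]
    exact Complex.ext rfl (by rw [h2, Complex.ofReal_im])

theorem neg_div_mem_slitPlane_iff {D k : ℕ} {z : ℂ} :
    -(z / dir D k) ∈ Complex.slitPlane ↔ z ∉ ray D k := by
  rw [mem_ray_iff, Complex.mem_slitPlane_iff, Complex.neg_re, Complex.neg_im, not_and_or, not_le,
    neg_pos, neg_ne_zero]

theorem zero_mem_ray (D k : ℕ) : (0 : ℂ) ∈ ray D k := ⟨0, le_rfl, by simp⟩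

theorem isClosed_ray (D k : ℕ) : IsClosed (ray D k) := by
  have : ray D k = (fun z => z / dir D k) ⁻¹' ({w | 0 ≤ w.re} ∩ {w | w.im = 0}) := by
    ext z; exact mem_ray_iff
  rw [this]
  exact ((isClosed_le continuous_const Complex.continuous_re).inter
    (isClosed_eq Complex.continuous_im continuous_const)).preimage (by fun_prop)

theorem ray_integrand (D k : ℕ) (f : ℂ → ℂ) (z : ℂ) (t : ℝ) :
    f (t * dir D k) / (t * dir D k - z) * dir D k = f (t * dir D k) / (t - z / dir D k) := by
  have hd := dir_ne_zero D k
  have : (t : ℂ) * dir D k - z = (t - z / dir D k) * dir D k := by field_simp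
  rw [this, div_mul_eq_mul_div, mul_div_mul_right _ _ hd]

theorem rayIntegral_div_sub (D k : ℕ) (f : ℂ → ℂ) (z : ℂ) :
    rayIntegral D k (fun x => f x / (x - z)) =
      halfTransform (fun w => f (w * dir D k)) (z / dir D k) := by
  rw [rayIntegral, halfTransform]
  simp only [ray_integrand]

variable {D : ℕ} {W : ℂ[X]}

theorem GrowsOnRays.rayIntegrable_div (hW : GrowsOnRays D W) (k : ℕ) (q : ℂ[X]) {z : ℂ}
    (hz : z ∉ ray D k) : IntegrableOn
      (fun t : ℝ => expPoly W q (t * dir D k) / (t * dir D k - z) * dir D k) (Set.Ioi 0) := by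
  have hc : Continuous fun w => expPoly W q (w * dir D k) := by
    have := continuous_expPoly W q; fun_prop
  simpa only [ray_integrand] using integrableOn_div_sub hc (hW.rayIntegrable k q)
    (neg_div_mem_slitPlane_iff.2 hz)

theorem GrowsOnRays.exists_rayTransform_eq (hW : GrowsOnRays D W) (k : ℕ) (q : ℂ[X]) :
    ∃ H : ℂ → ℂ, Differentiable ℂ H ∧ ∀ z ∉ ray D k,
      rayIntegral D k (fun x => expPoly W q x / (x - z)) =
        H z - expPoly W q z * Complex.log (-(z / dir D k)) := by
  have hd : Differentiable ℂ fun w => expPoly W q (w * dir D k) := by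
    have := differentiable_expPoly W q; fun_prop
  obtain ⟨C, -, hC⟩ := (hW.grows k).norm_expPoly_le (q.comp (C (dir D k) * X))
  simp only [expPoly_comp] at hC
  obtain ⟨H, hH, h⟩ := exists_halfTransform_eq hd hC (hW.rayIntegrable k q)
  refine ⟨fun z => H (z / dir D k), by fun_prop, fun z hz => ?_⟩
  rw [rayIntegral_div_sub, h _ (neg_div_mem_slitPlane_iff.2 hz), div_mul_cancel₀ _ (dir_ne_zero D k)]

theorem GrowsOnRays.exists_norm_rayTransform_le (hW : GrowsOnRays D W) (k : ℕ) (q : ℂ[X]) :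
    ∃ M : ℝ, ∀ z ∉ ray D k, 2 ≤ ‖z‖ →
      ‖rayIntegral D k (fun x => expPoly W q x / (x - z))‖ ≤ M := by
  have hd : Differentiable ℂ fun w => expPoly W q (w * dir D k) := by
    have := differentiable_expPoly W q; fun_prop
  obtain ⟨C₁, -, hC⟩ := (hW.grows k).norm_expPoly_le (q.comp (C (dir D k) * X))
  simp only [expPoly_comp] at hC
  obtain ⟨L, -, hL⟩ := (hW.grows k).norm_expPoly_bounded
    ((derivative q - derivative W * q).comp (C (dir D k) * X))
  simp only [expPoly_comp] at hL
  have hder : ∀ w, deriv (fun w => expPoly W q (w * dir D k)) w =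
      expPoly W (derivative q - derivative W * q) (w * dir D k) * dir D k := fun w => by
    have h := (hasDerivAt_expPoly W q (w * dir D k)).comp w ((hasDerivAt_id w).mul_const (dir D k))
    rw [one_mul] at h
    exact h.deriv
  obtain ⟨M, hM⟩ := exists_norm_halfTransform_le hd hC (hW.rayIntegrable k q) (L := L)
    fun t ht => by rw [hder, norm_mul, norm_dir, mul_one]; exact hL t ht
  refine ⟨M, fun z hz h2 => ?_⟩
  rw [rayIntegral_div_sub]
  refine hM _ (neg_div_mem_slitPlane_iff.2 hz) ?_
  rwa [norm_div, norm_dir, div_one]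

/-- This is `1/(x - z) = z⁻¹ (x/(x - z) - 1)`, one step of the expansion at infinity. Each step
splits off a moment and leaves a transform of the same kind. -/
theorem GrowsOnRays.rayTransform_step (hW : GrowsOnRays D W) (k : ℕ) (q : ℂ[X]) {z : ℂ}
    (hz : z ∉ ray D k) :
    rayIntegral D k (fun x => expPoly W q x / (x - z)) =
      z⁻¹ * (rayIntegral D k (fun x => expPoly W (X * q) x / (x - z)) -
        rayIntegral D k (expPoly W q)) := by
  have hz0 : z ≠ 0 := fun h => hz (h ▸ zero_mem_ray D k)
  rw [rayIntegral, rayIntegral, rayIntegral, ← integral_sub (hW.rayIntegrable_div k _ hz)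
    ((hW.rayIntegrable k q).mul_const _), ← integral_const_mul]
  refine setIntegral_congr_fun measurableSet_Ioi fun t ht => ?_
  have hne : (t : ℂ) * dir D k - z ≠ 0 := fun h =>
    hz ⟨t, le_of_lt ht, (sub_eq_zero.1 h).symm⟩
  simp only [← mul_expPoly, eval_X]
  field_simp
  ring

theorem not_mem_contour {j : ℕ} {z : ℂ} (hz : z ∉ contour D j) : z ∉ ray D 0 ∧ z ∉ ray D j :=
  ⟨fun h => hz (Or.inl h), fun h => hz (Or.inr h)⟩

theorem GrowsOnRays.cauchyContour_step (hW : GrowsOnRays D W) (j : ℕ) (q : ℂ[X]) {z : ℂ}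
    (hz : z ∉ contour D j) :
    cauchyContour D j (expPoly W q) z = z⁻¹ * (cauchyContour D j (expPoly W (X * q)) z -
      (2 * Real.pi * Complex.I)⁻¹ * contourIntegral D j (expPoly W q)) := by
  obtain ⟨h0, hj⟩ := not_mem_contour hz
  simp only [cauchyContour, contourIntegral]
  rw [hW.rayTransform_step 0 q h0, hW.rayTransform_step j q hj]
  ring

theorem GrowsOnRays.cauchyContour_pow (hW : GrowsOnRays D W) (j : ℕ) (q : ℂ[X]) (m : ℕ)
    (hm : ∀ l < m, contourIntegral D j (expPoly W (X ^ l * q)) = 0) {z : ℂ}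
    (hz : z ∉ contour D j) :
    cauchyContour D j (expPoly W q) z = z⁻¹ ^ m * cauchyContour D j (expPoly W (X ^ m * q)) z := by
  induction m with
  | zero => simp
  | succ m ih =>
    rw [ih fun l hl => hm l (by omega), hW.cauchyContour_step j (X ^ m * q) hz,
      hm m (by omega), pow_succ', pow_succ', mul_assoc X]
    ring

theorem GrowsOnRays.exists_norm_cauchyContour_le (hW : GrowsOnRays D W) (j : ℕ) (q : ℂ[X]) :
    ∃ M : ℝ, ∀ z ∉ contour D j, 2 ≤ ‖z‖ → ‖cauchyContour D j (expPoly W q) z‖ ≤ M := by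
  obtain ⟨M, hM⟩ := hW.exists_norm_rayTransform_le 0 q
  obtain ⟨N, hN⟩ := hW.exists_norm_rayTransform_le j q
  refine ⟨‖(2 * Real.pi * Complex.I : ℂ)⁻¹‖ * (M + N), fun z hz h2 => ?_⟩
  obtain ⟨h0, hj⟩ := not_mem_contour hz
  rw [cauchyContour, contourIntegral, norm_mul]
  gcongr
  exact (norm_sub_le _ _).trans (add_le_add (hM z h0 h2) (hN z hj h2))

/-- If the moments of order less than `m` vanish, then the Cauchy transform is
`-(2πi)⁻¹ c z^{-m-1} + O(z^{-m-2})`, where `c` is the moment of order `m`. -/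
theorem GrowsOnRays.exists_norm_cauchyContour_sub_le (hW : GrowsOnRays D W) (j : ℕ) (q : ℂ[X])
    (m : ℕ) (hm : ∀ l < m, contourIntegral D j (expPoly W (X ^ l * q)) = 0) :
    ∃ M : ℝ, ∀ z ∉ contour D j, 2 ≤ ‖z‖ → ‖z ^ (m + 1) * cauchyContour D j (expPoly W q) z -
      -(2 * Real.pi * Complex.I)⁻¹ * contourIntegral D j (expPoly W (X ^ m * q))‖ ≤
        M * ‖z⁻¹‖ := by
  obtain ⟨M, hM⟩ := hW.exists_norm_cauchyContour_le j (X * (X * (X ^ m * q)))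
  set c := contourIntegral D j (expPoly W (X * (X ^ m * q)))
  refine ⟨M + ‖(2 * Real.pi * Complex.I : ℂ)⁻¹ * c‖, fun z hz h2 => ?_⟩
  have hz0 : z ≠ 0 := fun h => (not_mem_contour hz).1 (h ▸ zero_mem_ray D 0)
  rw [hW.cauchyContour_pow j q m hm hz, hW.cauchyContour_step j (X ^ m * q) hz,
    hW.cauchyContour_step j (X * (X ^ m * q)) hz]
  have : ∀ a b e : ℂ, z ^ (m + 1) * (z⁻¹ ^ m * (z⁻¹ * (z⁻¹ * (a - b) - e))) - -e =
      (a - b) * z⁻¹ := by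
    intro a b e
    rw [inv_pow]
    field_simp
    ring
  rw [neg_mul, this, norm_mul]
  gcongr
  exact (norm_sub_le _ _).trans (add_le_add (hM z hz h2) le_rfl)

/-- All local properties of the transforms are derived from this formula. Each logarithm is
unbounded at `0`, but the real parts of the two cancel. -/
theorem GrowsOnRays.exists_cauchyContour_eq (hW : GrowsOnRays D W) (j : ℕ) (q : ℂ[X]) :
    ∃ H : ℂ → ℂ, Differentiable ℂ H ∧ ∀ z ∉ contour D j, cauchyContour D j (expPoly W q) z =
      H z + (2 * Real.pi * Complex.I)⁻¹ * expPoly W q z *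
        (Complex.log (-(z / dir D j)) - Complex.log (-(z / dir D 0))) := by
  obtain ⟨H, hH, h⟩ := hW.exists_rayTransform_eq 0 q
  obtain ⟨K, hK, h'⟩ := hW.exists_rayTransform_eq j q
  refine ⟨fun z => (2 * Real.pi * Complex.I)⁻¹ * (H z - K z), by fun_prop, fun z hz => ?_⟩
  obtain ⟨h0, hj⟩ := not_mem_contour hz
  rw [cauchyContour, contourIntegral, h z h0, h' z hj]
  ring

/-! ### The real line -/

theorem realLine_eq_contour (hD : D ≠ 0) (he : Even D) : realLine = contour D (D / 2) := by
  ext z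
  simp only [realLine, contour, ray, dir_half hD he, dir_zero, Set.mem_range, Set.mem_union,
    Set.mem_ofPred_eq]
  constructor
  · rintro ⟨x, rfl⟩
    rcases le_total 0 x with h | h
    · exact Or.inl ⟨x, h, by simp⟩
    · exact Or.inr ⟨-x, by linarith, by simp⟩
  · rintro (⟨t, -, rfl⟩ | ⟨t, -, rfl⟩)
    · exact ⟨t, by simp⟩
    · exact ⟨-t, by simp⟩

/-- The negative half-line is the ray `C_{D/2}`; the reflection `t ↦ -t` accounts for the minus sign
in `contourIntegral`. -/
theorem integrable_and_integral_real (hD : D ≠ 0) (he : Even D) {F : ℂ → ℂ}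
    (h0 : IntegrableOn (fun t : ℝ => F (t * dir D 0) * dir D 0) (Set.Ioi 0))
    (h1 : IntegrableOn (fun t : ℝ => F (t * dir D (D / 2)) * dir D (D / 2)) (Set.Ioi 0)) :
    Integrable (fun x : ℝ => F x) ∧ ∫ x : ℝ, F x = contourIntegral D (D / 2) F := by
  have h1' := h1.neg
  simp only [dir_zero, mul_one] at h0
  have e : (fun t : ℝ => F t) ∘ Neg.neg =
      fun t : ℝ => -(F (t * dir D (D / 2)) * dir D (D / 2)) := by
    ext t; simp [dir_half hD he]
  have h2 : IntegrableOn (fun t : ℝ => F t) (Set.Iic 0) := by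
    rw [integrableOn_Iic_iff_integrableOn_Iio]
    have := ((Measure.measurePreserving_neg (volume : Measure ℝ)).integrableOn_comp_preimage
      (Homeomorph.neg ℝ).measurableEmbedding (f := fun t : ℝ => F t) (s := Set.Iio 0)).1
    refine this ?_
    rw [e]
    simpa using h1'
  have h3 : ∫ t in Set.Iic (0 : ℝ), F t = -rayIntegral D (D / 2) F := by
    have := integral_comp_neg_Ioi (0 : ℝ) (fun t : ℝ => F t)
    rw [neg_zero] at this
    rw [← this, rayIntegral, ← integral_neg]
    refine setIntegral_congr_fun measurableSet_Ioi fun t _ => ?_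
    simp [dir_half hD he]
  refine ⟨?_, ?_⟩
  · rw [← integrableOn_univ, ← Set.Iic_union_Ioi (a := (0 : ℝ))]
    exact h2.union h0
  · rw [← intervalIntegral.integral_Iic_add_Ioi h2 h0, h3]
    simp only [contourIntegral, rayIntegral, dir_zero, mul_one]
    ring

theorem GrowsOnRays.integrable_real (hW : GrowsOnRays D W) (he : Even D) (q : ℂ[X]) :
    Integrable fun x : ℝ => expPoly W q x :=
  (integrable_and_integral_real (by have := hW.two_le; omega) he
    ((hW.rayIntegrable _ q).mul_const _) ((hW.rayIntegrable _ q).mul_const _)).1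

theorem GrowsOnRays.integral_real (hW : GrowsOnRays D W) (he : Even D) (q : ℂ[X]) :
    ∫ x : ℝ, expPoly W q x = contourIntegral D (D / 2) (expPoly W q) :=
  (integrable_and_integral_real (by have := hW.two_le; omega) he
    ((hW.rayIntegrable _ q).mul_const _) ((hW.rayIntegrable _ q).mul_const _)).2

theorem GrowsOnRays.cauchyReal_eq (hW : GrowsOnRays D W) (he : Even D) (q : ℂ[X]) {z : ℂ}
    (hz : z ∉ contour D (D / 2)) :
    cauchyReal (expPoly W q) z = cauchyContour D (D / 2) (expPoly W q) z := by
  obtain ⟨h0, h1⟩ := not_mem_contour hz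
  rw [cauchyReal, cauchyContour]
  congr 1
  exact (integrable_and_integral_real (F := fun x => expPoly W q x / (x - z))
    (by have := hW.two_le; omega) he
    (hW.rayIntegrable_div _ q h0) (hW.rayIntegrable_div _ q h1)).2

end

section

/-! ### Removal of a matched jump -/

/-- Cauchy's theorem in a strip, with the horizontal sides tending to the boundary. -/
theorem tendsto_horizontal_integrals {f : ℂ → ℂ} {a b p q M : ℝ} (hab : a ≤ b) (hpq : p < q)
    (hd : ∀ s : ℂ, s.im ∈ Set.Ioo p q → DifferentiableAt ℂ f s)
    (hM : ∀ s : ℂ, s.re ∈ Set.Icc a b → ‖f s‖ ≤ M) :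
    (∀ x ∈ Set.Icc a b, IntervalIntegrable (fun y : ℝ => f (x + y * Complex.I)) volume p q) ∧
    Tendsto (fun ε : ℝ => (∫ x in a..b, f (x + (p + ε : ℝ) * Complex.I)) -
        ∫ x in a..b, f (x + (q - ε : ℝ) * Complex.I)) (𝓝[>] 0)
      (𝓝 (Complex.I * ((∫ y in p..q, f (a + y * Complex.I)) -
        ∫ y in p..q, f (b + y * Complex.I)))) := by
  -- Nothing is known on the two boundary lines beyond the bound; with continuity inside, this
  -- suffices for integrability over the full height.
  have hint : ∀ x ∈ Set.Icc a b,
      IntervalIntegrable (fun y : ℝ => f (x + y * Complex.I)) volume p q := by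
    intro x hx
    rw [intervalIntegrable_iff_integrableOn_Ioo_of_le hpq.le]
    refine IntegrableOn.of_bound (by simp) ?_ M (ae_of_all _ fun y => hM _ (by simpa using hx))
    refine ContinuousOn.aestronglyMeasurable (fun y hy => ?_) measurableSet_Ioo
    refine ContinuousAt.continuousWithinAt (ContinuousAt.comp (g := f) ?_ (by fun_prop))
    exact (hd _ (by simpa using hy)).continuousAt
  refine ⟨hint, ?_⟩
  have hv : ∀ x ∈ Set.Icc a b, Tendsto (fun ε : ℝ => ∫ y in (p + ε)..(q - ε),
      f (x + y * Complex.I)) (𝓝[>] 0) (𝓝 (∫ y in p..q, f (x + y * Complex.I))) := by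
    intro x hx
    have hc := intervalIntegral.continuousOn_primitive_interval' (hint x hx) Set.left_mem_uIcc
    rw [Set.uIcc_of_le hpq.le] at hc
    have hε : ∀ᶠ ε : ℝ in 𝓝[>] 0, 0 < ε ∧ ε < q - p := by
      filter_upwards [Ioo_mem_nhdsGT (sub_pos.2 hpq)] with ε h using h
    have h1 : Tendsto (fun ε : ℝ => ∫ y in p..(p + ε), f (x + y * Complex.I)) (𝓝[>] 0)
        (𝓝 (∫ y in p..p, f (x + y * Complex.I))) := by
      refine (hc p ⟨le_rfl, hpq.le⟩).tendsto.comp (tendsto_nhdsWithin_iff.2 ⟨?_, ?_⟩)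
      · exact tendsto_nhdsWithin_of_tendsto_nhds (by
          simpa using (by fun_prop : Continuous fun ε : ℝ => p + ε).tendsto 0)
      · exact hε.mono fun ε h => ⟨by linarith [h.1], by linarith [h.2]⟩
    have h2 : Tendsto (fun ε : ℝ => ∫ y in p..(q - ε), f (x + y * Complex.I)) (𝓝[>] 0)
        (𝓝 (∫ y in p..q, f (x + y * Complex.I))) := by
      refine (hc q ⟨hpq.le, le_rfl⟩).tendsto.comp (tendsto_nhdsWithin_iff.2 ⟨?_, ?_⟩)
      · exact tendsto_nhdsWithin_of_tendsto_nhds (by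
          simpa using (by fun_prop : Continuous fun ε : ℝ => q - ε).tendsto 0)
      · exact hε.mono fun ε h => ⟨by linarith [h.2], by linarith [h.1]⟩
    have h3 := h2.sub h1
    rw [intervalIntegral.integral_same, sub_zero] at h3
    refine h3.congr' (hε.mono fun ε h => ?_)
    refine intervalIntegral.integral_interval_sub_left ((hint x hx).mono_set ?_)
      ((hint x hx).mono_set ?_) <;>
    · rw [Set.uIcc_of_le (by linarith), Set.uIcc_of_le hpq.le]
      exact Set.Icc_subset_Icc le_rfl (by linarith)
  have h := ((hv a ⟨le_rfl, hab⟩).sub (hv b ⟨hab, le_rfl⟩)).const_mul Complex.I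
  refine h.congr' ?_
  filter_upwards [Ioo_mem_nhdsGT (show (0 : ℝ) < (q - p) / 2 by linarith)] with ε hε
  -- Cauchy's theorem is applied to the rectangle shrunk by `ε` at top and bottom, where the
  -- function is analytic.
  have := Complex.integral_boundary_rect_eq_zero_of_differentiableOn f
    ⟨a, p + ε⟩ ⟨b, q - ε⟩ (fun s hs => ?_)
  · simp only [smul_eq_mul] at this
    linear_combination -this
  · rw [Complex.mem_reProdIm] at hs
    have h2 := hs.2
    simp only [] at h2
    rw [Set.uIcc_of_le (by linarith [hε.2])] at h2
    exact (hd s ⟨by linarith [h2.1, hε.1], by linarith [h2.2, hε.1]⟩).differentiableWithinAt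

/-- If a `2πi`-periodic function is analytic off the lines `Im s = 2πk/D` and has no jump there,
then its mean over vertical periods is constant. -/
theorem integral_period_eq {D : ℕ} (hD : 0 < D) {K : ℂ → ℂ}
    (hd : ∀ k : ℕ, ∀ s : ℂ, s.im ∈ Set.Ioo (2 * Real.pi * k / D) (2 * Real.pi * (k + 1 : ℕ) / D) →
      DifferentiableAt ℂ K s)
    (hper : ∀ s, K (s + 2 * Real.pi * Complex.I) = K s) {a b M : ℝ} (hab : a ≤ b)
    (hM : ∀ s : ℂ, s.re ∈ Set.Icc a b → ‖K s‖ ≤ M)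
    (hjump : ∀ k < D, ∀ x : ℝ, Tendsto (fun ε : ℝ =>
      K (x + (2 * Real.pi * k / D + ε : ℝ) * Complex.I) -
      K (x + (2 * Real.pi * k / D - ε : ℝ) * Complex.I)) (𝓝[>] 0) (𝓝 0)) :
    (∀ x ∈ Set.Icc a b,
      IntervalIntegrable (fun y : ℝ => K (x + y * Complex.I)) volume 0 (2 * Real.pi)) ∧
    ∫ y in (0 : ℝ)..2 * Real.pi, K (a + y * Complex.I) =
      ∫ y in (0 : ℝ)..2 * Real.pi, K (b + y * Complex.I) := by
  have hD' : (0 : ℝ) < D := Nat.cast_pos.2 hD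
  set y : ℕ → ℝ := fun k => 2 * Real.pi * k / D with hy
  have hy0 : y 0 = 0 := by simp [hy]
  have hyD : y D = 2 * Real.pi := by simp only [hy]; field_simp
  have hstep : ∀ k, y (k + 1) = y k + 2 * Real.pi / D := fun k => by
    simp only [hy]; push_cast; ring
  have hpos : 0 < 2 * Real.pi / D := by have := Real.pi_pos; positivity
  have hlt : ∀ k, y k < y (k + 1) := fun k => by rw [hstep]; linarith
  have hstrip := fun k => tendsto_horizontal_integrals hab (hlt k) (hd k) hM
  have hsum : ∀ x ∈ Set.Icc a b, ∑ k ∈ Finset.range D, ∫ t in (y k)..(y (k + 1)),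
      K (x + t * Complex.I) = ∫ t in (0 : ℝ)..2 * Real.pi, K (x + t * Complex.I) := by
    intro x hx
    rw [intervalIntegral.sum_integral_adjacent_intervals fun k _ => (hstrip k).1 x hx, hy0, hyD]
  refine ⟨fun x hx => ?_, ?_⟩
  · rw [← hy0, ← hyD]
    exact IntervalIntegrable.trans_iterate fun k _ => (hstrip k).1 x hx
  set h : ℝ → ℂ := fun t => ∫ x in a..b, K (x + t * Complex.I) with hh
  have hlim1 : Tendsto (fun ε : ℝ => ∑ k ∈ Finset.range D, (h (y k + ε) - h (y (k + 1) - ε)))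
      (𝓝[>] 0) (𝓝 (∑ k ∈ Finset.range D, Complex.I * ((∫ t in (y k)..(y (k + 1)),
        K (a + t * Complex.I)) - ∫ t in (y k)..(y (k + 1)), K (b + t * Complex.I)))) :=
    tendsto_finsetSum _ fun k _ => (hstrip k).2
  have hzero : ∀ k < D, Tendsto (fun ε : ℝ => h (y k + ε) - h (y k - ε)) (𝓝[>] 0) (𝓝 0) := by
    intro k hk
    have hcont : ∀ (j : ℕ) (t : ℝ), t ∈ Set.Ioo (y j) (y (j + 1)) →
        Continuous fun x : ℝ => K (x + t * Complex.I) := fun j t ht =>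
      continuous_iff_continuousAt.2 fun x => ContinuousAt.comp (g := K)
        ((hd j _ (by simpa [hy] using ht)).continuousAt) (by fun_prop)
    have hc1 : ∀ ε : ℝ, ε ∈ Set.Ioo 0 (2 * Real.pi / D) →
        Continuous fun x : ℝ => K (x + (y k + ε : ℝ) * Complex.I) := fun ε hε =>
      hcont k _ ⟨by linarith [hε.1], by rw [hstep]; linarith [hε.2]⟩
    have hc2 : ∀ ε : ℝ, ε ∈ Set.Ioo 0 (2 * Real.pi / D) →
        Continuous fun x : ℝ => K (x + (y k - ε : ℝ) * Complex.I) := fun ε hε => by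
      -- Below the line with `k = 0` there is no strip in the list; periodicity moves that side to
      -- the top of the last strip.
      rcases Nat.eq_zero_or_pos k with rfl | h0
      · have e : ∀ x : ℝ, K (x + (y 0 - ε : ℝ) * Complex.I) =
            K (x + (y D - ε : ℝ) * Complex.I) := fun x => by
          rw [← hper, hyD, hy0]; congr 1; push_cast; ring
        simp only [e]
        obtain ⟨m, rfl⟩ := Nat.exists_eq_add_of_lt hD
        rw [zero_add] at *
        refine hcont m _ ⟨?_, ?_⟩ <;> rw [hstep] <;> linarith [hε.1, hε.2]
      · obtain ⟨m, rfl⟩ := Nat.exists_eq_add_of_lt h0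
        rw [zero_add] at *
        refine hcont m _ ⟨?_, ?_⟩ <;> rw [hstep] <;> linarith [hε.1, hε.2]
    have hev : ∀ᶠ ε : ℝ in 𝓝[>] 0, ε ∈ Set.Ioo 0 (2 * Real.pi / D) := Ioo_mem_nhdsGT hpos
    have hdom := intervalIntegral.tendsto_integral_filter_of_dominated_convergence
      (μ := volume) (a := a) (b := b) (l := 𝓝[>] (0 : ℝ))
      (F := fun ε x => K (x + (y k + ε : ℝ) * Complex.I) - K (x + (y k - ε : ℝ) * Complex.I))
      (f := fun _ => 0) (fun _ => M + M)
      (hev.mono fun ε hε => ((hc1 ε hε).sub (hc2 ε hε)).aestronglyMeasurable)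
      (hev.mono fun ε _ => ae_of_all _ fun x hx => ?_) intervalIntegrable_const
      (ae_of_all _ fun x _ => hjump k hk x)
    · rw [intervalIntegral.integral_zero] at hdom
      refine hdom.congr' (hev.mono fun ε hε => ?_)
      exact intervalIntegral.integral_sub ((hc1 ε hε).intervalIntegrable _ _)
        ((hc2 ε hε).intervalIntegrable _ _)
    · rw [Set.uIoc_of_le hab] at hx
      have hx' : x ∈ Set.Icc a b := ⟨hx.1.le, hx.2⟩
      exact (norm_sub_le _ _).trans
        (add_le_add (hM _ (by simpa using hx')) (hM _ (by simpa using hx')))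
  have hlim2 : Tendsto (fun ε : ℝ => ∑ k ∈ Finset.range D, (h (y k + ε) - h (y k - ε)))
      (𝓝[>] 0) (𝓝 (∑ k ∈ Finset.range D, 0)) :=
    tendsto_finsetSum _ fun k hk => hzero k (Finset.mem_range.1 hk)
  -- The sum over strips (bottom minus top) becomes a sum over lines (above minus below); the term
  -- left over by the shift of index vanishes by periodicity.
  have hsame : ∀ ε : ℝ, ∑ k ∈ Finset.range D, (h (y k + ε) - h (y k - ε)) =
      ∑ k ∈ Finset.range D, (h (y k + ε) - h (y (k + 1) - ε)) := by
    intro ε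
    have hp : h (y D - ε) = h (y 0 - ε) := by
      simp only [hh]
      refine intervalIntegral.integral_congr fun x _ => ?_
      rw [← hper (x + (y 0 - ε : ℝ) * Complex.I), hyD, hy0]; congr 1; push_cast; ring
    rw [← sub_eq_zero, ← Finset.sum_sub_distrib]
    have := Finset.sum_range_sub (fun k => h (y k - ε)) D
    rw [hp, sub_self] at this
    rw [← this]
    exact Finset.sum_congr rfl fun k _ => by ring
  simp only [hsame, Finset.sum_const_zero] at hlim2
  have := tendsto_nhds_unique hlim1 hlim2
  rw [← Finset.mul_sum, Finset.sum_sub_distrib, hsum a ⟨le_rfl, hab⟩, hsum b ⟨hab, le_rfl⟩] at this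
  exact sub_eq_zero.1 ((mul_eq_zero.1 this).resolve_left Complex.I_ne_zero)

theorem mem_Gam_iff {D : ℕ} (hD : 2 ≤ D) {z : ℂ} : z ∈ Gam D ↔ ∃ k < D, z ∈ ray D k := by
  simp only [Gam, contour, Set.mem_iUnion, Set.mem_Icc, Set.mem_union, exists_prop]
  constructor
  · rintro ⟨j, hj, h | h⟩
    · exact ⟨0, by omega, h⟩
    · exact ⟨j, by omega, h⟩
  · rintro ⟨k, hk, h⟩
    rcases Nat.eq_zero_or_pos k with rfl | h0
    · exact ⟨1, by omega, Or.inl h⟩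
    · exact ⟨k, by omega, Or.inr h⟩

theorem isClosed_Gam (D : ℕ) : IsClosed (Gam D) := by
  refine Set.Finite.isClosed_biUnion (Set.finite_Icc _ _) fun j _ => ?_
  exact (isClosed_ray D 0).union (isClosed_ray D j)

/-- In the coordinate `s = log z` the rays become horizontal lines, so strips and rectangles can
replace sectors. -/
theorem exp_mem_Gam {D : ℕ} (hD : 2 ≤ D) {s : ℂ} (hs : Complex.exp s ∈ Gam D) :
    ∃ m : ℤ, s.im = 2 * Real.pi * m / D := by
  obtain ⟨k, -, t, ht, h⟩ := (mem_Gam_iff hD).1 hs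
  have hD' : (D : ℝ) ≠ 0 := Nat.cast_ne_zero.2 (by omega)
  have hn : t = Real.exp s.re := by
    have := congrArg norm h
    rw [Complex.norm_exp, norm_mul, norm_dir, mul_one, Complex.norm_real,
      Real.norm_of_nonneg ht] at this
    exact this.symm
  rw [dir_eq, hn, Complex.ofReal_exp, ← Complex.exp_add, Complex.exp_eq_exp_iff_exists_int] at h
  obtain ⟨n, hn⟩ := h
  refine ⟨k + n * D, ?_⟩
  have := congrArg Complex.im hn
  simp at this
  rw [this]
  push_cast
  field_simp

theorem exp_notMem_Gam {D : ℕ} (hD : 2 ≤ D) {k : ℤ} {s : ℂ}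
    (hs : s.im ∈ Set.Ioo (2 * Real.pi * k / D) (2 * Real.pi * (k + 1) / D)) :
    Complex.exp s ∉ Gam D := by
  intro h
  obtain ⟨m, hm⟩ := exp_mem_Gam hD h
  rw [hm] at hs
  have hD' : (0 : ℝ) < D := Nat.cast_pos.2 (by omega)
  have hpi := Real.pi_pos
  have h1 : (k : ℝ) < m := by
    have := hs.1
    rw [div_lt_div_iff_of_pos_right hD'] at this
    nlinarith
  have h2 : (m : ℝ) < k + 1 := by
    have := hs.2
    rw [div_lt_div_iff_of_pos_right hD'] at this
    nlinarith
  have h1' : k < m := by exact_mod_cast h1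
  have h2' : m < k + 1 := by exact_mod_cast h2
  omega

/-- The sign of the orientation of `C_k` relative to the outward direction. -/
def orient (k : ℕ) : ℝ := if k = 0 then 1 else -1

theorem orient_eq (k : ℕ) : orient k = 1 ∨ orient k = -1 := by
  unfold orient; split_ifs <;> simp

theorem orient_mul_self (k : ℕ) : orient k * orient k = 1 := by
  rcases orient_eq k with h | h <;> simp [h]

theorem tangent_eq (D k : ℕ) : tangent D k = orient k * dir D k := by
  unfold tangent orient; split_ifs with h <;> simp [h]

theorem im_div_tangent (D k : ℕ) (z : ℂ) :
    (z / tangent D k).im = orient k * (z / dir D k).im := by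
  rcases orient_eq k with h | h <;> simp [tangent_eq, h, div_neg]

/-- A circle around the origin crosses the ray at a right angle: the chord is at most `e^r ε`, its
normal component is `e^r sin ε > e^r ε / 2`. So the arc approaches non-tangentially, with aperture
constant `1/2`; `orient k` converts counterclockwise and clockwise into left and right. -/
theorem tendsto_arc_cone {D k : ℕ} (r : ℝ) {σ : ℝ} (hσ : σ = 1 ∨ σ = -1) :
    Tendsto (fun ε : ℝ => Complex.exp (r + (2 * Real.pi * k / D + σ * ε : ℝ) * Complex.I)) (𝓝[>] 0)
      (𝓝[cone D k (σ * orient k) (1 / 2) (Real.exp r * dir D k)] (Real.exp r * dir D k)) := by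
  have he : ∀ ε : ℝ, Complex.exp (r + (2 * Real.pi * k / D + σ * ε : ℝ) * Complex.I) =
      Real.exp r * dir D k * Complex.exp ((σ * ε : ℝ) * Complex.I) := fun ε => by
    rw [dir_eq, Complex.ofReal_exp, ← Complex.exp_add, ← Complex.exp_add]
    congr 1; push_cast; ring
  simp only [he]
  refine tendsto_nhdsWithin_iff.2 ⟨tendsto_nhdsWithin_of_tendsto_nhds ?_, ?_⟩
  · have : Continuous fun ε : ℝ => (Real.exp r * dir D k : ℂ) *
        Complex.exp ((σ * ε : ℝ) * Complex.I) := by fun_prop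
    simpa using this.tendsto 0
  · filter_upwards [Ioo_mem_nhdsGT (show (0 : ℝ) < Real.pi / 2 by positivity)] with ε hε
    have hr := Real.exp_pos r
    have hd : (Real.exp r * dir D k * Complex.exp ((σ * ε : ℝ) * Complex.I) -
        Real.exp r * dir D k) / dir D k =
        (Real.exp r : ℂ) * (Complex.exp ((σ * ε : ℝ) * Complex.I) - 1) := by
      have := dir_ne_zero D k; field_simp
    have him : ((Real.exp r : ℂ) * (Complex.exp ((σ * ε : ℝ) * Complex.I) - 1)).im =
        Real.exp r * Real.sin (σ * ε) := by
      rw [Complex.im_ofReal_mul, Complex.sub_im, Complex.exp_ofReal_mul_I_im, Complex.one_im,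
        sub_zero]
    have hsin : σ * Real.sin (σ * ε) = Real.sin ε := by
      rcases hσ with rfl | rfl <;> simp
    have habs : ‖σ * ε‖ = ε := by
      rcases hσ with rfl | rfl <;> simp [abs_of_pos hε.1]
    have hnorm : ‖(Real.exp r * dir D k * Complex.exp ((σ * ε : ℝ) * Complex.I) -
        Real.exp r * dir D k : ℂ)‖ ≤ Real.exp r * ε := by
      rw [show (Real.exp r * dir D k * Complex.exp ((σ * ε : ℝ) * Complex.I) -
        Real.exp r * dir D k : ℂ) = Real.exp r * dir D k *
          (Complex.exp (Complex.I * (σ * ε : ℝ)) - 1) by rw [mul_comm Complex.I]; ring,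
        norm_mul, norm_mul, norm_dir, mul_one, Complex.norm_real, Real.norm_of_nonneg hr.le]
      have := Real.norm_exp_I_mul_ofReal_sub_one_le (x := σ * ε)
      rw [habs] at this
      gcongr
    have hlow : ε / 2 < Real.sin ε := by
      refine lt_of_lt_of_le ?_ (Real.mul_lt_sin hε.1 hε.2).le
      rw [div_mul_eq_mul_div, lt_div_iff₀ Real.pi_pos]
      nlinarith [Real.pi_lt_four, hε.1]
    simp only [cone, Set.mem_ofPred_eq]
    rw [im_div_tangent, hd, him]
    calc 1 / 2 * _ ≤ 1 / 2 * (Real.exp r * ε) := by gcongr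
      _ < Real.exp r * Real.sin ε := by nlinarith
      _ = _ := by rw [← hsin]; linear_combination (-(σ * Real.sin (σ * ε) * Real.exp r)) *
                    orient_mul_self k

/-- A function analytic off `Γ`, bounded near `Γ`, without jump across `Γ` and with a limit at
infinity is constant. -/
theorem eq_limit_of_no_jump {D : ℕ} (hD : 2 ≤ D) {g : ℂ → ℂ} {c : ℂ}
    (hg : AnalyticOnNhd ℂ g (Gam D)ᶜ)
    (hb : ∀ x ∈ Gam D, ∃ r > 0, ∃ M : ℝ, ∀ z ∉ Gam D, dist z x < r → ‖g z‖ ≤ M)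
    (hjump : ∀ k < D, ∀ x ∈ ray D k, x ≠ 0 → ∃ b : ℂ, ∀ s : ℝ, (s = 1 ∨ s = -1) →
      ∀ c > 0, Tendsto g (𝓝[cone D k s c x] x) (𝓝 b))
    (hlim : Tendsto g (Bornology.cobounded ℂ ⊓ 𝓟 (Gam D)ᶜ) (𝓝 c)) :
    ∀ z ∉ Gam D, g z = c := by
  classical
  intro z₀ hz₀
  have hopen : IsOpen (Gam D)ᶜ := (isClosed_Gam D).isOpen_compl
  have hds : DifferentiableOn ℂ (dslope g z₀) (Gam D)ᶜ :=
    (Complex.differentiableOn_dslope (hopen.mem_nhds hz₀)).2 hg.differentiableOn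
  -- The quotient `(g - g(z₀))/(z - z₀)` is still bounded near `Γ` and without jump. Its integral
  -- over a circle is independent of the radius: it tends to `0` for small circles and to `2πi (c -
  -- g(z₀))` for large ones. The value `0` on `Γ` makes local bounds hold everywhere.
  set q : ℂ → ℂ := (Gam D)ᶜ.indicator (dslope g z₀) with hq
  have hq_of : ∀ z ∉ Gam D, q z = dslope g z₀ z := fun z hz => Set.indicator_of_mem hz _
  have hq_mem : ∀ z ∈ Gam D, q z = 0 := fun z hz => Set.indicator_of_notMem (by simpa using hz) _
  have hqd : ∀ z ∉ Gam D, DifferentiableAt ℂ q z := fun z hz => by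
    refine (hds.differentiableAt (hopen.mem_nhds hz)).congr_of_eventuallyEq ?_
    filter_upwards [hopen.mem_nhds hz] with w hw using hq_of w hw
  have hloc : ∀ x : ℂ, ∃ t ∈ 𝓝 x, ∃ M : ℝ, ∀ z ∈ t, ‖q z‖ ≤ M := by
    intro x
    by_cases hx : x ∈ Gam D
    · obtain ⟨r, hr, M, hM⟩ := hb x hx
      have hne : 0 < ‖x - z₀‖ := norm_pos_iff.2 (sub_ne_zero.2 fun h => hz₀ (h ▸ hx))
      refine ⟨Metric.ball x (min r (‖x - z₀‖ / 2)), Metric.ball_mem_nhds _ (by positivity),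
        |(M + ‖g z₀‖) / (‖x - z₀‖ / 2)|, fun z hz => ?_⟩
      by_cases hzG : z ∈ Gam D
      · rw [hq_mem z hzG, norm_zero]; positivity
      · have hz1 : dist z x < r := lt_of_lt_of_le hz (min_le_left _ _)
        have hz2 : dist z x < ‖x - z₀‖ / 2 := lt_of_lt_of_le hz (min_le_right _ _)
        have h3 : ‖x - z₀‖ / 2 ≤ ‖z - z₀‖ := by
          have := norm_sub_le_norm_sub_add_norm_sub x z z₀
          rw [dist_eq_norm, norm_sub_rev] at hz2
          linarith
        have hzz : z ≠ z₀ := fun h => by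
          rw [h, sub_self, norm_zero] at h3; linarith
        rw [hq_of z hzG, dslope_of_ne _ hzz, slope_def_field, norm_div]
        refine le_trans ?_ (le_abs_self _)
        gcongr
        · exact (norm_nonneg _).trans ((norm_sub_le _ _).trans (add_le_add (hM z hzG hz1) le_rfl))
        · exact (norm_sub_le _ _).trans (add_le_add (hM z hzG hz1) le_rfl)
    · obtain ⟨t, ht, hM⟩ := (hqd x hx).continuousAt.norm.eventually_lt_const
        (lt_add_one ‖q x‖) |>.exists_mem
      exact ⟨t, ht, ‖q x‖ + 1, fun z hz => (hM z hz).le⟩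
  have hball : ∀ R : ℝ, ∃ M : ℝ, 0 ≤ M ∧ ∀ z : ℂ, ‖z‖ ≤ R → ‖q z‖ ≤ M := by
    intro R
    obtain ⟨M, hM⟩ : ∃ M : ℝ, ∀ z ∈ Metric.closedBall (0 : ℂ) R, ‖q z‖ ≤ M := by
      refine (isCompact_closedBall (0 : ℂ) R).induction_on (p := fun s => ∃ M, ∀ z ∈ s, ‖q z‖ ≤ M)
        ⟨0, fun z hz => hz.elim⟩ (fun s t hst ⟨M, hM⟩ => ⟨M, fun z hz => hM z (hst hz)⟩)
        (fun s t ⟨M, hM⟩ ⟨N, hN⟩ => ⟨max M N, ?_⟩) (fun x _ => ?_)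
      · rintro z (hz | hz)
        · exact (hM z hz).trans (le_max_left _ _)
        · exact (hN z hz).trans (le_max_right _ _)
      · obtain ⟨t, ht, M, hM⟩ := hloc x
        exact ⟨t, mem_nhdsWithin_of_mem_nhds ht, M, hM⟩
    exact ⟨|M|, abs_nonneg _, fun z hz => (hM z (by simpa using hz)).trans (le_abs_self M)⟩
  -- The factor `e^s` is the Jacobian of `z = e^s`: the integral of `K` over a vertical period is
  -- that of `q` over a circle, up to the factor `i`.
  set K : ℂ → ℂ := fun s => Complex.exp s * q (Complex.exp s) with hK
  have hKd : ∀ s, Complex.exp s ∉ Gam D → DifferentiableAt ℂ K s := fun s hs =>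
    Complex.differentiableAt_exp.mul ((hqd _ hs).comp s Complex.differentiableAt_exp)
  have hKstrip : ∀ k : ℕ, ∀ s : ℂ,
      s.im ∈ Set.Ioo (2 * Real.pi * k / D) (2 * Real.pi * (k + 1 : ℕ) / D) →
      DifferentiableAt ℂ K s := fun k s hs =>
    hKd s (exp_notMem_Gam hD (k := k) (by push_cast at hs ⊢; exact hs))
  have hper : ∀ s, K (s + 2 * Real.pi * Complex.I) = K s := fun s => by
    simp only [hK, Complex.exp_periodic s]
  have hKb : ∀ a b : ℝ, ∃ M : ℝ, ∀ s : ℂ, s.re ∈ Set.Icc a b → ‖K s‖ ≤ M := by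
    intro a b
    obtain ⟨M, hM0, hM⟩ := hball (Real.exp b)
    refine ⟨Real.exp b * M, fun s hs => ?_⟩
    have : ‖Complex.exp s‖ ≤ Real.exp b := by
      rw [Complex.norm_exp]; exact Real.exp_le_exp.2 hs.2
    rw [hK, norm_mul]
    gcongr
    exact hM _ this
  have hside : ∀ k < D, ∀ x : ℝ, ∃ L : ℂ, ∀ σ : ℝ, (σ = 1 ∨ σ = -1) → Tendsto (fun ε : ℝ =>
      K (x + (2 * Real.pi * k / D + σ * ε : ℝ) * Complex.I)) (𝓝[>] 0) (𝓝 L) := by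
    intro k hk x
    have hxr : (Real.exp x : ℂ) * dir D k ∈ ray D k := ⟨_, (Real.exp_pos x).le, rfl⟩
    have hx0 : (Real.exp x : ℂ) * dir D k ≠ 0 :=
      mul_ne_zero (by exact_mod_cast (Real.exp_pos x).ne') (dir_ne_zero D k)
    obtain ⟨b, hbl⟩ := hjump k hk _ hxr hx0
    set X : ℂ := Real.exp x * dir D k with hX
    have hXG : X ∈ Gam D := (mem_Gam_iff hD).2 ⟨k, hk, hxr⟩
    have hXz : X - z₀ ≠ 0 := sub_ne_zero.2 fun h => hz₀ (h ▸ hXG)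
    refine ⟨X * ((b - g z₀) / (X - z₀)), fun σ hσ => ?_⟩
    have harc := tendsto_arc_cone (D := D) (k := k) x hσ
    have hs : σ * orient k = 1 ∨ σ * orient k = -1 := by
      rcases hσ with rfl | rfl <;> rcases orient_eq k with h | h <;> simp [h]
    have h1 := (hbl _ hs (1 / 2) (by norm_num)).comp harc
    have h2 := tendsto_nhds_of_tendsto_nhdsWithin harc
    have h3 := h2.mul ((h1.sub_const (g z₀)).div (h2.sub_const z₀) hXz)
    refine h3.congr' ?_
    have hD' : (0 : ℝ) < D := Nat.cast_pos.2 (by omega)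
    filter_upwards [Ioo_mem_nhdsGT (show (0 : ℝ) < 2 * Real.pi / D by
      have := Real.pi_pos; positivity), h2.eventually_ne (sub_ne_zero.1 hXz)] with ε hε hne
    have hnot : Complex.exp (x + (2 * Real.pi * k / D + σ * ε : ℝ) * Complex.I) ∉ Gam D := by
      rcases hσ with rfl | rfl
      · refine exp_notMem_Gam hD (k := k) ⟨?_, ?_⟩
        · simpa using hε.1
        · have := hε.2
          simp; rw [mul_add, add_div, mul_one]; linarith
      · refine exp_notMem_Gam hD (k := (k : ℤ) - 1) ⟨?_, ?_⟩
        · have := hε.2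
          simp; rw [mul_sub, sub_div, mul_one]; linarith
        · simpa using hε.1
    simp only [hK, Function.comp, hq_of _ hnot, dslope_of_ne _ hne, slope_def_field, Pi.div_apply]
  have hjump' : ∀ k < D, ∀ x : ℝ, Tendsto (fun ε : ℝ =>
      K (x + (2 * Real.pi * k / D + ε : ℝ) * Complex.I) -
      K (x + (2 * Real.pi * k / D - ε : ℝ) * Complex.I)) (𝓝[>] 0) (𝓝 0) := by
    intro k hk x
    obtain ⟨L, hL⟩ := hside k hk x
    have := (hL 1 (Or.inl rfl)).sub (hL (-1) (Or.inr rfl))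
    simpa [← sub_eq_add_neg] using this
  have hmain : ∀ a b : ℝ, a ≤ b → _ := fun a b hab =>
    integral_period_eq (by omega : 0 < D) hKstrip hper hab (hKb a b).choose_spec hjump'
  have hpi := Real.pi_pos
  -- the mean vanishes
  have hzero : ∀ b : ℝ, 0 ≤ b → ∫ y in (0 : ℝ)..2 * Real.pi, K (b + y * Complex.I) = 0 := by
    intro b hb0
    obtain ⟨M, hM0, hM⟩ := hball 1
    rw [← norm_le_zero_iff]
    have hle : ∀ a : ℝ, a ≤ 0 → ‖∫ y in (0 : ℝ)..2 * Real.pi, K (b + y * Complex.I)‖ ≤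
        Real.exp a * M * (2 * Real.pi) := by
      intro a ha
      rw [← (hmain a b (ha.trans hb0)).2]
      refine (intervalIntegral.norm_integral_le_of_norm_le_const (C := Real.exp a * M)
        fun y _ => ?_).trans_eq ?_
      · have hn : ‖Complex.exp (a + y * Complex.I)‖ = Real.exp a := by
          rw [Complex.norm_exp]; simp
        rw [hK, norm_mul, hn]
        gcongr
        exact hM _ (by rw [hn]; exact Real.exp_le_one_iff.2 ha)
      · rw [sub_zero, abs_of_pos (by positivity)]
    -- Here `a → -∞`, so the circle shrinks to the origin; `min a 0` keeps the bound valid for every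
    -- `a`.
    refine ge_of_tendsto' (x := atBot) (f := fun a : ℝ => Real.exp (min a 0) * M * (2 * Real.pi))
      ?_ (fun a => hle _ (min_le_right _ _))
    have h0 : Tendsto (fun a : ℝ => Real.exp (min a 0)) atBot (𝓝 0) :=
      Real.tendsto_exp_atBot.congr' ((eventually_le_atBot 0).mono fun a ha => by
        simp only [min_eq_left ha])
    simpa using (h0.mul_const M).mul_const (2 * Real.pi)
  -- the behaviour at infinity
  have hinf : Tendsto (fun z => z * dslope g z₀ z) (Bornology.cobounded ℂ ⊓ 𝓟 (Gam D)ᶜ)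
      (𝓝 (c - g z₀)) := by
    have hle : Bornology.cobounded ℂ ⊓ 𝓟 (Gam D)ᶜ ≤ Bornology.cobounded ℂ := inf_le_left
    have hinv : Tendsto (fun z : ℂ => z₀ * z⁻¹) (Bornology.cobounded ℂ ⊓ 𝓟 (Gam D)ᶜ) (𝓝 0) := by
      simpa using ((tendsto_inv₀_cobounded (α := ℂ)).mono_left hle).const_mul z₀
    have h1 := (hlim.sub_const (g z₀)).div (hinv.const_sub 1) (by simp)
    rw [sub_zero, div_one] at h1
    refine h1.congr' ?_
    have hev : ∀ᶠ z : ℂ in Bornology.cobounded ℂ, ‖z₀‖ < ‖z‖ :=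
      tendsto_norm_cobounded_atTop.eventually_gt_atTop _
    filter_upwards [hle hev] with z hz
    have hz0 : z ≠ 0 := norm_pos_iff.1 ((norm_nonneg _).trans_lt hz)
    have hzz : z ≠ z₀ := fun h => by rw [h] at hz; exact lt_irrefl _ hz
    have : z - z₀ ≠ 0 := sub_ne_zero.2 hzz
    have e : 1 - z₀ * z⁻¹ = (z - z₀) / z := by field_simp
    simp only [Pi.div_apply]
    rw [dslope_of_ne _ hzz, slope_def_field, e]
    field_simp
  have hsmall : ∀ η > 0, ‖c - g z₀‖ ≤ η := by
    intro η hη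
    have hev := hinf.eventually (Metric.closedBall_mem_nhds _ hη)
    rw [eventually_inf_principal] at hev
    obtain ⟨R, -, hR⟩ := (Filter.hasBasis_cobounded_norm (E := ℂ)).mem_iff.1 hev
    set a := max 0 (Real.log (max R 1)) with ha
    have haR : R ≤ Real.exp a := by
      calc R ≤ max R 1 := le_max_left _ _
        _ = Real.exp (Real.log (max R 1)) := (Real.exp_log (by positivity)).symm
        _ ≤ Real.exp a := Real.exp_le_exp.2 (le_max_right _ _)
    have hint := (hmain a a le_rfl).1 a ⟨le_rfl, le_rfl⟩
    -- The estimate at infinity holds off `Γ` only, but the circle meets `Γ` for countably many `y`.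
    have hae : ∀ᵐ y : ℝ, Complex.exp (a + y * Complex.I) ∉ Gam D := by
      have hc : (Set.range fun m : ℤ => 2 * Real.pi * m / D).Countable := Set.countable_range _
      filter_upwards [hc.ae_notMem volume] with y hy h
      obtain ⟨m, hm⟩ := exp_mem_Gam hD h
      exact hy ⟨m, by simpa using hm.symm⟩
    have hb : ‖∫ y in (0 : ℝ)..2 * Real.pi, (K (a + y * Complex.I) - (c - g z₀))‖ ≤
        η * |2 * Real.pi - 0| := by
      refine intervalIntegral.norm_integral_le_of_norm_le_const_ae ?_
      filter_upwards [hae] with y hy _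
      have hn : ‖Complex.exp (a + y * Complex.I)‖ = Real.exp a := by
        rw [Complex.norm_exp]; simp
      have := hR (show R ≤ ‖Complex.exp (a + y * Complex.I)‖ by rw [hn]; exact haR) hy
      simp only [hK, hq_of _ hy]
      simpa [dist_eq_norm] using this
    rw [intervalIntegral.integral_sub hint intervalIntegrable_const, hzero a (le_max_left _ _),
      intervalIntegral.integral_const, zero_sub, norm_neg, norm_smul, sub_zero,
      Real.norm_of_nonneg (by positivity), abs_of_pos (by positivity), mul_comm η] at hb
    exact le_of_mul_le_mul_left hb (by positivity)
  have : ‖c - g z₀‖ ≤ 0 := le_of_forall_gt_imp_ge_of_dense fun η hη => hsmall η hη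
  exact (sub_eq_zero.1 (norm_le_zero_iff.1 this)).symm

end

section

/-! ### The skew-symmetric form -/

/-- The standing hypotheses on the potential. -/
structure Admissible (V : ℝ[X]) : Prop where
  two_le : 2 ≤ V.natDegree
  even : Even V.natDegree
  lead_pos : 0 < V.leadingCoeff

/-- `V` as a complex polynomial. -/
def cpot (V : ℝ[X]) : ℂ[X] := V.map (algebraMap ℝ ℂ)

/-- `2V` as a complex polynomial. -/
def cpot₂ (V : ℝ[X]) : ℂ[X] := C 2 * V.map (algebraMap ℝ ℂ)

variable {V : ℝ[X]}

theorem Admissible.grows (hV : Admissible V) : GrowsOnRays V.natDegree (cpot V) := by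
  refine ⟨natDegree_map _, hV.two_le, ?_⟩
  rw [cpot, leadingCoeff_map]
  exact hV.lead_pos

theorem Admissible.grows₂ (hV : Admissible V) : GrowsOnRays V.natDegree (cpot₂ V) := by
  refine ⟨?_, hV.two_le, ?_⟩
  · rw [cpot₂, natDegree_C_mul two_ne_zero, natDegree_map]
  · rw [cpot₂, leadingCoeff_mul, leadingCoeff_C, leadingCoeff_map]
    have := hV.lead_pos
    simpa using this

theorem eval_map_ofReal (p : ℝ[X]) (x : ℝ) :
    (p.map (algebraMap ℝ ℂ)).eval (x : ℂ) = (p.eval x : ℝ) := by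
  rw [eval_map_algebraMap]
  exact (Polynomial.ofReal_eval p x).symm

theorem expPoly_cpot₂_ofReal (p : ℝ[X]) (x : ℝ) :
    expPoly (cpot₂ V) (p.map (algebraMap ℝ ℂ)) x =
      ((p.eval x * Real.exp (-2 * V.eval x) : ℝ) : ℂ) := by
  rw [expPoly, cpot₂, eval_mul, eval_C, eval_map_ofReal, eval_map_ofReal, mul_comm]
  push_cast
  ring_nf

/-- `∫ p e^{-2V} dx`. -/
def weightInt (V p : ℝ[X]) : ℝ := ∫ x : ℝ, p.eval x * Real.exp (-2 * V.eval x)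

theorem Admissible.integrable (hV : Admissible V) (p : ℝ[X]) :
    Integrable fun x : ℝ => p.eval x * Real.exp (-2 * V.eval x) := by
  have := (hV.grows₂.integrable_real hV.even (p.map (algebraMap ℝ ℂ))).re
  simpa only [expPoly_cpot₂_ofReal, RCLike.re_eq_complex_re, Complex.ofReal_re] using this

theorem Admissible.contourIntegral_map (hV : Admissible V) (p : ℝ[X]) :
    contourIntegral V.natDegree (V.natDegree / 2) (expPoly (cpot₂ V) (p.map (algebraMap ℝ ℂ))) =
      (weightInt V p : ℂ) := by
  rw [← hV.grows₂.integral_real hV.even, weightInt]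
  simp only [expPoly_cpot₂_ofReal]
  exact integral_ofReal

theorem Admissible.weightInt_add (hV : Admissible V) (p q : ℝ[X]) :
    weightInt V (p + q) = weightInt V p + weightInt V q := by
  rw [weightInt, weightInt, weightInt, ← integral_add (hV.integrable p) (hV.integrable q)]
  simp only [eval_add, add_mul]

theorem weightInt_smul (c : ℝ) (p : ℝ[X]) : weightInt V (c • p) = c * weightInt V p := by
  rw [weightInt, weightInt, ← integral_const_mul]
  simp only [eval_smul, smul_eq_mul, mul_assoc]

theorem Admissible.weightInt_deriv (hV : Admissible V) (p : ℝ[X]) :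
    weightInt V (derivative p - C 2 * derivative V * p) = 0 := by
  have h := hV.contourIntegral_map (derivative p - C 2 * derivative V * p)
  have e : (derivative p - C 2 * derivative V * p).map (algebraMap ℝ ℂ) =
      derivative (p.map (algebraMap ℝ ℂ)) - derivative (cpot₂ V) * p.map (algebraMap ℝ ℂ) := by
    simp [cpot₂, derivative_map]
  rw [e, hV.grows₂.contourIntegral_deriv] at h
  exact_mod_cast h.symm

theorem Admissible.weightInt_pos (hV : Admissible V) {p : ℝ[X]} (h0 : ∀ x, 0 ≤ p.eval x)
    (hp : p ≠ 0) : 0 < weightInt V p := by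
  obtain ⟨x, hx⟩ : ∃ x, p.eval x ≠ 0 := by
    by_contra! h
    exact hp (Polynomial.funext fun x => by rw [h x, eval_zero])
  refine integral_pos_of_integrable_nonneg_nonzero (x := x) (by fun_prop) (hV.integrable p)
    (fun y => mul_nonneg (h0 y) (Real.exp_pos _).le) (mul_ne_zero hx (Real.exp_pos _).ne')

theorem skewProd_eq_wronskian (P Q : ℝ[X]) :
    skewProd V P Q = 1 / 2 * weightInt V (wronskian P Q) := by
  simp only [skewProd, weightInt, wronskian, eval_sub, eval_mul]

/-- The Wronskian differs from `2P(Q' - V'Q)` by `e^{2V}(PQ e^{-2V})'`, which integrates to zero. In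
this form the skew product is, up to a constant, a moment of the dual of `Q`. -/
theorem Admissible.skewProd_eq (hV : Admissible V) (P Q : ℝ[X]) :
    skewProd V P Q = weightInt V (P * (derivative Q - derivative V * Q)) := by
  have e : wronskian P Q = (2 : ℝ) • (P * (derivative Q - derivative V * Q)) +
      (-1 : ℝ) • (derivative (P * Q) - C 2 * derivative V * (P * Q)) := by
    simp only [wronskian, derivative_mul, smul_eq_C_mul, C_neg, C_1, map_ofNat]
    ring
  rw [skewProd_eq_wronskian, e, hV.weightInt_add, weightInt_smul, weightInt_smul,
    hV.weightInt_deriv]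
  ring

/-- The form `⟨·,·⟩₄` as a bilinear map. -/
def Admissible.skew (hV : Admissible V) : ℝ[X] →ₗ[ℝ] ℝ[X] →ₗ[ℝ] ℝ :=
  LinearMap.mk₂ ℝ (skewProd V)
    (fun p q r => by
      simp only [skewProd_eq_wronskian, wronskian_add_left, hV.weightInt_add]; ring)
    (fun c p q => by
      have : wronskian (c • p) q = c • wronskian p q := by
        simp [wronskian, smul_sub]
      simp only [skewProd_eq_wronskian, this, weightInt_smul, smul_eq_mul]; ring)
    (fun p q r => by
      simp only [skewProd_eq_wronskian, wronskian_add_right, hV.weightInt_add]; ring)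
    (fun c p q => by
      have : wronskian p (c • q) = c • wronskian p q := by
        simp [wronskian, smul_sub]
      simp only [skewProd_eq_wronskian, this, weightInt_smul, smul_eq_mul]; ring)

theorem Admissible.skew_apply (hV : Admissible V) (p q : ℝ[X]) : hV.skew p q = skewProd V p q := rfl

theorem Admissible.skew_self (hV : Admissible V) (p : ℝ[X]) : hV.skew p p = 0 := by
  rw [hV.skew_apply, skewProd_eq_wronskian, wronskian_self_eq_zero]
  simp [weightInt]

theorem Admissible.skew_neg (hV : Admissible V) (p q : ℝ[X]) : hV.skew p q = -hV.skew q p := by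
  have := hV.skew_self (p + q)
  rw [map_add, map_add, LinearMap.add_apply, LinearMap.add_apply, hV.skew_self, hV.skew_self] at this
  linarith

/-- The form with weight `r² e^{-2V}` is nondegenerate on polynomials of degree less than `2n`. -/
def Admissible.Nondegenerate (hV : Admissible V) (n : ℕ) (r : ℝ[X]) : Prop :=
  ∀ p ∈ degreeLT ℝ (2 * n), (∀ q ∈ degreeLT ℝ (2 * n), hV.skew (r * p) (r * q) = 0) → p = 0

/-- Nondegeneracy makes the map into the dual space injective, hence bijective by equality of
dimensions; `u` represents the functional given by `f`. -/
theorem Admissible.Nondegenerate.exists_proj {hV : Admissible V} {n : ℕ} {r : ℝ[X]}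
    (h : hV.Nondegenerate n r) (f : ℝ[X]) :
    ∃ u ∈ degreeLT ℝ (2 * n), ∀ q ∈ degreeLT ℝ (2 * n), hV.skew (r * (f - u)) (r * q) = 0 := by
  have : FiniteDimensional ℝ (degreeLT ℝ (2 * n)) :=
    Module.Finite.equiv (degreeLTEquiv ℝ (2 * n)).symm
  set B : ℝ[X] →ₗ[ℝ] Module.Dual ℝ (degreeLT ℝ (2 * n)) :=
    (LinearMap.lcomp ℝ ℝ ((LinearMap.mulLeft ℝ r).comp (degreeLT ℝ (2 * n)).subtype)).comp
      (hV.skew.comp (LinearMap.mulLeft ℝ r)) with hB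
  have hBa : ∀ p (q : degreeLT ℝ (2 * n)), B p q = hV.skew (r * p) (r * q) := fun p q => rfl
  have hinj : Function.Injective (B.comp (degreeLT ℝ (2 * n)).subtype) := by
    rw [← LinearMap.ker_eq_bot, LinearMap.ker_eq_bot']
    intro p hp
    refine Subtype.ext (h p p.2 fun q hq => ?_)
    have := LinearMap.congr_fun hp ⟨q, hq⟩
    exact this
  have hsurj := (LinearMap.injective_iff_surjective_of_finrank_eq_finrank
    Subspace.dual_finrank_eq.symm).1 hinj
  obtain ⟨u, hu⟩ := hsurj (B f)
  refine ⟨u, u.2, fun q hq => ?_⟩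
  have := LinearMap.congr_fun hu ⟨q, hq⟩
  rw [LinearMap.comp_apply, Submodule.subtype_apply, hBa, hBa] at this
  simp only [] at this
  rw [mul_sub, map_sub, LinearMap.sub_apply, this, sub_self]

theorem eval_pos_or_neg {p : ℝ[X]} (h : ∀ x, p.eval x ≠ 0) :
    (∀ x, 0 < p.eval x) ∨ ∀ x, p.eval x < 0 := by
  by_contra! hc
  obtain ⟨⟨a, ha⟩, b, hb⟩ := hc
  obtain ⟨x, hx⟩ := mem_range_of_exists_le_of_exists_ge p.continuous ⟨a, ha⟩ ⟨b, hb⟩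
  exact h x hx

theorem monic_sub_of_mem {m k : ℕ} (hk : k ≤ m) {u : ℝ[X]} (hu : u ∈ degreeLT ℝ k) :
    (X ^ m - u).Monic ∧ (X ^ m - u).natDegree = m := by
  have hlt : u.degree < (m : WithBot ℕ) :=
    (mem_degreeLT.1 hu).trans_le (by exact_mod_cast hk)
  exact ⟨monic_X_pow_sub hlt, by
    rw [natDegree_eq_of_degree_eq_some (n := m)]
    rw [degree_sub_eq_left_of_degree_lt (by rwa [degree_X_pow]), degree_X_pow]⟩

theorem sub_smul_mem_degreeLT {R : Type*} [CommRing R] {m : ℕ} {p a : R[X]} (ha : a.Monic)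
    (hd : a.natDegree = m) (hp : p ∈ degreeLT R (m + 1)) : p - p.coeff m • a ∈ degreeLT R m := by
  rw [mem_degreeLT, degree_lt_iff_coeff_zero] at hp ⊢
  intro k hk
  rw [coeff_sub, coeff_smul, smul_eq_mul]
  rcases hk.eq_or_lt with rfl | h
  · rw [← hd] at *
    rw [ha.coeff_natDegree, mul_one, sub_self]
  · rw [hp k h, coeff_eq_zero_of_natDegree_lt (p := a) (n := k) (by omega), mul_zero, sub_zero]

/-- If the Wronskian vanishes at `t`, the vectors of value and derivative of `a` and `b` at `t` are
linearly dependent, and a nontrivial combination has a double zero there. -/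
theorem exists_sq_dvd {a b : ℝ[X]} {t : ℝ} (h : (wronskian a b).eval t = 0) :
    ∃ α β : ℝ, (α ≠ 0 ∨ β ≠ 0) ∧ (X - C t) ^ 2 ∣ α • a + β • b := by
  have hdvd : ∀ c : ℝ[X], c.eval t = 0 → (derivative c).eval t = 0 → (X - C t) ^ 2 ∣ c := by
    intro c h0 h1
    obtain ⟨e, rfl⟩ := dvd_iff_isRoot.2 h0
    simp only [derivative_mul, eval_add, eval_mul, eval_sub, eval_X, eval_C, sub_self, zero_mul,
      add_zero, derivative_sub, derivative_X, derivative_C, sub_zero, one_mul] at h1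
    obtain ⟨e', rfl⟩ := dvd_iff_isRoot.2 h1
    exact ⟨e', by ring⟩
  simp only [wronskian, eval_sub, eval_mul] at h
  by_cases ha : a.eval t = 0 ∧ b.eval t = 0
  · by_cases hb : (derivative b).eval t = 0
    · exact ⟨0, 1, Or.inr one_ne_zero, hdvd _ (by simp [ha]) (by simp [hb])⟩
    · refine ⟨(derivative b).eval t, -(derivative a).eval t, Or.inl hb,
        hdvd _ (by simp [ha]) ?_⟩
      simp only [derivative_add, derivative_smul, eval_add, eval_smul, smul_eq_mul]; ring
  · refine ⟨b.eval t, -a.eval t, ?_, hdvd _ ?_ ?_⟩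
    · rw [neg_ne_zero, ← not_and_or, and_comm]; exact ha
    · simp only [eval_add, eval_smul, smul_eq_mul]; ring
    · simp only [derivative_add, derivative_smul, eval_add, eval_smul, smul_eq_mul]
      linear_combination -h

/-- Induction on `n`, for all `r` at once. Let `a` and `b` be `X^{2n}` and `X^{2n+1}` made
orthogonal to degree below `2n`; it suffices that the form does not vanish on the pair. If it did,
both would lie in the radical. A real zero `t` of their Wronskian would give a radical element `(X -
t)² s` with `s ≠ 0` of degree below `2n`, contradicting the induction hypothesis for `r (X - t)²`,
if `(X - t)` is used once per argument as below. So the Wronskian has a constant sign, and its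
integral against `r² e^{-2V}` cannot vanish. -/
theorem Admissible.nondegenerate (hV : Admissible V) (n : ℕ) :
    ∀ r : ℝ[X], r ≠ 0 → hV.Nondegenerate n r := by
  induction n with
  | zero =>
    intro r _ p hp _
    simpa [mem_degreeLT] using hp
  | succ n ih =>
    intro r hr
    obtain ⟨u, hu, hua⟩ := (ih r hr).exists_proj (X ^ (2 * n))
    obtain ⟨v, hv, hvb⟩ := (ih r hr).exists_proj (X ^ (2 * n + 1))
    obtain ⟨ham, had⟩ := monic_sub_of_mem le_rfl hu
    obtain ⟨hbm, hbd⟩ := monic_sub_of_mem (by omega : 2 * n ≤ 2 * n + 1) hv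
    set a := X ^ (2 * n) - u
    set b := X ^ (2 * n + 1) - v
    have hdec : ∀ p ∈ degreeLT ℝ (2 * (n + 1)), ∃ w ∈ degreeLT ℝ (2 * n), ∃ α β : ℝ,
        p = w + α • a + β • b := by
      intro p hp
      have h1 := sub_smul_mem_degreeLT hbm hbd (p := p) hp
      have h2 := sub_smul_mem_degreeLT ham had h1
      exact ⟨_, h2, _, _, by abel⟩
    have hS : ∀ (w : ℝ[X]) (α β : ℝ) (z : ℝ[X]), hV.skew (r * z) (r * (w + α • a + β • b)) =
        hV.skew (r * z) (r * w) + α * hV.skew (r * z) (r * a) + β * hV.skew (r * z) (r * b) := by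
      intro w α β z
      simp only [mul_add, mul_smul_comm, map_add, map_smul, smul_eq_mul]
    have hmain : hV.skew (r * a) (r * b) ≠ 0 := by
      intro h0
      have hrad : ∀ α β : ℝ, ∀ q ∈ degreeLT ℝ (2 * (n + 1)),
          hV.skew (r * (α • a + β • b)) (r * q) = 0 := by
        intro α β q hq
        obtain ⟨w, hw, α', β', rfl⟩ := hdec q hq
        rw [mul_add, map_add, LinearMap.add_apply, mul_smul_comm, mul_smul_comm, map_smul, map_smul,
          LinearMap.smul_apply, LinearMap.smul_apply, hS, hS, hua w hw, hvb w hw, hV.skew_self,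
          hV.skew_self, hV.skew_neg (r * b), h0]
        simp
      have hW : ∀ t, (wronskian a b).eval t ≠ 0 := by
        intro t ht
        obtain ⟨α, β, hne, s, hs⟩ := exists_sq_dvd ht
        have hXt : (X - C t : ℝ[X]) ≠ 0 := X_sub_C_ne_zero t
        have hdeg : ((X - C t) ^ 2 : ℝ[X]).natDegree = 2 := by simp
        have hmem : ∀ q : ℝ[X], (X - C t) ^ 2 * q ∈ degreeLT ℝ (2 * (n + 1)) ↔
            q ∈ degreeLT ℝ (2 * n) := by
          intro q
          rcases eq_or_ne q 0 with rfl | hq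
          · simp
          · rw [mem_degreeLT, mem_degreeLT, ← natDegree_lt_iff_degree_lt hq,
              ← natDegree_lt_iff_degree_lt (mul_ne_zero (pow_ne_zero 2 hXt) hq),
              natDegree_mul (pow_ne_zero 2 hXt) hq, hdeg]
            omega
        have hab : α • a + β • b ∈ degreeLT ℝ (2 * (n + 1)) := by
          refine add_mem (Submodule.smul_mem _ _ ?_) (Submodule.smul_mem _ _ ?_)
          · rw [mem_degreeLT, ← natDegree_lt_iff_degree_lt ham.ne_zero]; omega
          · rw [mem_degreeLT, ← natDegree_lt_iff_degree_lt hbm.ne_zero]; omega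
        -- Both arguments of the form carry the whole factor `(X - t)²`, so the hypothesis is used
        -- with `r` replaced by `r (X - t)²`, that is, with weight `r² (X - t)⁴ e^{-2V}`.
        have hs0 : s = 0 := by
          refine ih (r * (X - C t) ^ 2) (mul_ne_zero hr (pow_ne_zero 2 hXt)) s
            ((hmem s).1 (hs ▸ hab)) fun q hq => ?_
          rw [mul_assoc, mul_assoc, ← hs]
          exact hrad α β _ ((hmem q).2 hq)
        rw [hs0, mul_zero] at hs
        have hβ : β = 0 := by
          have := congrArg (fun p => p.coeff (2 * n + 1)) hs
          simp only [coeff_add, coeff_smul, smul_eq_mul, coeff_zero] at this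
          rw [coeff_eq_zero_of_natDegree_lt (by omega : a.natDegree < _), mul_zero, zero_add] at this
          have hb1 : b.coeff (2 * n + 1) = 1 := by rw [← hbd]; exact hbm.coeff_natDegree
          rwa [hb1, mul_one] at this
        rw [hβ, zero_smul, add_zero] at hs
        rcases hne with h | h
        · exact (smul_ne_zero h ham.ne_zero) hs
        · exact h hβ
      have hr2 : wronskian (r * a) (r * b) = r ^ 2 * wronskian a b := by
        simp only [wronskian, derivative_mul]; ring
      have hWne : wronskian a b ≠ 0 := fun h => hW 0 (by rw [h, eval_zero])
      rw [hV.skew_apply, skewProd_eq_wronskian, hr2] at h0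
      rcases eval_pos_or_neg hW with h | h
      · have := hV.weightInt_pos (p := r ^ 2 * wronskian a b) (fun x => by
          rw [eval_mul, eval_pow]; exact mul_nonneg (sq_nonneg _) (h x).le)
          (mul_ne_zero (pow_ne_zero 2 hr) hWne)
        linarith
      · have := hV.weightInt_pos (p := (-1 : ℝ) • (r ^ 2 * wronskian a b)) (fun x => by
          rw [eval_smul, eval_mul, eval_pow, smul_eq_mul]
          nlinarith [mul_nonneg (sq_nonneg (r.eval x)) (neg_nonneg.2 (h x).le)])
          (smul_ne_zero (by norm_num) (mul_ne_zero (pow_ne_zero 2 hr) hWne))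
        rw [weightInt_smul] at this
        linarith
    intro p hp hrad
    obtain ⟨w, hw, α, β, rfl⟩ := hdec p hp
    have hle : degreeLT ℝ (2 * n) ≤ degreeLT ℝ (2 * (n + 1)) := degreeLT_mono (by omega)
    have ha : a ∈ degreeLT ℝ (2 * (n + 1)) := by
      rw [mem_degreeLT, ← natDegree_lt_iff_degree_lt ham.ne_zero]; omega
    have hb : b ∈ degreeLT ℝ (2 * (n + 1)) := by
      rw [mem_degreeLT, ← natDegree_lt_iff_degree_lt hbm.ne_zero]; omega
    have hA := hrad a ha
    have hB := hrad b hb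
    rw [hV.skew_neg, hS, hV.skew_self, hua w hw, mul_zero, add_zero, zero_add, neg_eq_zero] at hA
    rw [hV.skew_neg, hS, hV.skew_self, hvb w hw, hV.skew_neg, mul_zero, add_zero, zero_add,
      mul_neg, neg_neg] at hB
    have hβ := (mul_eq_zero.1 hA).resolve_right hmain
    have hα := (mul_eq_zero.1 hB).resolve_right hmain
    rw [hα, hβ, zero_smul, zero_smul, add_zero, add_zero] at hrad ⊢
    exact ih r hr w hw fun q hq => hrad q (hle hq)

/-! ### Skew-orthogonal sequences -/

theorem Admissible.exists_isSkewOrthogonal (hV : Admissible V) :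
    ∃ P : ℕ → ℝ[X], IsSkewOrthogonal V P := by
  -- The quotient `m / 2` treats `2k` and `2k + 1` alike: both monomials are made orthogonal to
  -- degree below `2k`. No condition links the two members of a pair, and the diagonal products
  -- vanish by antisymmetry.
  have h := fun m : ℕ => (hV.nondegenerate (m / 2) 1 one_ne_zero).exists_proj (X ^ m)
  choose u hu horth using h
  simp only [one_mul] at horth
  have hmd := fun m => monic_sub_of_mem (Nat.mul_div_le m 2) (hu m)
  have key : ∀ m k : ℕ, k < 2 * (m / 2) → skewProd V (X ^ m - u m) (X ^ k - u k) = 0 := by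
    intro m k hk
    refine horth m _ ?_
    rw [mem_degreeLT, ← natDegree_lt_iff_degree_lt (hmd k).1.ne_zero, (hmd k).2]
    exact hk
  have key' : ∀ m k : ℕ, m < 2 * (k / 2) → skewProd V (X ^ m - u m) (X ^ k - u k) = 0 := by
    intro m k hk
    have := hV.skew_neg (X ^ m - u m) (X ^ k - u k)
    rw [hV.skew_apply, hV.skew_apply, key k m hk, neg_zero] at this
    exact this
  refine ⟨fun m => X ^ m - u m, fun m => (hmd m).1, fun m => (hmd m).2, fun n m => ?_,
    fun n m => ?_, fun n m hnm => ?_⟩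
  · rcases lt_trichotomy n m with h | rfl | h
    · exact key' _ _ (by omega)
    · exact hV.skew_self _
    · exact key _ _ (by omega)
  · rcases lt_trichotomy n m with h | rfl | h
    · exact key' _ _ (by omega)
    · exact hV.skew_self _
    · exact key _ _ (by omega)
  · rcases lt_or_gt_of_ne hnm with h | h
    · exact key' _ _ (by omega)
    · exact key _ _ (by omega)

variable {P : ℕ → ℝ[X]}

theorem IsSkewOrthogonal.linearMap_eq_zero (hP : IsSkewOrthogonal V P) (φ : ℝ[X] →ₗ[ℝ] ℝ) {m : ℕ}
    (h : ∀ k < m, φ (P k) = 0) : ∀ q ∈ degreeLT ℝ m, φ q = 0 := by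
  induction m with
  | zero =>
    intro q hq
    have : q = 0 := by simpa [mem_degreeLT] using hq
    rw [this, map_zero]
  | succ m ih =>
    intro q hq
    have h1 := ih (fun k hk => h k (by omega)) _
      (sub_smul_mem_degreeLT (hP.monic m) (hP.natDegree_eq m) hq)
    rwa [map_sub, map_smul, h m (by omega), smul_zero, sub_zero] at h1

theorem IsSkewOrthogonal.skew_even_eq_zero (hV : Admissible V) (hP : IsSkewOrthogonal V P) {n k : ℕ}
    (hk : k ≠ 2 * n + 1) : hV.skew (P (2 * n)) (P k) = 0 := by
  rcases Nat.even_or_odd' k with ⟨m, rfl | rfl⟩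
  · exact hP.even_even n m
  · exact hP.even_odd n m (by omega)

/-- Among all members of the sequence `P (2n)` pairs nontrivially only with `P (2n+1)`. Hence the
moments of its dual vanish up to order `2n`, and the first one that survives has order `2n + 1`. -/
theorem IsSkewOrthogonal.skew_mem_eq_zero (hV : Admissible V) (hP : IsSkewOrthogonal V P) (n : ℕ) :
    ∀ q ∈ degreeLT ℝ (2 * n + 1), hV.skew q (P (2 * n)) = 0 := by
  intro q hq
  rw [hV.skew_neg, neg_eq_zero]
  exact hP.linearMap_eq_zero (hV.skew (P (2 * n)))
    (fun k hk => hP.skew_even_eq_zero hV (by omega)) q hq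

/-- Otherwise `P (2n)` would be in the radical of the form on degree below `2n + 2`. -/
theorem IsSkewOrthogonal.skewNorm_ne_zero (hV : Admissible V) (hP : IsSkewOrthogonal V P) (n : ℕ) :
    skewNorm V P n ≠ 0 := by
  intro h
  refine (hP.monic (2 * n)).ne_zero (hV.nondegenerate (n + 1) 1 one_ne_zero _ ?_ ?_)
  · rw [mem_degreeLT, ← natDegree_lt_iff_degree_lt (hP.monic _).ne_zero, hP.natDegree_eq]; omega
  · simp only [one_mul]
    refine hP.linearMap_eq_zero (hV.skew (P (2 * n))) fun k hk => ?_
    by_cases hk' : k = 2 * n + 1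
    · rw [hk']; exact h
    · exact hP.skew_even_eq_zero hV hk'

theorem IsSkewOrthogonal.skew_pow (hV : Admissible V) (hP : IsSkewOrthogonal V P) (n : ℕ) :
    hV.skew (X ^ (2 * n + 1)) (P (2 * n)) = -skewNorm V P n := by
  have hX : (X ^ (2 * n + 1) : ℝ[X]) ∈ degreeLT ℝ (2 * n + 1 + 1) := by
    rw [mem_degreeLT, degree_X_pow]; exact_mod_cast Nat.lt_succ_self _
  have h := sub_smul_mem_degreeLT (hP.monic (2 * n + 1)) (hP.natDegree_eq _) hX
  rw [coeff_X_pow_self, one_smul] at h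
  have := hP.skew_mem_eq_zero hV n _ h
  rw [map_sub, LinearMap.sub_apply, sub_eq_zero] at this
  rw [this, hV.skew_neg]
  rfl

/-! ### Duals -/

theorem Admissible.const_ne_zero (hV : Admissible V) :
    V.leadingCoeff * (V.natDegree : ℝ) ≠ 0 := by
  have := hV.two_le
  have := hV.lead_pos
  positivity

theorem Admissible.contourIntegral_dual (hV : Admissible V) (l : ℕ) (p : ℝ[X]) :
    contourIntegral V.natDegree (V.natDegree / 2)
      (expPoly (cpot₂ V) (X ^ l * (dual V p).map (algebraMap ℝ ℂ))) =
      ((-(V.leadingCoeff * (V.natDegree : ℝ))⁻¹ * hV.skew (X ^ l) p : ℝ) : ℂ) := by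
  have e : X ^ l * (dual V p).map (algebraMap ℝ ℂ) =
      ((-(V.leadingCoeff * (V.natDegree : ℝ))⁻¹) • (X ^ l *
        (derivative p - derivative V * p))).map (algebraMap ℝ ℂ) := by
    rw [dual, smul_eq_C_mul]
    simp only [Polynomial.map_mul, Polynomial.map_pow, map_X]
    ring
  rw [e, hV.contourIntegral_map, weightInt_smul, hV.skew_apply, hV.skewProd_eq]

/-- Times `e^{-V}`, the dual is a constant multiple of the derivative of `e^{-V} p`. -/
theorem Admissible.contourIntegral_dual_eq_zero (hV : Admissible V) (k : ℕ) (p : ℝ[X]) :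
    contourIntegral V.natDegree k (expPoly (cpot V) ((dual V p).map (algebraMap ℝ ℂ))) = 0 := by
  have e : (dual V p).map (algebraMap ℝ ℂ) =
      ((-(V.leadingCoeff * (V.natDegree : ℝ))⁻¹ : ℝ) : ℂ) • (derivative (p.map (algebraMap ℝ ℂ)) -
        derivative (cpot V) * p.map (algebraMap ℝ ℂ)) := by
    rw [dual, smul_eq_C_mul, cpot, derivative_map, derivative_map]
    simp
  rw [e, contourIntegral_smul, hV.grows.contourIntegral_deriv, mul_zero]

theorem Admissible.natDegree_dual_and_monic (hV : Admissible V) {p : ℝ[X]} (hp : p.Monic) :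
    (dual V p).natDegree = p.natDegree + V.natDegree - 1 ∧ (dual V p).Monic := by
  have h2 := hV.two_le
  have hVd : (derivative V).natDegree = V.natDegree - 1 := natDegree_derivative V
  have hV0 : derivative V ≠ 0 := fun h => by rw [h, natDegree_zero] at hVd; omega
  have hVl : (derivative V).leadingCoeff = V.leadingCoeff * (V.natDegree : ℝ) := by
    rw [leadingCoeff, hVd, coeff_derivative, leadingCoeff, ← Nat.cast_succ,
      Nat.succ_eq_add_one, Nat.sub_add_cancel (by omega)]
  have hlt : (derivative p).degree < (derivative V * p).degree := by
    rw [degree_mul]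
    refine (degree_derivative_lt hp.ne_zero).trans_le ?_
    exact le_add_of_nonneg_left (zero_le_degree_iff.2 hV0)
  have hd : (derivative p - derivative V * p).natDegree = p.natDegree + V.natDegree - 1 := by
    rw [natDegree_eq_of_degree_eq (degree_sub_eq_right_of_degree_lt hlt),
      natDegree_mul hV0 hp.ne_zero, hVd]
    omega
  have hl : (derivative p - derivative V * p).leadingCoeff =
      -(V.leadingCoeff * (V.natDegree : ℝ)) := by
    rw [leadingCoeff_sub_of_degree_lt' hlt, leadingCoeff_mul, hp.leadingCoeff, hVl, mul_one]
  have hc := hV.const_ne_zero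
  refine ⟨?_, ?_⟩
  · rw [dual, natDegree_C_mul (neg_ne_zero.2 (inv_ne_zero hc)), hd]
  · rw [Monic, dual, leadingCoeff_mul, leadingCoeff_C, hl, neg_mul_neg, inv_mul_cancel₀ hc]

/-- The complex form of nondegeneracy. -/
theorem Admissible.eq_zero_of_orthogonal (hV : Admissible V) {n : ℕ} {Q : ℂ[X]}
    (hQ : Q ∈ degreeLT ℂ (2 * n))
    (h : ∀ l < 2 * n, contourIntegral V.natDegree (V.natDegree / 2) (expPoly (cpot₂ V)
      (X ^ l * (derivative Q - derivative (cpot V) * Q))) = 0) : Q = 0 := by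
  -- The conditions are real-linear with real data, so they hold separately for the real and the
  -- imaginary parts of the coefficients; `Re(-i z) = Im z`.
  set Q₁ := rePart Q
  set Q₂ := rePart (C (-Complex.I) * Q)
  have hc₁ : ∀ k, Q₁.coeff k = (Q.coeff k).re := coeff_rePart Q
  have hc₂ : ∀ k, Q₂.coeff k = (Q.coeff k).im := fun k => by
    rw [coeff_rePart, coeff_C_mul]; simp
  have hdecomp : Q = Q₁.map (algebraMap ℝ ℂ) + Complex.I • Q₂.map (algebraMap ℝ ℂ) := by
    ext k
    rw [coeff_add, coeff_smul, coeff_map, coeff_map, hc₁, hc₂, smul_eq_mul, mul_comm]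
    exact (Complex.re_add_im _).symm
  have hmem : Q₁ ∈ degreeLT ℝ (2 * n) ∧ Q₂ ∈ degreeLT ℝ (2 * n) := by
    rw [mem_degreeLT, degree_lt_iff_coeff_zero] at hQ
    constructor <;> rw [mem_degreeLT, degree_lt_iff_coeff_zero] <;> intro k hk
    · rw [hc₁, hQ k hk, Complex.zero_re]
    · rw [hc₂, hQ k hk, Complex.zero_im]
  have hval : ∀ l < 2 * n, hV.skew (X ^ l) Q₁ = 0 ∧ hV.skew (X ^ l) Q₂ = 0 := by
    intro l hl
    have e : X ^ l * (derivative Q - derivative (cpot V) * Q) =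
        (X ^ l * (derivative Q₁ - derivative V * Q₁)).map (algebraMap ℝ ℂ) +
        Complex.I • (X ^ l * (derivative Q₂ - derivative V * Q₂)).map (algebraMap ℝ ℂ) := by
      rw [hdecomp, cpot]
      simp only [derivative_add, derivative_C_mul, derivative_map, Polynomial.map_mul,
        Polynomial.map_sub, Polynomial.map_pow, map_X, smul_eq_C_mul]
      ring
    have := h l hl
    rw [e, hV.grows₂.contourIntegral_add, contourIntegral_smul, hV.contourIntegral_map,
      hV.contourIntegral_map, ← hV.skewProd_eq, ← hV.skewProd_eq] at this
    have hre := congrArg Complex.re this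
    have him := congrArg Complex.im this
    simp only [Complex.add_re, Complex.add_im, Complex.mul_re, Complex.mul_im, Complex.I_re,
      Complex.I_im, Complex.ofReal_re, Complex.ofReal_im, Complex.zero_re, Complex.zero_im] at hre him
    constructor
    · rw [hV.skew_apply]; linarith
    · rw [hV.skew_apply]; linarith
  have hkey : ∀ q ∈ degreeLT ℝ (2 * n), (∀ l < 2 * n, hV.skew (X ^ l) q = 0) → q = 0 := by
    intro q hq hl
    refine hV.nondegenerate n 1 one_ne_zero q hq fun p hp => ?_
    rw [one_mul, one_mul, p.as_sum_range_C_mul_X_pow, map_sum]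
    refine Finset.sum_eq_zero fun l hl' => ?_
    rw [← smul_eq_C_mul, map_smul, hV.skew_neg]
    rcases lt_or_ge l (2 * n) with h1 | h1
    · rw [hl l h1, neg_zero, smul_zero]
    · rw [mem_degreeLT, degree_lt_iff_coeff_zero] at hp
      rw [hp l h1, zero_smul]
  rw [hdecomp, hkey Q₁ hmem.1 fun l hl => (hval l hl).1, hkey Q₂ hmem.2 fun l hl => (hval l hl).2]
  simp

end

section

/-! ### Independence of the periods -/

/-- The degree of `S` is below that of `W'`. Consequently `|e^{-W} S|` is eventually at most the
derivative of `-e^{-Re W}`, which can be integrated. -/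
theorem eventually_norm_le_re_derivative {W S : ℂ[X]} (hW : 2 ≤ W.natDegree)
    (hl : 0 < W.leadingCoeff.re) (hS : S.natDegree + 2 ≤ W.natDegree) :
    ∀ᶠ t : ℝ in atTop, ‖S.eval (t : ℂ)‖ ≤ ((derivative W).eval (t : ℂ)).re := by
  have hd : (derivative W).natDegree = W.natDegree - 1 := natDegree_derivative W
  have hlc : (derivative W).leadingCoeff.re = W.leadingCoeff.re * W.natDegree := by
    rw [leadingCoeff, hd, coeff_derivative, leadingCoeff, ← Nat.cast_succ, Nat.succ_eq_add_one,
      Nat.sub_add_cancel (by omega)]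
    exact Complex.re_mul_ofReal _ _
  have key : ∀ c : ℂ, ∀ᶠ t : ℝ in atTop,
      (c * S.eval (t : ℂ)).re ≤ ((derivative W).eval (t : ℂ)).re := by
    intro c
    have hlt : (C c * S).natDegree < (derivative W).natDegree := by
      have := natDegree_C_mul_le c S
      omega
    have h := tendsto_re_eval_atTop (W := derivative W - C c * S)
      (by rw [natDegree_sub_eq_left_of_natDegree_lt hlt]; omega)
      (by
        rw [leadingCoeff_sub_of_degree_lt (degree_lt_degree hlt), hlc]
        have : (0 : ℝ) < W.natDegree := Nat.cast_pos.2 (by omega)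
        positivity)
    filter_upwards [h.eventually_ge_atTop 0] with t ht
    rw [eval_sub, eval_mul, eval_C, Complex.sub_re] at ht
    linarith
  -- The factors `±2` and `±2i` bound the real and imaginary parts of `S` by half of `Re W'` each.
  filter_upwards [key 2, key (-2), key (2 * Complex.I), key (-2 * Complex.I)] with t h1 h2 h3 h4
  simp [Complex.mul_re, Complex.mul_im] at h1 h2 h3 h4
  refine (Complex.norm_le_abs_re_add_abs_im _).trans ?_
  have ha : |(S.eval (t : ℂ)).re| ≤ ((derivative W).eval (t : ℂ)).re / 2 :=
    abs_le.2 ⟨by linarith, by linarith⟩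
  have hb : |(S.eval (t : ℂ)).im| ≤ ((derivative W).eval (t : ℂ)).re / 2 :=
    abs_le.2 ⟨by linarith, by linarith⟩
  linarith

theorem hasDerivAt_exp_neg_re (W : ℂ[X]) (t : ℝ) :
    HasDerivAt (fun t : ℝ => Real.exp (-(W.eval (t : ℂ)).re))
      (-((derivative W).eval (t : ℂ)).re * Real.exp (-(W.eval (t : ℂ)).re)) t := by
  have h := ((W.hasDerivAt (t : ℂ)).real_of_complex).neg.exp
  refine h.congr_deriv ?_
  simp only [Pi.neg_apply]
  ring

theorem norm_expPoly (W S : ℂ[X]) (z : ℂ) :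
    ‖expPoly W S z‖ = Real.exp (-(W.eval z).re) * ‖S.eval z‖ := by
  rw [expPoly, norm_mul, Complex.norm_exp, Complex.neg_re]

/-- If `G' = e^{-W} S` and `W` grows, then `e^W G` is bounded on the half-line provided that
`G → 0`. -/
theorem bounded_of_tendsto_zero {W S : ℂ[X]} (hW : 2 ≤ W.natDegree)
    (hl : 0 < W.leadingCoeff.re) (hS : S.natDegree + 2 ≤ W.natDegree) {G : ℝ → ℂ}
    (hG : ∀ t : ℝ, HasDerivAt G (expPoly W S t) t) (h0 : Tendsto G atTop (𝓝 0)) :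
    ∀ᶠ t : ℝ in atTop, ‖Complex.exp (W.eval (t : ℂ)) * G t‖ ≤ 1 := by
  obtain ⟨t₀, ht₀⟩ := eventually_atTop.1 (eventually_norm_le_re_derivative hW hl hS)
  filter_upwards [eventually_ge_atTop t₀] with t ht
  have hle : ∀ T, t ≤ T → ‖G T - G t‖ ≤ Real.exp (-(W.eval (t : ℂ)).re) := by
    intro T hT
    have := image_norm_le_of_norm_deriv_right_le_deriv_boundary (a := t) (b := T)
      (f := fun x => G x - G t) (f' := fun x => expPoly W S x)
      (fun x _ => ((hG x).sub_const _).continuousAt.continuousWithinAt)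
      (fun x _ => ((hG x).sub_const _).hasDerivWithinAt)
      (B := fun x => Real.exp (-(W.eval (t : ℂ)).re) - Real.exp (-(W.eval (x : ℂ)).re))
      (B' := fun x => ((derivative W).eval (x : ℂ)).re * Real.exp (-(W.eval (x : ℂ)).re))
      (by simp) (fun x => by
        have := (hasDerivAt_exp_neg_re W x).const_sub (Real.exp (-(W.eval (t : ℂ)).re))
        refine this.congr_deriv (by ring))
      (fun x hx => by
        rw [norm_expPoly, mul_comm]
        gcongr
        exact ht₀ x (ht.trans hx.1)) (x := T) ⟨hT, le_rfl⟩
    refine this.trans ?_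
    have := Real.exp_pos (-(W.eval (T : ℂ)).re)
    linarith
  have hlim : ‖0 - G t‖ ≤ Real.exp (-(W.eval (t : ℂ)).re) :=
    le_of_tendsto ((h0.sub_const (G t)).norm) ((eventually_ge_atTop t).mono hle)
  rw [zero_sub, norm_neg] at hlim
  rw [norm_mul, Complex.norm_exp]
  calc _ ≤ Real.exp (W.eval (t : ℂ)).re * Real.exp (-(W.eval (t : ℂ)).re) := by gcongr
    _ = 1 := by rw [← Real.exp_add, add_neg_cancel, Real.exp_zero]

/-- If `G' = e^{-W} S` and `-W` grows, then `e^W G` is bounded on the half-line. -/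
theorem exists_bound_of_neg {W S : ℂ[X]} (hW : 2 ≤ W.natDegree)
    (hl : W.leadingCoeff.re < 0) (hS : S.natDegree + 2 ≤ W.natDegree) {G : ℝ → ℂ}
    (hG : ∀ t : ℝ, HasDerivAt G (expPoly W S t) t) :
    ∃ M : ℝ, ∀ᶠ t : ℝ in atTop, ‖Complex.exp (W.eval (t : ℂ)) * G t‖ ≤ M := by
  have hl' : 0 < (-W).leadingCoeff.re := by
    rw [leadingCoeff_neg, Complex.neg_re]; linarith
  obtain ⟨t₀, ht₀⟩ := eventually_atTop.1 (eventually_norm_le_re_derivative (W := -W) (S := S)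
    (by rwa [natDegree_neg]) hl' (by rwa [natDegree_neg]))
  have hinf := tendsto_re_eval_atTop (W := -W) (by rw [natDegree_neg]; omega) hl'
  refine ⟨‖G t₀‖ + 1, ?_⟩
  filter_upwards [eventually_ge_atTop t₀, hinf.eventually_ge_atTop 0] with t ht hneg
  rw [eval_neg, Complex.neg_re] at hneg
  have hle : ‖G t - G t₀‖ ≤ Real.exp (-(W.eval (t : ℂ)).re) := by
    have := image_norm_le_of_norm_deriv_right_le_deriv_boundary (a := t₀) (b := t)
      (f := fun x => G x - G t₀) (f' := fun x => expPoly W S x)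
      (fun x _ => ((hG x).sub_const _).continuousAt.continuousWithinAt)
      (fun x _ => ((hG x).sub_const _).hasDerivWithinAt)
      (B := fun x => Real.exp (-(W.eval (x : ℂ)).re))
      (B' := fun x => -((derivative W).eval (x : ℂ)).re * Real.exp (-(W.eval (x : ℂ)).re))
      (by simp [(Real.exp_pos _).le]) (hasDerivAt_exp_neg_re W)
      (fun x hx => by
        rw [norm_expPoly, mul_comm]
        gcongr
        have := ht₀ x hx.1
        rwa [derivative_neg, eval_neg, Complex.neg_re] at this) (x := t) ⟨ht, le_rfl⟩
    exact this
  have hle' : ‖G t‖ ≤ ‖G t₀‖ + Real.exp (-(W.eval (t : ℂ)).re) := by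
    have := norm_add_le (G t - G t₀) (G t₀)
    rw [sub_add_cancel] at this
    linarith
  rw [norm_mul, Complex.norm_exp]
  have h1 : Real.exp (W.eval (t : ℂ)).re ≤ 1 := Real.exp_le_one_iff.2 (by linarith)
  calc Real.exp (W.eval (t : ℂ)).re * ‖G t‖
      ≤ Real.exp (W.eval (t : ℂ)).re * (‖G t₀‖ + Real.exp (-(W.eval (t : ℂ)).re)) := by gcongr
    _ = Real.exp (W.eval (t : ℂ)).re * ‖G t₀‖ + 1 := by
        rw [mul_add, ← Real.exp_add, add_neg_cancel, Real.exp_zero]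
    _ ≤ ‖G t₀‖ + 1 := by
        have := mul_le_of_le_one_left (norm_nonneg (G t₀)) h1
        linarith

theorem exists_bound_Ici {f : ℝ → ℂ} (hf : Continuous f) {M : ℝ}
    (hM : ∀ᶠ t in atTop, ‖f t‖ ≤ M) : ∃ N : ℝ, ∀ t, 0 ≤ t → ‖f t‖ ≤ N := by
  obtain ⟨T, hT⟩ := eventually_atTop.1 hM
  obtain ⟨N, hN⟩ := (isCompact_Icc (a := (0 : ℝ)) (b := T)).exists_bound_of_continuousOn
    hf.continuousOn
  refine ⟨max M N, fun t ht => ?_⟩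
  rcases le_total t T with h | h
  · exact (hN t ⟨ht, h⟩).trans (le_max_right _ _)
  · exact (hT t h).trans (le_max_left _ _)

theorem norm_eval_le (p : ℂ[X]) {N : ℕ} (hN : p.natDegree ≤ N) :
    ∃ B : ℝ, 0 ≤ B ∧ ∀ (z : ℂ) (m : ℝ), 1 ≤ m → ‖z‖ ≤ m → ‖p.eval z‖ ≤ B * m ^ N := by
  refine ⟨∑ i ∈ Finset.range (p.natDegree + 1), ‖p.coeff i‖, by positivity, fun z m hm hz => ?_⟩
  rw [eval_eq_sum_range, Finset.sum_mul]
  refine (norm_sum_le _ _).trans (Finset.sum_le_sum fun i hi => ?_)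
  rw [norm_mul, norm_pow]
  have hi' : i ≤ N := by have := Finset.mem_range.1 hi; omega
  gcongr
  calc ‖z‖ ^ i ≤ m ^ i := by gcongr
    _ ≤ m ^ N := pow_le_pow_right₀ hm hi'

/-- Growth of `e^W G`, where `G' = e^{-W} S`. -/
theorem exists_growth {W S : ℂ[X]} {N : ℕ} (hN : 1 ≤ N) (hW : W.natDegree ≤ N)
    (hS : S.natDegree ≤ N) {G : ℂ → ℂ} (hG : ∀ z, HasDerivAt G (expPoly W S z) z) :
    ∃ A B : ℝ, ∀ (z : ℂ) (m : ℝ), 1 ≤ m → ‖z‖ ≤ m →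
      ‖Complex.exp (W.eval z) * G z‖ ≤ A * Real.exp (B * m ^ N) := by
  obtain ⟨B, hB0, hB⟩ := norm_eval_le W hW
  obtain ⟨B', hB0', hB'⟩ := norm_eval_le S hS
  refine ⟨‖G 0‖ + B', 2 * B + 2, fun z m hm hz => ?_⟩
  have hmN : m ≤ m ^ N := le_self_pow₀ hm (by omega)
  have hmN' : m ^ N ≤ Real.exp (m ^ N) := by linarith [Real.add_one_le_exp (m ^ N)]
  have hm0 : 0 ≤ m ^ N := by positivity
  have hf : ∀ w : ℂ, ‖w‖ ≤ m → ‖expPoly W S w‖ ≤ B' * Real.exp ((B + 1) * m ^ N) := by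
    intro w hw
    rw [norm_expPoly]
    have h1 : -(W.eval w).re ≤ B * m ^ N :=
      ((neg_le_abs _).trans (Complex.abs_re_le_norm _)).trans (hB w m hm hw)
    calc Real.exp (-(W.eval w).re) * ‖S.eval w‖
        ≤ Real.exp (B * m ^ N) * (B' * Real.exp (m ^ N)) := by
          gcongr
          exact (hB' w m hm hw).trans (by gcongr)
      _ = B' * Real.exp ((B + 1) * m ^ N) := by
          rw [mul_left_comm, ← Real.exp_add]; ring_nf
  have hGz : ‖G z - G 0‖ ≤ B' * Real.exp ((B + 1) * m ^ N) * ‖z - 0‖ := by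
    refine (convex_closedBall (0 : ℂ) m).norm_image_sub_le_of_norm_hasDerivWithin_le
      (fun w _ => (hG w).hasDerivWithinAt) (fun w hw => hf w (by simpa using hw)) ?_ ?_
    · simpa using (zero_le_one.trans hm)
    · simpa using hz
  rw [sub_zero] at hGz
  have hexp1 : 1 ≤ Real.exp ((B + 2) * m ^ N) := Real.one_le_exp (by positivity)
  have h2 : ‖G z‖ ≤ (‖G 0‖ + B') * Real.exp ((B + 2) * m ^ N) := by
    have h3 : ‖G z‖ ≤ ‖G z - G 0‖ + ‖G 0‖ := by
      have := norm_add_le (G z - G 0) (G 0)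
      rwa [sub_add_cancel] at this
    have h4 : B' * Real.exp ((B + 1) * m ^ N) * ‖z‖ ≤ B' * Real.exp ((B + 2) * m ^ N) := by
      calc B' * Real.exp ((B + 1) * m ^ N) * ‖z‖
          ≤ B' * Real.exp ((B + 1) * m ^ N) * Real.exp (m ^ N) := by
            gcongr
            exact hz.trans (hmN.trans hmN')
        _ = B' * Real.exp ((B + 2) * m ^ N) := by
            rw [mul_assoc, ← Real.exp_add]; ring_nf
    nlinarith [norm_nonneg (G 0)]
  rw [norm_mul, Complex.norm_exp]
  have h5 : (W.eval z).re ≤ B * m ^ N := (Complex.re_le_norm _).trans (hB z m hm hz)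
  calc Real.exp (W.eval z).re * ‖G z‖
      ≤ Real.exp (B * m ^ N) * ((‖G 0‖ + B') * Real.exp ((B + 2) * m ^ N)) := by gcongr
    _ = (‖G 0‖ + B') * Real.exp ((2 * B + 2) * m ^ N) := by
        rw [mul_left_comm, ← Real.exp_add]; ring_nf

/-- Phragmén–Lindelöf in the sectors between the rays `e^{2πik/(3D)} [0, ∞)`. -/
theorem exists_bound_of_rays {D : ℕ} (hD : 0 < D) {H : ℂ → ℂ} (hH : Differentiable ℂ H) {A B : ℝ}
    (hgrowth : ∀ (z : ℂ) (m : ℝ), 1 ≤ m → ‖z‖ ≤ m → ‖H z‖ ≤ A * Real.exp (B * m ^ D))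
    (hray : ∀ k : ℕ, ∃ M : ℝ, ∀ t : ℝ, 0 ≤ t → ‖H (t * dir (3 * D) k)‖ ≤ M) :
    ∃ M : ℝ, ∀ z, ‖H z‖ ≤ M := by
  choose M hM using hray
  have hD' : (0 : ℝ) < D := Nat.cast_pos.2 hD
  have hpi := Real.pi_pos
  set θ : ℕ → ℝ := fun k => 2 * Real.pi * k / (3 * D : ℕ) with hθ
  have hline : ∀ (k : ℕ) (s : ℂ), s.im = θ k → ‖H (Complex.exp s)‖ ≤ M k := by
    intro k s hs
    have : Complex.exp s = (Real.exp s.re : ℝ) * dir (3 * D) k := by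
      rw [dir_eq, Complex.ofReal_exp, ← Complex.exp_add]
      congr 1
      conv_lhs => rw [← Complex.re_add_im s, hs]
    rw [this]
    exact hM k _ (Real.exp_pos _).le
  have hstrip : ∀ (k : ℕ) (s : ℂ), θ k ≤ s.im → s.im ≤ θ (k + 1) →
      ‖H (Complex.exp s)‖ ≤ max (M k) (M (k + 1)) := by
    intro k s h1 h2
    have hdiff : Differentiable ℂ fun s => H (Complex.exp s) := by fun_prop
    refine PhragmenLindelof.horizontal_strip (a := θ k) (b := θ (k + 1))
      (f := fun s => H (Complex.exp s)) hdiff.diffContOnCl ⟨D, ?_, B, ?_⟩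
      (fun s hs => (hline k s hs).trans (le_max_left _ _))
      (fun s hs => (hline (k + 1) s hs).trans (le_max_right _ _)) h1 h2
    -- The opening `2π/(3D)` is less than `π/D`, so growth of order `D` is admissible for
    -- Phragmén–Lindelöf.
    · have : θ (k + 1) - θ k = 2 * Real.pi / (3 * D) := by
        simp only [hθ]; push_cast; field_simp; ring
      rw [this, lt_div_iff₀ (by positivity)]
      field_simp
      linarith
    · refine Asymptotics.IsBigO.of_bound A (Eventually.of_forall fun s => ?_)
      rw [Real.norm_of_nonneg (Real.exp_pos _).le]
      have := hgrowth (Complex.exp s) (Real.exp |s.re|) (Real.one_le_exp (abs_nonneg _)) (by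
        rw [Complex.norm_exp]; exact Real.exp_le_exp.2 (le_abs_self _))
      rwa [← Real.exp_nat_mul] at this
  have hfin : ∀ k ∈ Finset.range (3 * D + 1),
      M k ≤ ∑ k ∈ Finset.range (3 * D + 1), |M k| := fun k hk =>
    (le_abs_self _).trans
      (Finset.single_le_sum (f := fun k => |M k|) (fun i _ => abs_nonneg (M i)) hk)
  refine ⟨max ‖H 0‖ (∑ k ∈ Finset.range (3 * D + 1), |M k|), fun z => ?_⟩
  rcases eq_or_ne z 0 with rfl | hz
  · exact le_max_left _ _
  refine le_trans ?_ (le_max_right _ _)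
  -- With the imaginary part of the logarithm in `[0, 2π)`, the point lies in one of finitely many
  -- strips.
  obtain ⟨s, hs, hs0, hs1⟩ : ∃ s, Complex.exp s = z ∧ 0 ≤ s.im ∧ s.im < 2 * Real.pi := by
    have harg := Complex.arg_le_pi z
    have harg' := Complex.neg_pi_lt_arg z
    rcases le_or_gt 0 (Complex.arg z) with h | h
    · exact ⟨Complex.log z, Complex.exp_log hz, by rwa [Complex.log_im], by
        rw [Complex.log_im]; linarith⟩
    · have him : (Complex.log z + 2 * Real.pi * Complex.I).im = Complex.arg z + 2 * Real.pi := by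
        simp [Complex.log_im]
      refine ⟨Complex.log z + 2 * Real.pi * Complex.I, ?_, ?_, ?_⟩
      · rw [Complex.exp_periodic, Complex.exp_log hz]
      · rw [him]; linarith
      · rw [him]; linarith
  set x := s.im * (3 * D : ℕ) / (2 * Real.pi) with hx
  have hx0 : 0 ≤ x := by positivity
  have hsx : s.im = 2 * Real.pi * x / (3 * D : ℕ) := by
    rw [hx]; push_cast; field_simp
  have hxlt : x < (3 * D : ℕ) := by
    rw [hx, div_lt_iff₀ (by positivity), mul_comm]
    have : (0 : ℝ) < (3 * D : ℕ) := Nat.cast_pos.2 (by omega)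
    gcongr
  have hk : ⌊x⌋₊ < 3 * D := (Nat.floor_lt hx0).2 hxlt
  rw [← hs]
  refine (hstrip ⌊x⌋₊ s ?_ ?_).trans (max_le (hfin _ ?_) (hfin _ ?_))
  · rw [hsx, hθ]; simp only []
    gcongr
    exact Nat.floor_le hx0
  · rw [hsx, hθ]; simp only []
    gcongr
    push_cast
    exact (Nat.lt_floor_add_one x).le
  · exact Finset.mem_range.2 (by omega)
  · exact Finset.mem_range.2 (by omega)

theorem dir_three_mul {D : ℕ} (hD : D ≠ 0) (m : ℕ) : dir (3 * D) (3 * m) = dir D m := by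
  have : (D : ℂ) ≠ 0 := Nat.cast_ne_zero.2 hD
  rw [dir, dir]
  congr 1
  push_cast
  field_simp

/-- Between two neighbouring rays `C_m` there are two more of the `3D` rays. On them the leading
term of `V` has negative real part, since `cos(±2π/3) = -1/2`. -/
theorem re_dir_three_mul_pow {D : ℕ} (hD : D ≠ 0) {k : ℕ} (hk : k % 3 ≠ 0) :
    (dir (3 * D) k ^ D).re = -(1 / 2) := by
  have hD' : (D : ℂ) ≠ 0 := Nat.cast_ne_zero.2 hD
  have e : dir (3 * D) k ^ D = Complex.exp ((2 * Real.pi * k / 3 : ℝ) * Complex.I) := by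
    rw [dir, ← Complex.exp_nat_mul]
    congr 1
    push_cast
    field_simp
  rw [e, Complex.exp_ofReal_mul_I_re]
  have hc : Real.cos (2 * Real.pi / 3) = -(1 / 2) := by
    rw [show 2 * Real.pi / 3 = Real.pi - Real.pi / 3 by ring, Real.cos_pi_sub, Real.cos_pi_div_three]
  have hm := Nat.div_add_mod k 3
  have hlt := Nat.mod_lt k (show 0 < 3 by norm_num)
  set m := k / 3
  have hcases : k = 3 * m + 1 ∨ k = 3 * m + 2 := by omega
  rcases hcases with h | h
  · rw [h, ← hc, ← Real.cos_add_nat_mul_two_pi (2 * Real.pi / 3) m]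
    congr 1; push_cast; ring
  · rw [h, ← hc, ← Real.cos_neg (2 * Real.pi / 3),
      ← Real.cos_add_nat_mul_two_pi (-(2 * Real.pi / 3)) (m + 1)]
    congr 1; push_cast; ring

theorem dir_mod {D : ℕ} (hD : D ≠ 0) (m : ℕ) : dir D (m % D) = dir D m := by
  have hD' : (D : ℂ) ≠ 0 := Nat.cast_ne_zero.2 hD
  have hm := Nat.div_add_mod m D
  generalize m / D = a at hm
  generalize m % D = b at hm ⊢
  subst hm
  rw [dir, dir, Complex.exp_eq_exp_iff_exists_int]
  refine ⟨-(a : ℤ), ?_⟩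
  push_cast
  field_simp
  ring

/-- Equal integrals over all rays allow a primitive `G` of `e^{-V} S` that tends to `0` along every
`C_k`. Then `H = e^V G` is bounded on these rays, and also on the intermediate ones where `e^V`
decays. By Phragmén–Lindelöf and Liouville `H` is a constant `b`. The equation `H' = V' H + S`
becomes `b V' + S = 0`, and comparing degrees gives `b = 0` and `S = 0`. -/
theorem Admissible.eq_zero_of_periods {V : ℝ[X]} (hV : Admissible V) {S : ℂ[X]}
    (hS : S.natDegree + 2 ≤ V.natDegree) (h : ∀ k ∈ Set.Icc 1 (V.natDegree - 1),
      contourIntegral V.natDegree k (expPoly (cpot V) S) = 0) : S = 0 := by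
  have h2 := hV.two_le
  have hWd : (cpot V).natDegree = V.natDegree := natDegree_map _
  have hWl : (cpot V).leadingCoeff = (V.leadingCoeff : ℂ) := leadingCoeff_map _
  set W := cpot V with hW
  set D := V.natDegree with hDdef
  obtain ⟨F, hF⟩ := (differentiable_expPoly W S).isExactOn_univ
  replace hF : ∀ z, HasDerivAt F (expPoly W S z) z := fun z => hF z trivial
  -- This is the limit of `F` along `C_0`, and by the vanishing periods along every other `C_k`.
  set c := F 0 + rayIntegral D 0 (expPoly W S) with hc
  set G : ℂ → ℂ := fun z => F z - c with hGdef
  have hG : ∀ z, HasDerivAt G (expPoly W S z) z := fun z => (hF z).sub_const c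
  have hGray : ∀ (u : ℂ) (t : ℝ), HasDerivAt (fun t : ℝ => G (t * u))
      (expPoly W S (t * u) * u) t := fun u t => by
    have h1 : HasDerivAt (fun w : ℂ => w * u) u (t : ℂ) := by
      simpa using (hasDerivAt_id (t : ℂ)).mul_const u
    exact ((hG (t * u)).comp (t : ℂ) h1).comp_ofReal
  have hlim : ∀ k < D, Tendsto (fun t : ℝ => G (t * dir D k)) atTop (𝓝 0) := by
    intro k hk
    have hint := (hV.grows.rayIntegrable k S).mul_const (dir D k)
    have h1 := intervalIntegral_tendsto_integral_Ioi 0 hint tendsto_id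
    have hck : rayIntegral D k (expPoly W S) = rayIntegral D 0 (expPoly W S) := by
      rcases Nat.eq_zero_or_pos k with rfl | h0
      · rfl
      · have := h k ⟨h0, by omega⟩
        rw [contourIntegral, sub_eq_zero] at this
        exact this.symm
    have h3 := h1.add_const (G 0)
    have hval : (∫ t in Set.Ioi (0 : ℝ), expPoly (cpot V) S (t * dir D k) * dir D k) + G 0 = 0 := by
      have : (∫ t in Set.Ioi (0 : ℝ), expPoly (cpot V) S (t * dir D k) * dir D k) =
          rayIntegral D 0 (expPoly W S) := hck
      rw [this, hGdef, hc]; ring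
    rw [hval] at h3
    refine h3.congr fun T => ?_
    have := intervalIntegral.integral_eq_sub_of_hasDerivAt (a := 0) (b := T)
      (fun t _ => hGray (dir D k) t) (Continuous.intervalIntegrable (by
        have := continuous_expPoly W S
        fun_prop) _ _)
    rw [id, this]
    simp
  set H : ℂ → ℂ := fun z => Complex.exp (W.eval z) * G z with hH
  have hHd : ∀ z, HasDerivAt H ((derivative W).eval z * H z + S.eval z) z := fun z => by
    have := ((W.hasDerivAt z).cexp).mul (hG z)
    refine this.congr_deriv ?_
    have e : Complex.exp (W.eval z) * Complex.exp (-W.eval z) = 1 := by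
      rw [← Complex.exp_add, add_neg_cancel, Complex.exp_zero]
    simp only [hH, expPoly]
    linear_combination S.eval z * e
  have hHdiff : Differentiable ℂ H := fun z => (hHd z).differentiableAt
  obtain ⟨A, B, hgr⟩ := exists_growth (N := D) (by omega) hWd.le (by omega) hG
  obtain ⟨M, hM⟩ := exists_bound_of_rays (by omega : 0 < D) hHdiff hgr fun k => by
    set u := dir (3 * D) k with hu
    have hu0 : u ≠ 0 := dir_ne_zero _ _
    have hd1 : (C u * X : ℂ[X]).natDegree = 1 := natDegree_C_mul_X _ hu0
    set W' := W.comp (C u * X)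
    set S' := C u * S.comp (C u * X)
    have hWd' : W'.natDegree = D := by rw [natDegree_comp, hd1, hWd, mul_one]
    have hSd' : S'.natDegree + 2 ≤ W'.natDegree := by
      rw [hWd', natDegree_C_mul hu0, natDegree_comp, hd1, mul_one]; exact hS
    have hWl' : W'.leadingCoeff.re = V.leadingCoeff * (u ^ D).re := by
      rw [leadingCoeff_comp (by rw [hd1]; exact one_ne_zero), leadingCoeff_mul, leadingCoeff_C,
        leadingCoeff_X, mul_one, hWd, hWl, Complex.re_ofReal_mul]
    have hG' : ∀ t : ℝ, HasDerivAt (fun t : ℝ => G (t * u)) (expPoly W' S' t) t := fun t => by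
      refine (hGray u t).congr_deriv ?_
      rw [← expPoly_comp]
      simp only [expPoly, S', eval_mul, eval_C]
      ring
    have hHW : ∀ t : ℝ, Complex.exp (W'.eval (t : ℂ)) * G (t * u) = H (t * u) := fun t => by
      simp only [hH, W', eval_comp, eval_mul, eval_C, eval_X, mul_comm u]
    have hcont : Continuous fun t : ℝ => H (t * u) := by
      have := hHdiff.continuous
      fun_prop
    have hex : ∃ M : ℝ, ∀ᶠ t : ℝ in atTop, ‖Complex.exp (W'.eval (t : ℂ)) * G (t * u)‖ ≤ M := by
      -- Multiples of `3` are the rays `C_m`, where `G → 0` is needed; on the others the decay of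
      -- `e^V` suffices.
      by_cases hk : k % 3 = 0
      · obtain ⟨m, rfl⟩ := Nat.dvd_of_mod_eq_zero hk
        have hum : u = dir D (m % D) := by
          rw [dir_mod (by omega), hu, dir_three_mul (by omega)]
        refine ⟨1, bounded_of_tendsto_zero (by omega) ?_ hSd' hG' ?_⟩
        · rw [hWl', hum, dir_pow (by omega)]
          simpa using hV.lead_pos
        · rw [hum]; exact hlim _ (Nat.mod_lt _ (by omega))
      · refine exists_bound_of_neg (by omega) ?_ hSd' hG'
        rw [hWl', hu, re_dir_three_mul_pow (by omega) hk]
        linarith [hV.lead_pos]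
    obtain ⟨M, hM⟩ := hex
    simp only [hHW] at hM
    exact exists_bound_Ici hcont hM
  obtain ⟨b, hb⟩ := hHdiff.exists_const_forall_eq_of_bounded
    (isBounded_iff_forall_norm_le.2 ⟨M, by rintro _ ⟨z, rfl⟩; exact hM z⟩)
  have hpoly : C b * derivative W + S = 0 := by
    refine Polynomial.funext fun z => ?_
    have h3 : HasDerivAt H 0 z := by
      have : H = fun _ => b := funext hb
      rw [this]; exact hasDerivAt_const z b
    have := (hHd z).unique h3
    rw [hb] at this
    rw [eval_add, eval_mul, eval_C, eval_zero, mul_comm, this]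
  have hb0 : b = 0 := by
    by_contra hb0
    have hdd : (C b * derivative W).natDegree = D - 1 := by
      rw [natDegree_C_mul hb0, natDegree_derivative W, hWd]
    have : C b * derivative W = -S := eq_neg_of_add_eq_zero_left hpoly
    rw [this, natDegree_neg] at hdd
    omega
  rw [hb0, C_0, zero_mul, zero_add] at hpoly
  exact hpoly

end

section

variable {V : ℝ[X]}

/-! ### The auxiliary polynomials -/

theorem weight_one_mul (q : ℂ[X]) :
    (fun x => weight V 1 x * q.eval x) = expPoly (cpot₂ V) q := by
  ext x
  simp only [weight, if_true, expPoly, cpot₂, eval_mul, eval_C, eval_map_algebraMap, neg_mul]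

theorem exp_neg_aeval_mul (q : ℂ[X]) :
    (fun x => Complex.exp (-aeval x V) * q.eval x) = expPoly (cpot V) q := by
  ext x
  simp only [expPoly, cpot, eval_map_algebraMap]

theorem weight_mul {j : ℕ} (hj : j ≠ 1) (q : ℂ[X]) :
    (fun x => weight V j x * q.eval x) = expPoly (cpot V) q := by
  rw [← exp_neg_aeval_mul]
  simp only [weight, if_neg hj]

theorem Admissible.isAuxiliary_iff (hV : Admissible V) {n j : ℕ} {S : ℂ[X]} :
    IsAuxiliary V n j S ↔ S ∈ degreeLT ℂ (2 * n + V.natDegree - 1) ∧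
      (∀ l < 2 * n, contourIntegral V.natDegree (V.natDegree / 2)
        (expPoly (cpot₂ V) (X ^ l * S)) = 0) ∧
      ∀ k ∈ Set.Icc 1 (V.natDegree - 1), contourIntegral V.natDegree k (expPoly (cpot V) S) =
        if k = j then -(2 * Real.pi * Complex.I) else 0 := by
  have h2 := hV.two_le
  have hdeg : S.natDegree ≤ 2 * n + V.natDegree - 2 ↔
      S ∈ degreeLT ℂ (2 * n + V.natDegree - 1) := by
    rcases eq_or_ne S 0 with rfl | hS
    · simp
    · rw [mem_degreeLT, ← natDegree_lt_iff_degree_lt hS]; omega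
  have hint : ∀ l : ℕ, ∫ x : ℝ, Complex.exp (-2 * aeval (x : ℂ) V) * (x : ℂ) ^ l * S.eval (x : ℂ) =
      contourIntegral V.natDegree (V.natDegree / 2) (expPoly (cpot₂ V) (X ^ l * S)) := by
    intro l
    rw [← hV.grows₂.integral_real hV.even, ← weight_one_mul]
    simp only [weight, if_true, eval_mul, eval_pow, eval_X, mul_assoc]
  have hnorm : ∀ k : ℕ, -(2 * Real.pi * Complex.I)⁻¹ *
      contourIntegral V.natDegree k (fun x => Complex.exp (-aeval x V) * S.eval x) =
        (if k = j then 1 else 0) ↔ contourIntegral V.natDegree k (expPoly (cpot V) S) =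
        if k = j then -(2 * Real.pi * Complex.I) else 0 := by
    intro k
    have hpi := Complex.two_pi_I_ne_zero
    rw [exp_neg_aeval_mul, neg_inv, inv_mul_eq_iff_eq_mul₀ (neg_ne_zero.2 hpi)]
    split_ifs <;> simp
  constructor
  · rintro ⟨h1, h2, h3⟩
    exact ⟨hdeg.1 h1, fun l hl => by rw [← hint]; exact h2 l hl, fun k hk => (hnorm k).1 (h3 k hk)⟩
  · rintro ⟨h1, h2, h3⟩
    exact ⟨hdeg.2 h1, fun l hl => by rw [hint]; exact h2 l hl, fun k hk => (hnorm k).2 (h3 k hk)⟩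

/-- Division with remainder: `Q' - V'Q` raises degrees by exactly `D - 1`, so leading terms can be
removed down to degree below `D - 1`. Duals of monomials serve as monic representatives. -/
theorem Admissible.exists_sub_mem (hV : Admissible V) (m : ℕ) :
    ∀ S ∈ degreeLT ℂ (m + (V.natDegree - 1)), ∃ Q ∈ degreeLT ℂ m,
      S - (derivative Q - derivative (cpot V) * Q) ∈ degreeLT ℂ (V.natDegree - 1) := by
  have h2 := hV.two_le
  induction m with
  | zero =>
    intro S hS
    exact ⟨0, zero_mem _, by simpa using hS⟩
  | succ m ih =>
    intro S hS
    obtain ⟨hd, hm⟩ := hV.natDegree_dual_and_monic (monic_X_pow (R := ℝ) m)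
    rw [natDegree_X_pow] at hd
    set T := (dual V (X ^ m)).map (algebraMap ℝ ℂ) with hT
    have hTm : T.Monic := hm.map _
    have hTd : T.natDegree = m + (V.natDegree - 1) := by
      rw [hT, hm.natDegree_map, hd]; omega
    have h1 := sub_smul_mem_degreeLT hTm hTd (p := S) (by
      rwa [show m + (V.natDegree - 1) + 1 = m + 1 + (V.natDegree - 1) by omega])
    set c := S.coeff (m + (V.natDegree - 1))
    set κ : ℂ := ((-(V.leadingCoeff * (V.natDegree : ℝ))⁻¹ : ℝ) : ℂ)
    have hTe : T = C κ * (derivative (X ^ m) - derivative (cpot V) * X ^ m) := by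
      rw [hT, dual, cpot, derivative_map]
      simp only [Polynomial.map_mul, Polynomial.map_sub, map_C, Polynomial.map_pow, map_X,
        ← derivative_map]
      rfl
    obtain ⟨Q, hQ, h⟩ := ih _ h1
    refine ⟨Q + C (c * κ) * X ^ m, add_mem ?_ ?_, ?_⟩
    · exact degreeLT_mono (Nat.le_succ m) hQ
    · rw [← smul_eq_C_mul]
      refine Submodule.smul_mem _ _ ?_
      rw [mem_degreeLT, degree_X_pow]
      exact_mod_cast Nat.lt_succ_self m
    · convert h using 1
      rw [hTe, smul_eq_C_mul, derivative_add, derivative_C_mul, C_mul]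
      ring

/-- Split `S` into `T = Q' - V'Q` and a remainder of degree at most `D - 2`. The part `T` has no
periods, so the remainder has none and vanishes; then the moments of `S = T` are skew products with
`Q`, which forces `Q = 0`. -/
theorem Admissible.eq_zero_of_conditions (hV : Admissible V) {n : ℕ} {S : ℂ[X]}
    (hS : S ∈ degreeLT ℂ (2 * n + V.natDegree - 1))
    (h1 : ∀ l < 2 * n, contourIntegral V.natDegree (V.natDegree / 2)
      (expPoly (cpot₂ V) (X ^ l * S)) = 0)
    (h2 : ∀ k ∈ Set.Icc 1 (V.natDegree - 1),
      contourIntegral V.natDegree k (expPoly (cpot V) S) = 0) : S = 0 := by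
  have hD := hV.two_le
  obtain ⟨Q, hQ, h⟩ := hV.exists_sub_mem (2 * n) S (by
    rwa [show 2 * n + (V.natDegree - 1) = 2 * n + V.natDegree - 1 by omega])
  set T := derivative Q - derivative (cpot V) * Q with hT
  have h0 : S - T = 0 := by
    refine hV.eq_zero_of_periods ?_ fun k hk => ?_
    · rcases eq_or_ne (S - T) 0 with h0 | h0
      · rw [h0, natDegree_zero]; omega
      · rw [mem_degreeLT, ← natDegree_lt_iff_degree_lt h0] at h
        omega
    · have e : S - T = S + (-1 : ℂ) • T := by rw [neg_one_smul, sub_eq_add_neg]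
      rw [e, hV.grows.contourIntegral_add, contourIntegral_smul, h2 k hk,
        hV.grows.contourIntegral_deriv]
      simp
  have hST : S = T := sub_eq_zero.1 h0
  have hQ0 : Q = 0 := hV.eq_zero_of_orthogonal hQ fun l hl => by rw [← hT, ← hST]; exact h1 l hl
  rw [hST, hT, hQ0]
  simp

/-- The linear conditions that define the auxiliary polynomials. -/
def Admissible.conditions (hV : Admissible V) (n : ℕ) :
    ℂ[X] →ₗ[ℂ] (Fin (2 * n) → ℂ) × (Fin (V.natDegree - 1) → ℂ) where
  toFun S := (fun l => contourIntegral V.natDegree (V.natDegree / 2)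
      (expPoly (cpot₂ V) (X ^ (l : ℕ) * S)),
    fun k => contourIntegral V.natDegree (k + 1) (expPoly (cpot V) S))
  map_add' p q := by
    ext <;> simp only [mul_add, hV.grows.contourIntegral_add, hV.grows₂.contourIntegral_add,
      Prod.fst_add, Prod.snd_add, Pi.add_apply]
  map_smul' c p := by
    ext <;> simp only [mul_smul_comm, contourIntegral_smul, Prod.smul_fst, Prod.smul_snd,
      Pi.smul_apply, smul_eq_mul, RingHom.id_apply]

/-- There are `2n` moments and `D - 1` periods, as many conditions as the dimension `2n + D - 1`, so
injectivity gives bijectivity. -/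
theorem Admissible.existsUnique_isAuxiliary (hV : Admissible V) (n j : ℕ) :
    ∃! S : ℂ[X], IsAuxiliary V n j S := by
  have h2 := hV.two_le
  set N := 2 * n + V.natDegree - 1 with hN
  have hfd : FiniteDimensional ℂ (degreeLT ℂ N) := Module.Finite.equiv (degreeLTEquiv ℂ N).symm
  set L := (hV.conditions n).comp (degreeLT ℂ N).subtype with hL
  have hinj : Function.Injective L := by
    rw [← LinearMap.ker_eq_bot, LinearMap.ker_eq_bot']
    intro S hS
    refine Subtype.ext (hV.eq_zero_of_conditions S.2 (fun l hl => ?_) fun k hk => ?_)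
    · exact congrFun (congrArg Prod.fst hS) ⟨l, hl⟩
    · have := congrFun (congrArg Prod.snd hS) ⟨k - 1, by have := hk.1; have := hk.2; omega⟩
      have hk' : k - 1 + 1 = k := Nat.sub_add_cancel hk.1
      simpa only [hL, LinearMap.comp_apply, Submodule.subtype_apply, Admissible.conditions,
        LinearMap.coe_mk, AddHom.coe_mk, hk', Prod.snd_zero, Pi.zero_apply] using this
  have hrank : Module.finrank ℂ (degreeLT ℂ N) =
      Module.finrank ℂ ((Fin (2 * n) → ℂ) × (Fin (V.natDegree - 1) → ℂ)) := by
    rw [(degreeLTEquiv ℂ N).finrank_eq, Module.finrank_prod, Module.finrank_fin_fun,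
      Module.finrank_fin_fun, Module.finrank_fin_fun]
    omega
  have hsurj := (LinearMap.injective_iff_surjective_of_finrank_eq_finrank hrank).1 hinj
  obtain ⟨S, hS⟩ := hsurj (0, fun k => if (k : ℕ) + 1 = j then -(2 * Real.pi * Complex.I) else 0)
  refine ⟨S, hV.isAuxiliary_iff.2 ⟨S.2, fun l hl => ?_, fun k hk => ?_⟩, fun T hT => ?_⟩
  · exact congrFun (congrArg Prod.fst hS) ⟨l, hl⟩
  · have := congrFun (congrArg Prod.snd hS) ⟨k - 1, by have := hk.1; have := hk.2; omega⟩
    have hk' : k - 1 + 1 = k := Nat.sub_add_cancel hk.1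
    simpa only [hL, LinearMap.comp_apply, Submodule.subtype_apply, Admissible.conditions,
      LinearMap.coe_mk, AddHom.coe_mk, hk'] using this
  · obtain ⟨hT1, hT2, hT3⟩ := hV.isAuxiliary_iff.1 hT
    refine congrArg Subtype.val (hinj (a₁ := ⟨T, hT1⟩) (a₂ := S) ?_)
    rw [hS]
    ext l
    · exact hT2 l l.2
    · exact hT3 (l + 1) ⟨by omega, by have := l.2; omega⟩

end

section

/-! ### Boundary values of the logarithms -/

/-- The logarithm with cut along `C_k`. -/
def lg (D k : ℕ) (z : ℂ) : ℂ := Complex.log (-(z / dir D k))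

open Classical in
/-- The boundary value of `lg D k` from the left (`s = 1`) or from the right (`s = -1`). -/
def lgBdry (D k : ℕ) (s : ℝ) (z : ℂ) : ℂ :=
  if z ∈ ray D k then Real.log ‖z‖ - (s * orient k : ℝ) * Real.pi * Complex.I else lg D k z

theorem lgBdry_of_mem {D k : ℕ} {z : ℂ} (hz : z ∈ ray D k) (s : ℝ) :
    lgBdry D k s z = Real.log ‖z‖ - (s * orient k : ℝ) * Real.pi * Complex.I := if_pos hz

theorem lgBdry_of_notMem {D k : ℕ} {z : ℂ} (hz : z ∉ ray D k) (s : ℝ) :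
    lgBdry D k s z = lg D k z := if_neg hz

theorem differentiableAt_lg {D k : ℕ} {z : ℂ} (hz : z ∉ ray D k) :
    DifferentiableAt ℂ (lg D k) z := by
  have h : DifferentiableAt ℂ (fun z : ℂ => -(z / dir D k)) z := by fun_prop
  exact h.clog (neg_div_mem_slitPlane_iff.2 hz)

theorem eq_of_mem_rays {D m k : ℕ} (hm : m < D) (hk : k < D) {x : ℂ} (hx : x ≠ 0)
    (h1 : x ∈ ray D m) (h2 : x ∈ ray D k) : m = k := by
  obtain ⟨t, ht, rfl⟩ := h1
  obtain ⟨u, hu, h⟩ := h2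
  have hD' : (D : ℂ) ≠ 0 := Nat.cast_ne_zero.2 (by omega)
  have htu : t = u := by
    have := congrArg norm h
    rwa [norm_mul, norm_mul, norm_dir, norm_dir, mul_one, mul_one, Complex.norm_real,
      Complex.norm_real, Real.norm_of_nonneg ht, Real.norm_of_nonneg hu] at this
  rw [← htu] at h
  have hd := mul_left_cancel₀ (left_ne_zero_of_mul hx) h
  rw [dir, dir, Complex.exp_eq_exp_iff_exists_int] at hd
  obtain ⟨n, hn⟩ := hd
  have hmk : (m : ℂ) = k + n * D := by
    have hpi := Complex.two_pi_I_ne_zero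
    field_simp at hn
    linear_combination hn
  have hmk' : (m : ℤ) = k + n * D := by exact_mod_cast hmk
  have hn0 : n = 0 := by
    by_contra h0
    rcases lt_or_gt_of_ne h0 with h | h
    · have : n * D ≤ -1 * D := by gcongr; omega
      omega
    · have : 1 * (D : ℤ) ≤ n * D := by gcongr; omega
      omega
  rw [hn0] at hmk'
  omega

theorem im_of_mem_cone {D m : ℕ} {s c : ℝ} (hc : 0 < c) {x z : ℂ} (hx : x ∈ ray D m)
    (hz : z ∈ cone D m s c x) : 0 < s * orient m * (z / dir D m).im := by
  have h1 : c * ‖z - x‖ < s * ((z - x) / tangent D m).im := hz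
  rw [im_div_tangent, sub_div, Complex.sub_im, (mem_ray_iff.1 hx).2, sub_zero, ← mul_assoc] at h1
  exact (by positivity : 0 ≤ c * ‖z - x‖).trans_lt h1

theorem eventually_notMem_ray {D m k : ℕ} (hm : m < D) (hk : k < D) {s c : ℝ} (hc : 0 < c) {x : ℂ}
    (hx : x ∈ ray D m) (hx0 : x ≠ 0) : ∀ᶠ z in 𝓝[cone D m s c x] x, z ∉ ray D k := by
  by_cases hkm : k = m
  · subst hkm
    filter_upwards [self_mem_nhdsWithin] with z hz hzr
    have := im_of_mem_cone hc hx hz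
    rw [(mem_ray_iff.1 hzr).2, mul_zero] at this
    exact lt_irrefl _ this
  · exact nhdsWithin_le_nhds ((isClosed_ray D k).isOpen_compl.mem_nhds
      fun h => hkm (eq_of_mem_rays hk hm hx0 h hx))

theorem eventually_notMem_Gam {D m : ℕ} (hD : 2 ≤ D) (hm : m < D) {s c : ℝ} (hc : 0 < c) {x : ℂ}
    (hx : x ∈ ray D m) (hx0 : x ≠ 0) : ∀ᶠ z in 𝓝[cone D m s c x] x, z ∉ Gam D := by
  have : ∀ᶠ z in 𝓝[cone D m s c x] x, ∀ k ∈ Finset.range D, z ∉ ray D k :=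
    (Finset.eventually_all _).2 fun k hk =>
      eventually_notMem_ray hm (Finset.mem_range.1 hk) hc hx hx0
  filter_upwards [this] with z hz h
  obtain ⟨k, hk, hzk⟩ := (mem_Gam_iff hD).1 h
  exact hz k (Finset.mem_range.2 hk) hzk

theorem tendsto_lg {D m k : ℕ} (hm : m < D) (hk : k < D) {s c : ℝ} (hs : s = 1 ∨ s = -1)
    (hc : 0 < c) {x : ℂ} (hx : x ∈ ray D m) (hx0 : x ≠ 0) :
    Tendsto (lg D k) (𝓝[cone D m s c x] x) (𝓝 (lgBdry D k s x)) := by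
  by_cases hkm : k = m
  · subst hkm
    obtain ⟨h1, h2⟩ := mem_ray_iff.1 hx
    have hne : x / dir D k ≠ 0 := div_ne_zero hx0 (dir_ne_zero D k)
    have hre : (-(x / dir D k)).re < 0 := by
      rw [Complex.neg_re, neg_lt_zero]
      refine lt_of_le_of_ne h1 fun h => hne (Complex.ext h.symm h2)
    have him : (-(x / dir D k)).im = 0 := by rw [Complex.neg_im, h2, neg_zero]
    have hnorm : ‖-(x / dir D k)‖ = ‖x‖ := by rw [norm_neg, norm_div, norm_dir, div_one]
    have hcont : Tendsto (fun z : ℂ => -(z / dir D k)) (𝓝[cone D k s c x] x)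
        (𝓝 (-(x / dir D k))) :=
      tendsto_nhdsWithin_of_tendsto_nhds
        ((by fun_prop : Continuous fun z : ℂ => -(z / dir D k)).tendsto x)
    have hsg : s * orient k = 1 ∨ s * orient k = -1 := by
      rcases hs with rfl | rfl <;> rcases orient_eq k with h | h <;> simp [h]
    rw [lgBdry_of_mem hx]
    -- In the first case `z` approaches from the counterclockwise side, so `-(z / dir D k)` lies
    -- below the cut of the logarithm and the limit has imaginary part `-π`; the second case gives
    -- `+π`.
    rcases hsg with h | h
    · have := (Complex.tendsto_log_nhdsWithin_im_neg_of_re_neg_of_im_zero hre him).comp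
        (tendsto_nhdsWithin_iff.2 ⟨hcont, by
          filter_upwards [self_mem_nhdsWithin] with z hz
          have := im_of_mem_cone hc hx hz
          rw [h, one_mul] at this
          simpa using this⟩)
      rw [hnorm] at this
      rw [h, Complex.ofReal_one, one_mul]
      exact this
    · have := (Complex.tendsto_log_nhdsWithin_im_nonneg_of_re_neg_of_im_zero hre him).comp
        (tendsto_nhdsWithin_iff.2 ⟨hcont, by
          filter_upwards [self_mem_nhdsWithin] with z hz
          have := im_of_mem_cone hc hx hz
          rw [h] at this
          simp only [Complex.neg_im]
          linarith⟩)
      rw [hnorm] at this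
      rw [h, Complex.ofReal_neg, Complex.ofReal_one, neg_one_mul, neg_mul, sub_neg_eq_add]
      exact this
  · have hxk : x ∉ ray D k := fun h => hkm (eq_of_mem_rays hk hm hx0 h hx)
    rw [lgBdry_of_notMem hxk]
    exact tendsto_nhdsWithin_of_tendsto_nhds (differentiableAt_lg hxk).continuousAt

theorem continuousOn_lgBdry {D k : ℕ} (hD : 2 ≤ D) (hk : k < D) (s : ℝ) :
    ContinuousOn (lgBdry D k s) (Gam D \ {0}) := by
  intro x hx
  have hx0 : x ≠ 0 := hx.2
  by_cases hxk : x ∈ ray D k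
  -- Away from `0` the rays are disjoint, so near `x` the set `Γ` consists of `C_k` alone.
  · have hev : ∀ᶠ z in 𝓝[Gam D \ {0}] x, z ∈ ray D k := by
      have : ∀ᶠ z in 𝓝 x, ∀ m ∈ (Finset.range D).erase k, z ∉ ray D m :=
        (Finset.eventually_all _).2 fun m hm => by
          have hm' := Finset.mem_erase.1 hm
          exact (isClosed_ray D m).isOpen_compl.mem_nhds fun h =>
            hm'.1 (eq_of_mem_rays (Finset.mem_range.1 hm'.2) hk hx0 h hxk)
      filter_upwards [nhdsWithin_le_nhds this, self_mem_nhdsWithin] with z hz hzG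
      obtain ⟨m, hm, hzm⟩ := (mem_Gam_iff hD).1 hzG.1
      by_cases hmk : m = k
      · exact hmk ▸ hzm
      · exact absurd hzm (hz m (Finset.mem_erase.2 ⟨hmk, Finset.mem_range.2 hm⟩))
    have hc : ContinuousAt (fun z : ℂ => (Real.log ‖z‖ : ℂ) -
        (s * orient k : ℝ) * Real.pi * Complex.I) x := by
      refine ContinuousAt.sub ?_ continuousAt_const
      exact Complex.continuous_ofReal.continuousAt.comp
        (continuous_norm.continuousAt.log (norm_ne_zero_iff.2 hx0))
    refine hc.continuousWithinAt.congr_of_eventuallyEq ?_ (lgBdry_of_mem hxk s)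
    filter_upwards [hev] with z hz using lgBdry_of_mem hz s
  · refine (differentiableAt_lg hxk).continuousAt.continuousWithinAt.congr_of_eventuallyEq ?_
      (lgBdry_of_notMem hxk s)
    filter_upwards [nhdsWithin_le_nhds ((isClosed_ray D k).isOpen_compl.mem_nhds hxk)] with z hz
      using lgBdry_of_notMem hz s

open Classical in
theorem lgBdry_sub (D k : ℕ) (x : ℂ) : lgBdry D k 1 x - lgBdry D k (-1) x =
    if x ∈ ray D k then -(2 * Real.pi * Complex.I) * orient k else 0 := by
  unfold lgBdry
  split_ifs <;> push_cast <;> ring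

/-- Both real parts are `log |z|` and cancel. This is the reason why the solution stays bounded at
the origin. -/
theorem norm_lg_sub_le (D k : ℕ) (z : ℂ) : ‖lg D k z - lg D 0 z‖ ≤ 2 * Real.pi := by
  have hre : (lg D k z - lg D 0 z).re = 0 := by
    simp only [lg, Complex.sub_re, Complex.log_re, norm_neg, norm_div, norm_dir, sub_self]
  rw [← Complex.re_add_im (lg D k z - lg D 0 z), hre, Complex.ofReal_zero, zero_add, norm_mul,
    Complex.norm_I, mul_one, Complex.norm_real, Real.norm_eq_abs, Complex.sub_im, lg, lg,
    Complex.log_im, Complex.log_im]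
  refine (abs_sub _ _).trans ?_
  have := Complex.abs_arg_le_pi (-(z / dir D k))
  have := Complex.abs_arg_le_pi (-(z / dir D 0))
  linarith

/-! ### The columns of the explicit solution -/

variable {V : ℝ[X]}

/-- The index of the contour on which column `j ≥ 1` jumps. -/
def colContour (D j : ℕ) : ℕ := if j = 1 then D / 2 else j - 1

/-- The exponent of the weight of column `j ≥ 1`. -/
def colPot (V : ℝ[X]) (j : ℕ) : ℂ[X] := if j = 1 then cpot₂ V else cpot V

theorem Admissible.colGrows (hV : Admissible V) (j : ℕ) :
    GrowsOnRays V.natDegree (colPot V j) := by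
  unfold colPot; split_ifs
  · exact hV.grows₂
  · exact hV.grows

theorem colContour_mem {D j : ℕ} (hD : 2 ≤ D) (h1 : 1 ≤ j) (hj : j ≤ D) :
    1 ≤ colContour D j ∧ colContour D j < D := by
  unfold colContour; split_ifs <;> omega

theorem contour_subset_Gam {D j : ℕ} (h1 : 1 ≤ j) (hj : j < D) : contour D j ⊆ Gam D :=
  Set.subset_biUnion_of_mem (u := fun j => contour D j)
    (Set.mem_Icc.2 ⟨h1, by omega⟩ : j ∈ Set.Icc 1 (D - 1))

theorem weight_mul_eval (V : ℝ[X]) (j : ℕ) (q : ℂ[X]) :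
    (fun x => weight V j x * q.eval x) = expPoly (colPot V j) q := by
  by_cases hj : j = 1
  · subst hj; rw [weight_one_mul, colPot, if_pos rfl]
  · rw [weight_mul hj, colPot, if_neg hj]

theorem Admissible.support_eq (hV : Admissible V) (j : ℕ) :
    support V.natDegree j = contour V.natDegree (colContour V.natDegree j) := by
  unfold support colContour; split_ifs
  · exact realLine_eq_contour (by have := hV.two_le; omega) hV.even
  · rfl

theorem cauchyRow_zero (q : ℂ[X]) (z : ℂ) : cauchyRow V q 0 z = q.eval z := if_pos rfl

theorem Admissible.cauchyRow_eq (hV : Admissible V) (q : ℂ[X]) {j : ℕ} (h1 : 1 ≤ j)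
    (hj : j ≤ V.natDegree) {z : ℂ} (hz : z ∉ Gam V.natDegree) :
    cauchyRow V q j z =
      cauchyContour V.natDegree (colContour V.natDegree j) (expPoly (colPot V j) q) z := by
  obtain ⟨hc1, hc2⟩ := colContour_mem hV.two_le h1 hj
  have hzc : z ∉ contour V.natDegree (colContour V.natDegree j) :=
    fun h => hz (contour_subset_Gam hc1 hc2 h)
  rw [cauchyRow, if_neg (by omega)]
  by_cases hj1 : j = 1
  · subst hj1
    rw [if_pos rfl, weight_mul_eval]
    simp only [colContour, if_true] at hzc ⊢
    exact (hV.colGrows 1).cauchyReal_eq hV.even q hzc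
  · rw [if_neg hj1, weight_mul_eval, colContour, if_neg hj1]

theorem Admissible.exists_cauchyRow_eq (hV : Admissible V) (q : ℂ[X]) {j : ℕ} (h1 : 1 ≤ j)
    (hj : j ≤ V.natDegree) :
    ∃ H : ℂ → ℂ, Differentiable ℂ H ∧ ∀ z ∉ Gam V.natDegree, cauchyRow V q j z =
      H z + (2 * Real.pi * Complex.I)⁻¹ * expPoly (colPot V j) q z *
        (lg V.natDegree (colContour V.natDegree j) z - lg V.natDegree 0 z) := by
  obtain ⟨hc1, hc2⟩ := colContour_mem hV.two_le h1 hj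
  obtain ⟨H, hH, h⟩ := (hV.colGrows j).exists_cauchyContour_eq (colContour V.natDegree j) q
  refine ⟨H, hH, fun z hz => ?_⟩
  rw [hV.cauchyRow_eq q h1 hj hz, h z fun hzc => hz (contour_subset_Gam hc1 hc2 hzc)]
  rfl

theorem Admissible.analyticOnNhd_cauchyRow (hV : Admissible V) (q : ℂ[X]) {j : ℕ}
    (hj : j ≤ V.natDegree) : AnalyticOnNhd ℂ (cauchyRow V q j) (Gam V.natDegree)ᶜ := by
  refine DifferentiableOn.analyticOnNhd ?_ (isClosed_Gam _).isOpen_compl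
  rcases Nat.eq_zero_or_pos j with rfl | h1
  · rw [show cauchyRow V q 0 = fun z => q.eval z from funext (cauchyRow_zero q)]
    exact q.differentiable.differentiableOn
  obtain ⟨hc1, hc2⟩ := colContour_mem hV.two_le h1 hj
  obtain ⟨H, hH, h⟩ := hV.exists_cauchyRow_eq q h1 hj
  refine DifferentiableOn.congr (fun z hz => ?_) h
  have hmem : ∀ k < V.natDegree, z ∉ ray V.natDegree k := fun k hk hzk =>
    hz ((mem_Gam_iff hV.two_le).2 ⟨k, hk, hzk⟩)
  refine DifferentiableAt.differentiableWithinAt ?_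
  exact (hH z).add (((differentiable_expPoly _ _ z).const_mul _).mul
    ((differentiableAt_lg (hmem _ hc2)).sub (differentiableAt_lg (hmem 0 (by omega)))))

theorem Admissible.bounded_cauchyRow (hV : Admissible V) (q : ℂ[X]) {j : ℕ}
    (hj : j ≤ V.natDegree) (x : ℂ) :
    ∃ M : ℝ, ∀ z ∉ Gam V.natDegree, dist z x < 1 → ‖cauchyRow V q j z‖ ≤ M := by
  have hle : ∀ z : ℂ, dist z x < 1 → ‖z‖ ≤ ‖x‖ + 1 := fun z hz => by
    rw [dist_eq_norm] at hz
    have := norm_add_le (z - x) x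
    rw [sub_add_cancel] at this
    linarith
  rcases Nat.eq_zero_or_pos j with rfl | h1
  · obtain ⟨M, -, hM⟩ := exists_bound_closedBall q.continuous (‖x‖ + 1)
    exact ⟨M, fun z _ hz => by rw [cauchyRow_zero]; exact hM z (hle z hz)⟩
  obtain ⟨H, hH, h⟩ := hV.exists_cauchyRow_eq q h1 hj
  obtain ⟨M, hM0, hM⟩ := exists_bound_closedBall hH.continuous (‖x‖ + 1)
  obtain ⟨N, hN0, hN⟩ := exists_bound_closedBall (continuous_expPoly (colPot V j) q) (‖x‖ + 1)
  refine ⟨M + ‖(2 * Real.pi * Complex.I : ℂ)⁻¹‖ * N * (2 * Real.pi), fun z hz hzx => ?_⟩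
  rw [h z hz]
  refine (norm_add_le _ _).trans (add_le_add (hM z (hle z hzx)) ?_)
  rw [norm_mul, norm_mul]
  have hpi := Real.pi_pos
  gcongr
  · exact hN z (hle z hzx)
  · exact norm_lg_sub_le _ _ _

theorem Admissible.exists_boundary_cauchyRow (hV : Admissible V) (q : ℂ[X]) {j : ℕ} (h1 : 1 ≤ j)
    (hj : j ≤ V.natDegree) : ∃ B : ℝ → ℂ → ℂ,
      (∀ s : ℝ, (s = 1 ∨ s = -1) → ∀ k < V.natDegree, ∀ x ∈ ray V.natDegree k, x ≠ 0 → ∀ c > 0,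
        Tendsto (cauchyRow V q j) (𝓝[cone V.natDegree k s c x] x) (𝓝 (B s x))) ∧
      (∀ s, ContinuousOn (B s) (Gam V.natDegree \ {0})) ∧
      ∀ x ≠ 0, B 1 x = B (-1) x +
        q.eval x * (support V.natDegree j).indicator (weight V j) x := by
  have hD := hV.two_le
  obtain ⟨hc1, hc2⟩ := colContour_mem hV.two_le h1 hj
  obtain ⟨H, hH, h⟩ := hV.exists_cauchyRow_eq q h1 hj
  set m := colContour V.natDegree j with hm
  refine ⟨fun s x => H x + (2 * Real.pi * Complex.I)⁻¹ * expPoly (colPot V j) q x *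
    (lgBdry V.natDegree m s x - lgBdry V.natDegree 0 s x), fun s hs k hk x hx hx0 c hc => ?_,
    fun s => ?_, fun x hx0 => ?_⟩
  · have hlim : Tendsto (fun z => H z + (2 * Real.pi * Complex.I)⁻¹ * expPoly (colPot V j) q z *
        (lg V.natDegree m z - lg V.natDegree 0 z)) (𝓝[cone V.natDegree k s c x] x) _ :=
      (tendsto_nhdsWithin_of_tendsto_nhds (hH.continuous.tendsto x)).add
      ((tendsto_nhdsWithin_of_tendsto_nhds
        (((continuous_expPoly (colPot V j) q).tendsto x).const_mul _)).mul
      ((tendsto_lg hk hc2 hs hc hx hx0).sub (tendsto_lg hk (by omega) hs hc hx hx0)))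
    refine hlim.congr' ?_
    filter_upwards [eventually_notMem_Gam hD hk hc hx hx0] with z hz using (h z hz).symm
  · exact hH.continuous.continuousOn.add
      (((continuous_expPoly (colPot V j) q).continuousOn.const_mul _).mul
      ((continuousOn_lgBdry hD hc2 s).sub (continuousOn_lgBdry hD (by omega) s)))
  · have hpi := Complex.two_pi_I_ne_zero
    have e1 := lgBdry_sub V.natDegree m x
    have e0 := lgBdry_sub V.natDegree 0 x
    have hw : weight V j x * q.eval x = expPoly (colPot V j) q x :=
      congrFun (weight_mul_eval V j q) x
    -- On the incoming ray the jump of the logarithm is `2πi`; on `C_0` it is `-2πi`, but there the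
    -- logarithm enters with a minus sign. So both rays contribute `+ e^{-W} q`.
    have hom : orient m = -1 := if_neg (by omega)
    have ho0 : orient 0 = 1 := if_pos rfl
    rw [hom] at e1
    rw [ho0] at e0
    have hkey : (2 * Real.pi * Complex.I)⁻¹ * expPoly (colPot V j) q x *
        ((lgBdry V.natDegree m 1 x - lgBdry V.natDegree m (-1) x) -
        (lgBdry V.natDegree 0 1 x - lgBdry V.natDegree 0 (-1) x)) =
        q.eval x * (support V.natDegree j).indicator (weight V j) x := by
      rw [e1, e0, ← hw, hV.support_eq, ← hm]
      by_cases hxm : x ∈ ray V.natDegree m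
      · have hx' : x ∉ ray V.natDegree 0 := fun h' => by
          have := eq_of_mem_rays hc2 (by omega) hx0 hxm h'
          omega
        rw [if_pos hxm, if_neg hx', Set.indicator_of_mem (show x ∈ contour V.natDegree m from Or.inr hxm)]
        push_cast
        field_simp
        ring
      · by_cases hx' : x ∈ ray V.natDegree 0
        · rw [if_neg hxm, if_pos hx', Set.indicator_of_mem (show x ∈ contour V.natDegree m from Or.inl hx')]
          push_cast
          field_simp
          ring
        · rw [if_neg hxm, if_neg hx', Set.indicator_of_notMem (fun h' => h'.elim hx' hxm)]
          ring
    rw [← hkey]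
    ring

/-! ### Behaviour at infinity -/

theorem exists_norm_poly_sub_le (q : ℂ[X]) {N : ℕ} (hN : 1 ≤ N) (hq : q.natDegree ≤ N) :
    ∃ M : ℝ, ∀ z : ℂ, 2 ≤ ‖z‖ → ‖q.eval z * z ^ (-(N : ℤ)) - q.coeff N‖ ≤ M * ‖z⁻¹‖ := by
  set p := q - C (q.coeff N) * X ^ N with hp
  have hpd : p.natDegree ≤ N - 1 := by
    rw [natDegree_le_iff_coeff_eq_zero]
    intro k hk
    rw [hp, coeff_sub, coeff_C_mul, coeff_X_pow]
    split_ifs with h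
    · rw [h]; ring
    · rw [coeff_eq_zero_of_natDegree_lt (by omega : q.natDegree < k)]; ring
  obtain ⟨B, -, hB⟩ := norm_eval_le p hpd
  refine ⟨B, fun z hz => ?_⟩
  have hz0 : z ≠ 0 := norm_pos_iff.1 (by linarith)
  have e : q.eval z * z ^ (-(N : ℤ)) - q.coeff N = p.eval z * (z ^ N)⁻¹ := by
    rw [zpow_neg, zpow_natCast, hp, eval_sub, eval_mul, eval_C, eval_pow, eval_X]
    field_simp
  rw [e, norm_mul, norm_inv, norm_inv, norm_pow]
  have hzp : 0 < ‖z‖ := norm_pos_iff.2 hz0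
  have hpow : ‖z‖ ^ N = ‖z‖ ^ (N - 1) * ‖z‖ := by
    rw [← pow_succ]; congr 1; omega
  calc ‖p.eval z‖ * (‖z‖ ^ N)⁻¹ ≤ B * ‖z‖ ^ (N - 1) * (‖z‖ ^ N)⁻¹ := by
        gcongr
        exact hB z ‖z‖ (by linarith) le_rfl
    _ = B * ‖z‖⁻¹ := by rw [hpow]; field_simp

theorem Admissible.exists_norm_cauchyRow_sub_le (hV : Admissible V) (q : ℂ[X]) {j : ℕ} (h1 : 1 ≤ j)
    (hj : j ≤ V.natDegree) (m : ℕ) (hm : ∀ l < m, contourIntegral V.natDegree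
      (colContour V.natDegree j) (expPoly (colPot V j) (X ^ l * q)) = 0) :
    ∃ M : ℝ, ∀ z ∉ Gam V.natDegree, 2 ≤ ‖z‖ → ‖cauchyRow V q j z * z ^ (m + 1) -
      -(2 * Real.pi * Complex.I)⁻¹ * contourIntegral V.natDegree (colContour V.natDegree j)
        (expPoly (colPot V j) (X ^ m * q))‖ ≤ M * ‖z⁻¹‖ := by
  obtain ⟨hc1, hc2⟩ := colContour_mem hV.two_le h1 hj
  obtain ⟨M, hM⟩ := (hV.colGrows j).exists_norm_cauchyContour_sub_le _ q m hm
  refine ⟨M, fun z hz h2 => ?_⟩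
  rw [hV.cauchyRow_eq q h1 hj hz, mul_comm]
  exact hM z (fun h => hz (contour_subset_Gam hc1 hc2 h)) h2

theorem Admissible.exists_norm_cauchyRow_le (hV : Admissible V) (q : ℂ[X]) {j : ℕ} (h1 : 1 ≤ j)
    (hj : j ≤ V.natDegree) (m : ℕ) (hm : ∀ l < m, contourIntegral V.natDegree
      (colContour V.natDegree j) (expPoly (colPot V j) (X ^ l * q)) = 0) :
    ∃ M : ℝ, ∀ z ∉ Gam V.natDegree, 2 ≤ ‖z‖ → ‖cauchyRow V q j z * z ^ m‖ ≤ M * ‖z⁻¹‖ := by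
  obtain ⟨M, hM⟩ := hV.exists_norm_cauchyRow_sub_le q h1 hj m hm
  set v := -(2 * Real.pi * Complex.I)⁻¹ * contourIntegral V.natDegree (colContour V.natDegree j)
    (expPoly (colPot V j) (X ^ m * q))
  refine ⟨|M| + ‖v‖, fun z hz h2 => ?_⟩
  have hz0 : z ≠ 0 := norm_pos_iff.1 (by linarith)
  have hinv : ‖z⁻¹‖ ≤ 1 := by
    rw [norm_inv]; exact inv_le_one_of_one_le₀ (by linarith)
  have e : cauchyRow V q j z * z ^ m = (cauchyRow V q j z * z ^ (m + 1)) * z⁻¹ := by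
    rw [pow_succ]; field_simp
  rw [e, norm_mul]
  gcongr
  have h3 := norm_add_le (cauchyRow V q j z * z ^ (m + 1) - v) v
  rw [sub_add_cancel] at h3
  have h4 : M * ‖z⁻¹‖ ≤ |M| := by
    have := abs_nonneg M
    have := le_abs_self M
    nlinarith [norm_nonneg z⁻¹]
  linarith [hM z hz h2]

end

section

variable {V : ℝ[X]} {P : ℕ → ℝ[X]} {R : ℕ → ℂ[X]} {n : ℕ}

/-! ### Degrees and moments of the polynomials of column `0` -/

theorem rowPoly_zero : rowPoly V P R n 0 = (dual V (P (2 * n))).map (algebraMap ℝ ℂ) := rfl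

theorem rowPoly_one (m : ℕ) : rowPoly V P R (m + 1) 1 =
    (-(2 * Real.pi * Complex.I * V.leadingCoeff * V.natDegree / skewNorm V P m) : ℂ) •
      (dual V (P (2 * m))).map (algebraMap ℝ ℂ) := by
  rw [smul_eq_C_mul]; rfl

theorem rowPoly_of_two_le {i : ℕ} (hi : 2 ≤ i) : rowPoly V P R n i = R (i - 1) := by
  rw [rowPoly, if_neg (by omega), if_neg (by omega)]

theorem natDegree_rowPoly_zero (hV : Admissible V) (hP : IsSkewOrthogonal V P) :
    (rowPoly V P R n 0).natDegree = 2 * n + V.natDegree - 1 ∧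
      (rowPoly V P R n 0).coeff (2 * n + V.natDegree - 1) = 1 := by
  obtain ⟨h1, h2⟩ := hV.natDegree_dual_and_monic (hP.monic (2 * n))
  rw [hP.natDegree_eq] at h1
  have h3 := h2.map (algebraMap ℝ ℂ)
  have h4 := h2.natDegree_map (algebraMap ℝ ℂ)
  rw [h1] at h4
  refine ⟨h4, ?_⟩
  rw [rowPoly_zero, ← h4]
  exact h3

theorem natDegree_rowPoly_lt (hV : Admissible V) (hP : IsSkewOrthogonal V P)
    (hR : ∀ j ∈ Set.Icc 1 (V.natDegree - 1), IsAuxiliary V n j (R j)) {i : ℕ} (h0 : i ≠ 0)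
    (hi : i ≤ V.natDegree) (hni : ¬(n = 0 ∧ i = 1)) :
    (rowPoly V P R n i).natDegree < 2 * n + V.natDegree - 1 := by
  have hD := hV.two_le
  by_cases h1 : i = 1
  · subst h1
    obtain ⟨m, rfl⟩ : ∃ m, n = m + 1 := ⟨n - 1, by omega⟩
    rw [rowPoly_one]
    refine (natDegree_smul_le _ _).trans_lt ?_
    obtain ⟨h1, h2⟩ := hV.natDegree_dual_and_monic (hP.monic (2 * m))
    rw [h2.natDegree_map, h1, hP.natDegree_eq]
    omega
  · rw [rowPoly_of_two_le (by omega)]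
    have := (hR (i - 1) (Set.mem_Icc.2 (by omega))).natDegree_le
    omega

theorem moment_rowPoly_of_ne_one (hV : Admissible V) (hP : IsSkewOrthogonal V P)
    (hR : ∀ j ∈ Set.Icc 1 (V.natDegree - 1), IsAuxiliary V n j (R j)) {i : ℕ} (h1 : i ≠ 1)
    (hi : i ≤ V.natDegree) : ∀ l < 2 * n, contourIntegral V.natDegree (V.natDegree / 2)
      (expPoly (cpot₂ V) (X ^ l * rowPoly V P R n i)) = 0 := by
  intro l hl
  by_cases h0 : i = 0
  · subst h0
    have hX : (X ^ l : ℝ[X]) ∈ degreeLT ℝ (2 * n + 1) := by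
      rw [mem_degreeLT, degree_X_pow]; exact_mod_cast (by omega)
    rw [rowPoly_zero, hV.contourIntegral_dual, hP.skew_mem_eq_zero hV n _ hX, mul_zero,
      Complex.ofReal_zero]
  · rw [rowPoly_of_two_le (by omega)]
    exact (hV.isAuxiliary_iff.1 (hR (i - 1) (Set.mem_Icc.2 (by omega)))).2.1 l hl

/-- The factor `2πi γ D / h` in the second row is fixed by this: the first surviving moment is
`-2πi`, which makes the leading coefficient of its Cauchy transform equal to `1`. -/
theorem moment_rowPoly_one (hV : Admissible V) (hP : IsSkewOrthogonal V P) {m l : ℕ}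
    (hl : l ≤ 2 * m + 1) : contourIntegral V.natDegree (V.natDegree / 2)
      (expPoly (cpot₂ V) (X ^ l * rowPoly V P R (m + 1) 1)) =
        if l = 2 * m + 1 then -(2 * Real.pi * Complex.I) else 0 := by
  rw [rowPoly_one, mul_smul_comm, contourIntegral_smul, hV.contourIntegral_dual]
  split_ifs with h
  · rw [h, hP.skew_pow hV m]
    have h1 : (skewNorm V P m : ℂ) ≠ 0 := Complex.ofReal_ne_zero.2 (hP.skewNorm_ne_zero hV m)
    have h2 : (V.leadingCoeff : ℂ) * (V.natDegree : ℂ) ≠ 0 := by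
      exact_mod_cast hV.const_ne_zero
    push_cast
    have h3 := left_ne_zero_of_mul h2
    have h4 := right_ne_zero_of_mul h2
    field_simp
  · have hX : (X ^ l : ℝ[X]) ∈ degreeLT ℝ (2 * m + 1) := by
      rw [mem_degreeLT, degree_X_pow]; exact_mod_cast (by omega)
    rw [hP.skew_mem_eq_zero hV m _ hX, mul_zero, Complex.ofReal_zero, mul_zero]

/-- Rows `0` and `1` are multiples of duals and have no periods; the shift by one comes from `R k`
standing in row `k + 1`. -/
theorem period_rowPoly (hV : Admissible V)
    (hR : ∀ j ∈ Set.Icc 1 (V.natDegree - 1), IsAuxiliary V n j (R j)) {i k : ℕ}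
    (hi : i ≤ V.natDegree) (hni : ¬(n = 0 ∧ i = 1)) (hk : k ∈ Set.Icc 1 (V.natDegree - 1)) :
    contourIntegral V.natDegree k (expPoly (cpot V) (rowPoly V P R n i)) =
      if i = k + 1 then -(2 * Real.pi * Complex.I) else 0 := by
  by_cases h0 : i = 0
  · subst h0
    rw [rowPoly_zero, hV.contourIntegral_dual_eq_zero, if_neg (by omega)]
  by_cases h1 : i = 1
  · subst h1
    obtain ⟨m, rfl⟩ : ∃ m, n = m + 1 := ⟨n - 1, by omega⟩
    rw [rowPoly_one, contourIntegral_smul, hV.contourIntegral_dual_eq_zero, mul_zero,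
      if_neg (by have := hk.1; omega)]
  · rw [rowPoly_of_two_le (by omega),
      (hV.isAuxiliary_iff.1 (hR (i - 1) (Set.mem_Icc.2 (by omega)))).2.2 k hk]
    congr 1
    exact propext (by omega)

/-! ### The entries of the explicit solution -/

/-- The exponents of `normMatrix`. -/
def normExp (D n j : ℕ) : ℤ :=
  if j = 0 then 2 * (n : ℤ) + D - 1 else if j = 1 then -(2 * (n : ℤ)) else -1

/-- Column `0` is governed by degrees, column `1` by the moment conditions, and the remaining
columns by the periods, which are the coefficients of `z⁻¹`. -/
theorem norm_rowPoly_le (hV : Admissible V) (hP : IsSkewOrthogonal V P)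
    (hR : ∀ j ∈ Set.Icc 1 (V.natDegree - 1), IsAuxiliary V n j (R j)) {i j : ℕ}
    (hi : i ≤ V.natDegree) (hj : j ≤ V.natDegree) (hni : ¬(n = 0 ∧ i = 1)) :
    ∃ M : ℝ, ∀ z ∉ Gam V.natDegree, 2 ≤ ‖z‖ →
      ‖cauchyRow V (rowPoly V P R n i) j z * z ^ (-normExp V.natDegree n j) -
        if i = j then 1 else 0‖ ≤ M * ‖z⁻¹‖ := by
  have hD := hV.two_le
  have hpi := Complex.two_pi_I_ne_zero
  by_cases h0 : j = 0
  · subst h0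
    have hdeg : (rowPoly V P R n i).natDegree ≤ 2 * n + V.natDegree - 1 := by
      by_cases hi0 : i = 0
      · rw [hi0, (natDegree_rowPoly_zero hV hP).1]
      · exact (natDegree_rowPoly_lt hV hP hR hi0 hi hni).le
    have hcoeff : (rowPoly V P R n i).coeff (2 * n + V.natDegree - 1) = if i = 0 then 1 else 0 := by
      split_ifs with hi0
      · rw [hi0, (natDegree_rowPoly_zero hV hP).2]
      · exact coeff_eq_zero_of_natDegree_lt (natDegree_rowPoly_lt hV hP hR hi0 hi hni)
    obtain ⟨M, hM⟩ := exists_norm_poly_sub_le _ (by omega) hdeg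
    have he : normExp V.natDegree n 0 = ((2 * n + V.natDegree - 1 : ℕ) : ℤ) := by
      rw [normExp, if_pos rfl]; omega
    refine ⟨M, fun z _ h2 => ?_⟩
    rw [cauchyRow_zero, he, ← hcoeff]
    exact hM z h2
  by_cases h1 : j = 1
  · subst h1
    have he : -normExp V.natDegree n 1 = ((2 * n : ℕ) : ℤ) := by simp [normExp]
    by_cases hi1 : i = 1
    · subst hi1
      obtain ⟨m, rfl⟩ : ∃ m, n = m + 1 := ⟨n - 1, by omega⟩
      obtain ⟨M, hM⟩ := hV.exists_norm_cauchyRow_sub_le (rowPoly V P R (m + 1) 1) le_rfl hj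
        (2 * m + 1) (fun l hl => (moment_rowPoly_one hV hP hl.le).trans (if_neg hl.ne))
      refine ⟨M, fun z hz h2 => ?_⟩
      have h3 := hM z hz h2
      have h4 : contourIntegral V.natDegree (colContour V.natDegree 1) (expPoly (colPot V 1)
          (X ^ (2 * m + 1) * rowPoly V P R (m + 1) 1)) = -(2 * Real.pi * Complex.I) :=
        (moment_rowPoly_one hV hP le_rfl).trans (if_pos rfl)
      rw [h4, neg_mul_neg, inv_mul_cancel₀ hpi] at h3
      rw [he, zpow_natCast, if_pos rfl]
      exact h3
    · obtain ⟨M, hM⟩ := hV.exists_norm_cauchyRow_le (rowPoly V P R n i) le_rfl hj (2 * n)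
        (moment_rowPoly_of_ne_one hV hP hR hi1 hi)
      refine ⟨M, fun z hz h2 => ?_⟩
      rw [he, zpow_natCast, if_neg hi1, sub_zero]
      exact hM z hz h2
  · obtain ⟨M, hM⟩ := hV.exists_norm_cauchyRow_sub_le (rowPoly V P R n i) (by omega) hj 0
      (fun l hl => absurd hl (Nat.not_lt_zero l))
    refine ⟨M, fun z hz h2 => ?_⟩
    have h3 := hM z hz h2
    rw [colContour, if_neg h1, colPot, if_neg h1, pow_zero, one_mul,
      period_rowPoly hV hR hi hni (Set.mem_Icc.2 (by omega)), zero_add, pow_one] at h3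
    rw [normExp, if_neg h0, if_neg h1, neg_neg, zpow_one]
    refine (le_of_eq ?_).trans h3
    congr 2
    have : j - 1 + 1 = j := by omega
    rw [this]
    split_ifs
    · rw [neg_mul_neg, inv_mul_cancel₀ hpi]
    · rw [mul_zero]

theorem evenSolution_apply (i j : Fin (V.natDegree + 1)) : (fun z => evenSolution V P R n z i j) =
    if n = 0 ∧ i.val = 1 then fun _ => if j = i then 1 else 0
    else cauchyRow V (rowPoly V P R n i) j := by
  funext z
  simp only [evenSolution, Matrix.of_apply]
  split_ifs <;> rfl

theorem analyticOnNhd_evenSolution (hV : Admissible V) (i j : Fin (V.natDegree + 1)) :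
    AnalyticOnNhd ℂ (fun z => evenSolution V P R n z i j) (Gam V.natDegree)ᶜ := by
  rw [evenSolution_apply]
  split_ifs
  · exact analyticOnNhd_const
  · exact analyticOnNhd_const
  · exact hV.analyticOnNhd_cauchyRow _ (Nat.lt_succ_iff.1 j.2)

theorem bounded_evenSolution (hV : Admissible V) (x : ℂ) (i j : Fin (V.natDegree + 1)) :
    ∃ M : ℝ, ∀ z ∉ Gam V.natDegree, dist z x < 1 → ‖evenSolution V P R n z i j‖ ≤ M := by
  simp only [congrFun (evenSolution_apply (V := V) (P := P) (R := R) (n := n) i j)]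
  split_ifs
  · exact ⟨_, fun _ _ _ => le_rfl⟩
  · exact ⟨_, fun _ _ _ => le_rfl⟩
  · exact hV.bounded_cauchyRow _ (Nat.lt_succ_iff.1 j.2) x

/-- All entries of a row share one polynomial `q`, its entry in column `0`. The exceptional row for
`n = 0` is covered by `q = 0`: it has no jump. -/
theorem exists_boundary_evenSolution (hV : Admissible V) (i : Fin (V.natDegree + 1)) :
    ∃ q : ℂ[X], ∀ j : Fin (V.natDegree + 1), ∃ B : ℝ → ℂ → ℂ,
      (∀ s : ℝ, (s = 1 ∨ s = -1) → ∀ k < V.natDegree, ∀ x ∈ ray V.natDegree k, x ≠ 0 → ∀ c > 0,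
        Tendsto (fun z => evenSolution V P R n z i j) (𝓝[cone V.natDegree k s c x] x)
          (𝓝 (B s x))) ∧
      (∀ s, ContinuousOn (B s) (Gam V.natDegree \ {0})) ∧
      (j = 0 → ∀ s x, B s x = q.eval x) ∧
      ∀ x ≠ 0, B 1 x = B (-1) x +
        q.eval x * if j = 0 then 0 else (support V.natDegree j).indicator (weight V j) x := by
  by_cases h : n = 0 ∧ i.val = 1
  · refine ⟨0, fun j => ⟨fun _ _ => if j = i then 1 else 0, fun s _ k _ x _ _ c _ => ?_,
      fun _ => continuousOn_const, fun hj s x => ?_, fun x _ => by simp⟩⟩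
    · rw [evenSolution_apply, if_pos h]
      exact tendsto_const_nhds
    · have : j ≠ i := fun hji => by
        have := h.2
        rw [← hji, hj] at this
        exact zero_ne_one this
      simp [this]
  · refine ⟨rowPoly V P R n i, fun j => ?_⟩
    rw [evenSolution_apply, if_neg h]
    by_cases hj : j = 0
    · subst hj
      refine ⟨fun _ x => (rowPoly V P R n i).eval x, fun s _ k _ x _ _ c _ => ?_,
        fun _ => (rowPoly V P R n i).continuous.continuousOn, fun _ _ _ => rfl, fun x _ => by simp⟩
      rw [show cauchyRow V (rowPoly V P R n i) ((0 : Fin (V.natDegree + 1)) : ℕ) =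
        fun z => (rowPoly V P R n i).eval z from funext (cauchyRow_zero _)]
      exact tendsto_nhdsWithin_of_tendsto_nhds ((rowPoly V P R n i).continuous.tendsto x)
    · have h1 : 1 ≤ (j : ℕ) := Nat.one_le_iff_ne_zero.2 fun h => hj (Fin.ext h)
      obtain ⟨B, hB1, hB2, hB3⟩ := hV.exists_boundary_cauchyRow (rowPoly V P R n i) h1
        (Nat.lt_succ_iff.1 j.2)
      exact ⟨B, hB1, hB2, fun h => absurd h hj, fun x hx => by rw [if_neg hj]; exact hB3 x hx⟩

theorem mul_jump_apply (A : Matrix (Fin (V.natDegree + 1)) (Fin (V.natDegree + 1)) ℂ) (x : ℂ)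
    (i j : Fin (V.natDegree + 1)) : (A * jump V x) i j = A i j +
      A i 0 * if j = 0 then 0 else (support V.natDegree j).indicator (weight V j) x := by
  have hJ : ∀ k, jump V x k j = (if k = j then 1 else 0) +
      if k = 0 then (if j = 0 then 0 else (support V.natDegree j).indicator (weight V j) x)
      else 0 := by
    intro k
    have hk : k.val = 0 ↔ k = 0 := by rw [Fin.ext_iff, Fin.val_zero]
    simp only [jump, Matrix.of_apply, hk]
    by_cases h1 : k = j
    · subst h1; by_cases h0 : k = 0 <;> simp [h0]
    · by_cases h0 : k = 0
      · subst h0; simp [h1, Ne.symm h1]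
      · simp [h0, h1]
  simp only [Matrix.mul_apply, hJ, mul_add, Finset.sum_add_distrib, mul_ite, mul_one, mul_zero,
    Finset.sum_ite_eq', Finset.mem_univ, if_true]

theorem isEvenSolution_evenSolution (hV : Admissible V) (hP : IsSkewOrthogonal V P)
    (hR : ∀ j ∈ Set.Icc 1 (V.natDegree - 1), IsAuxiliary V n j (R j)) :
    IsEvenSolution V n (evenSolution V P R n) where
  analytic := analyticOnNhd_evenSolution hV
  bounded := fun x _ => by
    choose M hM using bounded_evenSolution (P := P) (R := R) (n := n) hV x
    refine ⟨1, one_pos, ∑ i, ∑ j, |M i j|, fun z hz hzx i j => ?_⟩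
    refine ((hM i j z hz hzx).trans (le_abs_self _)).trans ?_
    refine (Finset.single_le_sum (f := fun j => |M i j|) (fun _ _ => abs_nonneg _)
      (Finset.mem_univ j)).trans ?_
    exact Finset.single_le_sum (f := fun i => ∑ j, |M i j|)
      (fun _ _ => Finset.sum_nonneg fun _ _ => abs_nonneg _) (Finset.mem_univ i)
  boundary := by
    choose q B hB1 hB2 hB3 hB4 using exists_boundary_evenSolution (P := P) (R := R) (n := n) hV
    refine ⟨fun x => Matrix.of fun i j => B i j 1 x, fun x => Matrix.of fun i j => B i j (-1) x,
      fun k hk x hx hx0 c hc => ?_, fun k hk x hx hx0 c hc => ?_, ?_, ?_, fun x hx => ?_⟩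
    · exact tendsto_pi_nhds.2 fun i => tendsto_pi_nhds.2 fun j =>
        hB1 i j 1 (Or.inl rfl) k hk x hx hx0 c hc
    · exact tendsto_pi_nhds.2 fun i => tendsto_pi_nhds.2 fun j =>
        hB1 i j (-1) (Or.inr rfl) k hk x hx hx0 c hc
    · exact continuousOn_pi.2 fun i => continuousOn_pi.2 fun j => hB2 i j 1
    · exact continuousOn_pi.2 fun i => continuousOn_pi.2 fun j => hB2 i j (-1)
    · ext i j
      rw [mul_jump_apply]
      simp only [Matrix.of_apply]
      rw [hB3 i 0 rfl, hB4 i j x hx.2]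
  normalisation := by
    have key : ∀ i j : Fin (V.natDegree + 1), ∃ M : ℝ, ∀ z ∉ Gam V.natDegree, 2 ≤ ‖z‖ →
        ‖evenSolution V P R n z i j * z ^ (-normExp V.natDegree n j) -
          (1 : Matrix (Fin (V.natDegree + 1)) (Fin (V.natDegree + 1)) ℂ) i j‖ ≤ M * ‖z⁻¹‖ := by
      intro i j
      simp only [congrFun (evenSolution_apply (V := V) (P := P) (R := R) (n := n) i j),
        Matrix.one_apply]
      by_cases h : n = 0 ∧ i.val = 1
      · refine ⟨0, fun z _ _ => ?_⟩
        rw [if_pos h, zero_mul, norm_le_zero_iff]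
        by_cases hij : i = j
        · subst hij
          simp [normExp, h.1, h.2]
        · rw [if_neg hij, if_neg (Ne.symm hij)]; ring
      · rw [if_neg h]
        obtain ⟨M, hM⟩ := norm_rowPoly_le hV hP hR (Nat.lt_succ_iff.1 i.2) (Nat.lt_succ_iff.1 j.2) h
        refine ⟨M, fun z hz h2 => ?_⟩
        simp only [Fin.ext_iff]
        exact hM z hz h2
    choose M hM using key
    have hev : ∀ᶠ z in Bornology.cobounded ℂ ⊓ 𝓟 (Gam V.natDegree)ᶜ,
        z ∉ Gam V.natDegree ∧ 2 ≤ ‖z‖ := by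
      rw [eventually_inf_principal]
      filter_upwards [tendsto_norm_cobounded_atTop.eventually_ge_atTop 2] with z h2 hz
        using ⟨hz, h2⟩
    refine ⟨fun z => Matrix.of fun i j =>
      evenSolution V P R n z i j * z ^ (-normExp V.natDegree n j) -
        (1 : Matrix (Fin (V.natDegree + 1)) (Fin (V.natDegree + 1)) ℂ) i j, fun i j => ?_, ?_⟩
    · refine Asymptotics.IsBigO.of_bound (M i j) ?_
      filter_upwards [hev] with z hz using hM i j z hz.1 hz.2
    · filter_upwards [hev] with z hz
      have hz0 : z ≠ 0 := norm_pos_iff.1 (by linarith [hz.2])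
      ext i j
      rw [normMatrix, Matrix.mul_diagonal, Matrix.add_apply, Matrix.of_apply, add_sub_cancel,
        mul_assoc, ← normExp, ← zpow_add₀ hz0, neg_add_cancel, zpow_zero, mul_one]

end

/-! ### Uniqueness and the determinant -/

section

variable {V : ℝ[X]} {n : ℕ}

theorem det_jump (V : ℝ[X]) (x : ℂ) : (jump V x).det = 1 := by
  have h : (jump V x).BlockTriangular id := fun i j hij => by
    have hij' : j < i := hij
    have h0 : i.val ≠ 0 := by have := Fin.lt_def.1 hij'; omega
    rw [jump, Matrix.of_apply, if_neg hij'.ne', if_neg h0]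
  rw [Matrix.det_of_isUpperTriangular h]
  exact Finset.prod_eq_one fun i _ => by rw [jump, Matrix.of_apply, if_pos rfl]

/-- The exponents sum to zero: `(2n + D - 1) - 2n - (D - 1) = 0`. -/
theorem det_normMatrix {D : ℕ} (hD : 2 ≤ D) (n : ℕ) {z : ℂ} (hz : z ≠ 0) :
    (normMatrix D n z).det = 1 := by
  obtain ⟨d, rfl⟩ : ∃ d, D = d + 1 := ⟨D - 1, by omega⟩
  rw [normMatrix, Matrix.det_diagonal, Fin.prod_univ_succ, Fin.prod_univ_succ]
  simp only [Fin.val_zero, Fin.val_succ, Nat.succ_ne_zero, if_true, if_false, Nat.add_eq_right,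
    zero_add, Finset.prod_const, Finset.card_univ, Fintype.card_fin]
  rw [← zpow_natCast, ← zpow_mul, ← zpow_add₀ hz, ← zpow_add₀ hz]
  convert zpow_zero z using 2
  push_cast
  ring

section Analytic

variable {ι : Type*} [Fintype ι] [DecidableEq ι] {A : ℂ → Matrix ι ι ℂ} {s : Set ℂ}

theorem analyticOnNhd_det (hA : ∀ i j, AnalyticOnNhd ℂ (fun z => A z i j) s) :
    AnalyticOnNhd ℂ (fun z => (A z).det) s := by
  simp only [Matrix.det_apply]
  refine Finset.analyticOnNhd_fun_sum _ fun σ _ => ?_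
  exact (Finset.analyticOnNhd_fun_prod _ fun i _ => hA (σ i) i).const_smul

theorem analyticOnNhd_adjugate (hA : ∀ i j, AnalyticOnNhd ℂ (fun z => A z i j) s) (i j : ι) :
    AnalyticOnNhd ℂ (fun z => (A z).adjugate i j) s := by
  simp only [Matrix.adjugate_apply]
  refine analyticOnNhd_det fun k l => ?_
  simp only [Matrix.updateRow_apply]
  split_ifs
  · exact analyticOnNhd_const
  · exact hA k l

end Analytic

/-- Matrices with bounded entries form a compact set, so local boundedness of solutions passes to
continuous expressions in them. -/
theorem exists_norm_le_of_continuous {ι : Type*} {F : Matrix ι ι ℂ → Matrix ι ι ℂ → ℂ}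
    (hF : Continuous (Function.uncurry F)) (M N : ℝ) :
    ∃ C : ℝ, ∀ A B : Matrix ι ι ℂ, (∀ i j, ‖A i j‖ ≤ M) → (∀ i j, ‖B i j‖ ≤ N) →
      ‖F A B‖ ≤ C := by
  have hc : ∀ M : ℝ, IsCompact {A : Matrix ι ι ℂ | ∀ i j, ‖A i j‖ ≤ M} := fun M => by
    have h : {A : ι → ι → ℂ | ∀ i j, ‖A i j‖ ≤ M} =
        Set.univ.pi fun _ => Set.univ.pi fun _ => Metric.closedBall 0 M := by
      ext A
      simp [Set.mem_pi]
    exact h ▸ isCompact_univ_pi fun _ => isCompact_univ_pi fun _ => isCompact_closedBall _ _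
  obtain ⟨C, hC⟩ := ((hc M).prod (hc N)).exists_bound_of_continuousOn hF.continuousOn
  exact ⟨C, fun A B hA hB => hC (A, B) ⟨hA, hB⟩⟩

variable {A B : ℂ → Matrix (Fin (V.natDegree + 1)) (Fin (V.natDegree + 1)) ℂ}

theorem IsEvenSolution.exists_tendsto_one (hA : IsEvenSolution V n A) :
    ∃ A' : ℂ → Matrix (Fin (V.natDegree + 1)) (Fin (V.natDegree + 1)) ℂ,
      Tendsto A' (Bornology.cobounded ℂ ⊓ 𝓟 (Gam V.natDegree)ᶜ) (𝓝 1) ∧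
      ∀ᶠ z in Bornology.cobounded ℂ ⊓ 𝓟 (Gam V.natDegree)ᶜ,
        A z = A' z * normMatrix V.natDegree n z := by
  obtain ⟨E, hE, h⟩ := hA.normalisation
  refine ⟨fun z => 1 + E z, ?_, h⟩
  have h0 : Tendsto E (Bornology.cobounded ℂ ⊓ 𝓟 (Gam V.natDegree)ᶜ) (𝓝 0) :=
    tendsto_pi_nhds.2 fun i => tendsto_pi_nhds.2 fun j =>
      (hE i j).trans_tendsto (tendsto_inv₀_cobounded.mono_left inf_le_left)
  simpa using h0.const_add (1 : Matrix (Fin (V.natDegree + 1)) (Fin (V.natDegree + 1)) ℂ)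

/-- A function of two solutions that does not change when both are multiplied from the right by the
same matrix of determinant `1` is constant. -/
theorem IsEvenSolution.eq_of_invariant (hV : Admissible V) (hA : IsEvenSolution V n A)
    (hB : IsEvenSolution V n B)
    {F : Matrix (Fin (V.natDegree + 1)) (Fin (V.natDegree + 1)) ℂ →
      Matrix (Fin (V.natDegree + 1)) (Fin (V.natDegree + 1)) ℂ → ℂ}
    (hF : Continuous (Function.uncurry F))
    (hinv : ∀ X Y J, J.det = 1 → F (X * J) (Y * J) = F X Y)
    (han : AnalyticOnNhd ℂ (fun z => F (A z) (B z)) (Gam V.natDegree)ᶜ) :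
    ∀ z ∉ Gam V.natDegree, F (A z) (B z) = F 1 1 := by
  have hD := hV.two_le
  refine eq_limit_of_no_jump hD han (fun x hx => ?_) (fun k hk x hx hx0 => ?_) ?_
  · obtain ⟨r, hr, M, hM⟩ := hA.bounded x hx
    obtain ⟨r', hr', N, hN⟩ := hB.bounded x hx
    obtain ⟨C, hC⟩ := exists_norm_le_of_continuous hF M N
    exact ⟨min r r', lt_min hr hr', C, fun z hz hzx => hC _ _
      (hM z hz (hzx.trans_le (min_le_left _ _))) (hN z hz (hzx.trans_le (min_le_right _ _)))⟩
  · obtain ⟨Ap, Am, hAp, hAm, -, -, hAJ⟩ := hA.boundary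
    obtain ⟨Bp, Bm, hBp, hBm, -, -, hBJ⟩ := hB.boundary
    have hxG : x ∈ Gam V.natDegree \ {0} := ⟨(mem_Gam_iff hD).2 ⟨k, hk, hx⟩, hx0⟩
    -- The value from the right serves for both sides: the left boundary values arise from the right
    -- ones by multiplication with the same jump matrix, which `F` does not see.
    refine ⟨F (Am x) (Bm x), ?_⟩
    rintro s (rfl | rfl) c hc
    · rw [← hinv _ _ _ (det_jump V x), ← hAJ x hxG, ← hBJ x hxG]
      exact (hF.tendsto (Ap x, Bp x)).comp
        ((hAp k hk x hx hx0 c hc).prodMk_nhds (hBp k hk x hx hx0 c hc))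
    · exact (hF.tendsto (Am x, Bm x)).comp
        ((hAm k hk x hx hx0 c hc).prodMk_nhds (hBm k hk x hx hx0 c hc))
  · obtain ⟨A', hA', hA2⟩ := hA.exists_tendsto_one
    obtain ⟨B', hB', hB2⟩ := hB.exists_tendsto_one
    have hlim : Tendsto (fun z => F (A' z) (B' z)) _ (𝓝 (F 1 1)) :=
      (hF.tendsto (1, 1)).comp (hA'.prodMk_nhds hB')
    have hne : ∀ᶠ z in Bornology.cobounded ℂ ⊓ 𝓟 (Gam V.natDegree)ᶜ, z ≠ 0 :=
      Filter.Eventually.filter_mono inf_le_left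
        ((tendsto_norm_cobounded_atTop.eventually_gt_atTop 0).mono fun z => norm_pos_iff.1)
    refine hlim.congr' ?_
    filter_upwards [hA2, hB2, hne] with z h1 h2 hz
    rw [h1, h2, hinv _ _ _ (det_normMatrix hD n hz)]

theorem IsEvenSolution.det_eq_one (hV : Admissible V) (hA : IsEvenSolution V n A) :
    ∀ z ∉ Gam V.natDegree, (A z).det = 1 := by
  intro z hz
  have := hA.eq_of_invariant hV hA (F := fun X _ => X.det) continuous_fst.matrix_det
    (fun X _ J hJ => by rw [Matrix.det_mul, hJ, mul_one]) (analyticOnNhd_det hA.analytic) z hz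
  rwa [Matrix.det_one] at this

/-- The adjugate replaces the inverse, so that the entries of `A · adj B` are polynomials in those
of `A` and `B`. The product is invariant because `J · adj J = det J = 1`, so it is the identity
everywhere. -/
theorem IsEvenSolution.eqOn (hV : Admissible V) (hA : IsEvenSolution V n A)
    (hB : IsEvenSolution V n B) : Set.EqOn A B (Gam V.natDegree)ᶜ := by
  intro z hz
  have h : A z * (B z).adjugate = 1 := by
    ext i j
    have := hA.eq_of_invariant hV hB (F := fun X Y => (X * Y.adjugate) i j)
      ((continuous_fst.matrix_mul continuous_snd.matrix_adjugate).matrix_elem i j)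
      (fun X Y J hJ => by
        rw [Matrix.adjugate_mul_distrib, Matrix.mul_assoc, ← Matrix.mul_assoc J,
          Matrix.mul_adjugate, hJ, one_smul, Matrix.one_mul]) ?_ z hz
    · simpa using this
    · simp only [Matrix.mul_apply]
      exact Finset.analyticOnNhd_fun_sum _ fun k _ =>
        (hA.analytic i k).mul (analyticOnNhd_adjugate hB.analytic k j)
  have h2 : (B z).adjugate * B z = 1 := by
    rw [Matrix.adjugate_mul, hB.det_eq_one hV z hz, one_smul]
  rw [← Matrix.mul_one (A z), ← h2, ← Matrix.mul_assoc, h, Matrix.one_mul]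

end

end SymplecticRHP

end

theorem mainTheorem3 (V : Polynomial ℝ) (hpos : 2 ≤ V.natDegree) (heven : Even V.natDegree)
    (hlead : 0 < V.leadingCoeff) (n : ℕ) :
    (∃ P : ℕ → Polynomial ℝ, SymplecticRHP.IsSkewOrthogonal V P) ∧
    (∀ j ∈ Set.Icc 1 (V.natDegree - 1),
      ∃! S : Polynomial ℂ, SymplecticRHP.IsAuxiliary V n j S) ∧
    ∀ (P : ℕ → Polynomial ℝ) (R : ℕ → Polynomial ℂ),
      SymplecticRHP.IsSkewOrthogonal V P →
      (∀ j ∈ Set.Icc 1 (V.natDegree - 1), SymplecticRHP.IsAuxiliary V n j (R j)) →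
      (1 ≤ n → SymplecticRHP.skewNorm V P (n - 1) ≠ 0) ∧
      SymplecticRHP.IsEvenSolution V n (SymplecticRHP.evenSolution V P R n) ∧
      (∀ A : ℂ → Matrix (Fin (V.natDegree + 1)) (Fin (V.natDegree + 1)) ℂ,
        SymplecticRHP.IsEvenSolution V n A →
        Set.EqOn A (SymplecticRHP.evenSolution V P R n) (SymplecticRHP.Gam V.natDegree)ᶜ) ∧
      ∀ z ∉ SymplecticRHP.Gam V.natDegree,
        (SymplecticRHP.evenSolution V P R n z).det = 1 := by
  have hV : SymplecticRHP.Admissible V := ⟨hpos, heven, hlead⟩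
  refine ⟨hV.exists_isSkewOrthogonal, fun j _ => hV.existsUnique_isAuxiliary n j,
    fun P R hP hR => ?_⟩
  have hS := SymplecticRHP.isEvenSolution_evenSolution hV hP hR
  exact ⟨fun _ => hP.skewNorm_ne_zero hV (n - 1), hS, fun A hA => hA.eqOn hV hS, hS.det_eq_one hV⟩
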